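/- Let $K$ be an algebraically closed field of characteristic zero, and let $f\in K[x_0,\dots,x_5]$ be a homogeneous cubic form such that $\operatorname{hess}_f=\det\big(\partial^2 f/\partial x_i\partial x_j\big)=0$ and such that the cubic hypersurface $X=V(f)\subset\mathbb P^5$ is not a cone (i.e. there is no point $p\in X$ such that for every $q\in X$ the line $\langle p,q\rangle$ is contained in $X$). Notation, for a form $f$ in $N+1$ variables with $\operatorname{hess}_f=0$ and $X=V(f)\subset\mathbb P^N$: $\Phi_X:\mathbb P^N\dashrightarrow(\mathbb P^N)^*$, $p\mapsto(\frac{\partial f}{\partial x_0}(p):\dots:\frac{\partial f}{\partial x_N}(p))$ is the polar map and $Z=\overline{\Phi_X(\mathbb P^N)}$ is the polar image; $(T_zZ)^*\subset\mathbb P^N$ is the linear space dual to the projective tangent space to $Z$ at a smooth point $z$; $Z^*=\overline{\bigcup_{z\in Z_{\rm reg}}(T_zZ)^*}\subset\mathbb P^N$ is the dual variety of $Z$. The Perazzo map $\mathcal P_X:\mathbb P^N\dashrightarrow\mathbb G(\operatorname{codim}(Z)-1,N)$, $p\mapsto(T_{\Phi_X(p)}Z)^*$, is defined where $\Phi_X(p)$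 is defined and is a smooth point of $Z$; $W$ is the closure of its image and $\mu=\dim W$. A congruence (of order one) of linear spaces is an irreducible family of linear spaces of a fixed dimension such that a unique member passes through the general point of $\mathbb P^N$. An irreducible cubic hypersurface $X\subset\mathbb P^N$ with vanishing hessian, not a cone, is a Special Perazzo Cubic Hypersurface if the closures $\overline{\mathcal P_X^{-1}(w)}$, $w\in W$ general, are linear spaces of dimension $N-\mu$ which form a congruence and all contain a fixed linear space $\mathbb P^{N-\mu-1}$. Then: (i) $X$ is a Special Perazzo Cubic Hypersurface (in particular, it is irreducible) and $Z^*$ is an irreducible conic (in some plane of $\mathbb P^5$). Moreover $X$ is a scroll in planes tangent to the conic $Z^*$: there is a closed irreducible family of planes contained in $X$ such that a unique member passes through the general point of $X$, and each of its members contains the tangent line to $Z^*$ at some point of $Z^*$. (ii) There is a cubic form $D\in K[x_3,x_4,x_5]$ such that $X$ is projectively equivalent to $$V\big(x_0x_4^2+2x_1x_4x_5+x_2x_5^2+D(x_3,x_4,x_5)\big)\subset\mathbb P^5 .$$ -/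

import Mathlib

open MvPolynomial

namespace PerazzoCubic

noncomputable section

/-! ### Projective space and its Zariski topology -/

/-- The projective space of dimension `N` over `K`. The dual projective space is identified with it
by means of the dual coordinates. -/
abbrev PSpace (K : Type*) [Field K] (N : ℕ) : Type _ :=
  Projectivization K (Fin (N + 1) → K)

section

variable {K : Type*} [Field K] {N : ℕ}

/-- The nonzero vectors that represent a point of `S`. -/
def affineCone (S : Set (PSpace K N)) : Set (Fin (N + 1) → K) :=
  {v | ∃ h : v ≠ 0, Projectivization.mk K v h ∈ S}

/-- The homogeneous ideal of `S`: all polynomials vanishing on the affine cone over `S`. -/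
def projIdeal (S : Set (PSpace K N)) : Ideal (MvPolynomial (Fin (N + 1)) K) :=
  vanishingIdeal K (affineCone S)

/-- The Zariski closure of a subset of projective space. -/
def zariskiClosure (S : Set (PSpace K N)) : Set (PSpace K N) :=
  {p | p.rep ∈ zeroLocus K (projIdeal S)}

/-- The dimension of the affine cone over `S`, that is `dim S + 1`, computed as the transcendence
degree of the homogeneous coordinate ring of (the Zariski closure of) `S`. -/
def coneDim (S : Set (PSpace K N)) : ℕ :=
  Cardinal.toNat (Algebra.trdeg K (MvPolynomial (Fin (N + 1)) K ⧸ projIdeal S))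

/-- `P` holds at the general point of the irreducible set `S`: at all points of a nonempty
(principal) Zariski open subset of `S`. -/
def ForGeneralPoint (S : Set (PSpace K N)) (P : PSpace K N → Prop) : Prop :=
  ∃ (d : ℕ) (g : MvPolynomial (Fin (N + 1)) K), g.IsHomogeneous d ∧
    (∃ p ∈ S, eval p.rep g ≠ 0) ∧ ∀ p ∈ S, eval p.rep g ≠ 0 → P p

/-- The projective linear space given by a linear subspace of `K ^ (N + 1)`. -/
def linearSpace (L : Submodule K (Fin (N + 1) → K)) : Set (PSpace K N) :=
  {p | p.submodule ≤ L}

/-- The (embedded, projective) Zariski tangent space at `z` of the closure of `S`, as a linear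
subspace of `K ^ (N + 1)`. -/
def tangentSpace (S : Set (PSpace K N)) (z : PSpace K N) : Submodule K (Fin (N + 1) → K) where
  carrier := {h | ∀ g ∈ projIdeal S, ∑ i, eval z.rep (pderiv i g) * h i = 0}
  zero_mem' := by
    intro g _
    simp
  add_mem' := by
    intro a b ha hb g hg
    simp only [Pi.add_apply, mul_add, Finset.sum_add_distrib, ha g hg, hb g hg, add_zero]
  smul_mem' := by
    intro c a ha g hg
    have : ∀ i, eval z.rep (pderiv i g) * (c • a) i = c * (eval z.rep (pderiv i g) * a i) := by
      intro i
      simp only [Pi.smul_apply, smul_eq_mul]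
      ring
    simp only [this, ← Finset.mul_sum, ha g hg, mul_zero]

/-- The smooth points of `S`, for an irreducible closed set `S`. -/
def regularLocus (S : Set (PSpace K N)) : Set (PSpace K N) :=
  {z | z ∈ S ∧ Module.finrank K (tangentSpace S z) = coneDim S}

/-- The linear subspace of `P ^ N` dual to a linear subspace of the dual projective space. -/
def dualSubspace (T : Submodule K (Fin (N + 1) → K)) : Submodule K (Fin (N + 1) → K) where
  carrier := {x | ∀ h ∈ T, ∑ i, h i * x i = 0}
  zero_mem' := by
    intro h _
    simp
  add_mem' := by
    intro a b ha hb h hh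
    simp only [Pi.add_apply, mul_add, Finset.sum_add_distrib, ha h hh, hb h hh, add_zero]
  smul_mem' := by
    intro c a ha h hh
    have : ∀ i, h i * (c • a) i = c * (h i * a i) := by
      intro i
      simp only [Pi.smul_apply, smul_eq_mul]
      ring
    simp only [this, ← Finset.mul_sum, ha h hh, mul_zero]

/-! ### Families of linear spaces

Families of linear spaces are sets of `k`-dimensional linear subspaces of `K ^ (N + 1)`, that is
subsets of the Grassmannian. Its Zariski topology is the quotient topology from the space of linearly
independent `k`-tuples of vectors (on which `GL k` acts), an open set in affine space. -/

/-- The bases `(a (i, ·))`, `i < k`, of the members of the family `F`. -/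
def frames (k : ℕ) (F : Set (Submodule K (Fin (N + 1) → K))) :
    Set (Fin k × Fin (N + 1) → K) :=
  {a | LinearIndependent K (fun (i : Fin k) (j : Fin (N + 1)) => a (i, j)) ∧
    Submodule.span K (Set.range fun (i : Fin k) (j : Fin (N + 1)) => a (i, j)) ∈ F}

/-- The Zariski closure of a family of `k`-dimensional linear subspaces in the Grassmannian. -/
def grassClosure (k : ℕ) (F : Set (Submodule K (Fin (N + 1) → K))) :
    Set (Submodule K (Fin (N + 1) → K)) :=
  {L | Module.finrank K L = k ∧ frames k {L} ⊆ zeroLocus K (vanishingIdeal K (frames k F))}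

/-- The dimension of a family of `k`-dimensional linear subspaces: the space of bases of its members
is a bundle over the family with fibre the `k ^ 2`-dimensional group `GL k`. -/
def familyDim (k : ℕ) (F : Set (Submodule K (Fin (N + 1) → K))) : ℤ :=
  (Cardinal.toNat (Algebra.trdeg K
    (MvPolynomial (Fin k × Fin (N + 1)) K ⧸ vanishingIdeal K (frames k F))) : ℤ) - (k : ℤ) ^ 2

/-- The family `F` of `k`-dimensional linear subspaces is irreducible. -/
def IsIrreducibleFamily (k : ℕ) (F : Set (Submodule K (Fin (N + 1) → K))) : Prop :=
  (∀ L ∈ F, Module.finrank K L = k) ∧ (vanishingIdeal K (frames k F)).IsPrime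

/-- `U` is a nonempty (principal) Zariski open subset of the family `F` of `k`-dimensional linear
subspaces. -/
def IsOpenSubfamily (k : ℕ) (U F : Set (Submodule K (Fin (N + 1) → K))) : Prop :=
  U.Nonempty ∧ ∃ g : MvPolynomial (Fin k × Fin (N + 1)) K,
    U = {L | L ∈ F ∧ ∃ a ∈ frames k {L}, eval a g ≠ 0}

/-- A congruence (of order one) of linear spaces of projective dimension `k - 1`: an irreducible
family of them such that a unique member passes through the general point of `P ^ N`. -/
def IsCongruence (k : ℕ) (F : Set (Submodule K (Fin (N + 1) → K))) : Prop :=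
  IsIrreducibleFamily k F ∧
    ForGeneralPoint (Set.univ : Set (PSpace K N)) fun p => ∃! L, L ∈ F ∧ p ∈ linearSpace L

/-- `F` is a closed irreducible family of linear spaces of projective dimension `k - 1` contained
in `X`, with a unique member through the general point of `X`. -/
def IsScrollStructure (k : ℕ) (X : Set (PSpace K N))
    (F : Set (Submodule K (Fin (N + 1) → K))) : Prop :=
  IsIrreducibleFamily k F ∧ grassClosure k F = F ∧ (∀ L ∈ F, linearSpace L ⊆ X) ∧
    ForGeneralPoint X fun p => ∃! L, L ∈ F ∧ p ∈ linearSpace L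

/-- `X` is a scroll in planes, each of which is tangent to `C`: it contains the tangent line to `C`
at some point `r` of `C`. -/
def IsScrollInPlanesTangentTo (X C : Set (PSpace K N)) : Prop :=
  ∃ F : Set (Submodule K (Fin (N + 1) → K)), IsScrollStructure 3 X F ∧
    ∀ L ∈ F, ∃ r ∈ C, tangentSpace C r ≤ L

/-- `C` is an irreducible conic in some plane of `P ^ N`. -/
def IsConic (C : Set (PSpace K N)) : Prop :=
  ∃ (φ : (Fin 3 → K) →ₗ[K] (Fin (N + 1) → K)) (q : MvPolynomial (Fin 3) K),
    Function.Injective φ ∧ q.IsHomogeneous 2 ∧ Irreducible q ∧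
      C = {p | ∃ v, φ v = p.rep ∧ eval v q = 0}

/-! ### Hypersurfaces -/

/-- The hypersurface `V(f)`, for a form `f`. -/
def hypersurface (f : MvPolynomial (Fin (N + 1)) K) : Set (PSpace K N) :=
  {p | eval p.rep f = 0}

/-- The vertex of `X`: the points `p` of `X` such that `X` contains the line joining `p` to any point
of `X`. -/
def vertex (X : Set (PSpace K N)) : Set (PSpace K N) :=
  {p | p ∈ X ∧ ∀ q ∈ X, linearSpace (p.submodule ⊔ q.submodule) ⊆ X}

/-- `X` is a cone if its vertex is not empty. -/
def IsCone (X : Set (PSpace K N)) : Prop :=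
  (vertex X).Nonempty

/-- The hessian of `f`, i.e. the determinant of its matrix of second derivatives. -/
def hessian (f : MvPolynomial (Fin (N + 1)) K) : MvPolynomial (Fin (N + 1)) K :=
  (Matrix.of fun i j => pderiv i (pderiv j f)).det

/-- The vector of first derivatives of `f` at `v`. -/
def grad (f : MvPolynomial (Fin (N + 1)) K) (v : Fin (N + 1) → K) : Fin (N + 1) → K :=
  fun i => eval v (pderiv i f)

/-- The polar map of `V(f)` is defined at `p` and takes the value `z` there. -/
def PolarMapsTo (f : MvPolynomial (Fin (N + 1)) K) (p z : PSpace K N) : Prop :=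
  ∃ h : grad f p.rep ≠ 0, Projectivization.mk K (grad f p.rep) h = z

/-- The polar image `Z`: the closure of the image of the polar map, in the dual space. -/
def polarImage (f : MvPolynomial (Fin (N + 1)) K) : Set (PSpace K N) :=
  zariskiClosure {z | ∃ p, PolarMapsTo f p z}

/-- The codimension of the polar image in the dual projective space. -/
def polarCodim (f : MvPolynomial (Fin (N + 1)) K) : ℕ :=
  N + 1 - coneDim (polarImage f)

/-- The dual variety `Z^*` of the polar image: the closure of the union of the linear spaces dual to
the tangent spaces at the smooth points of `Z`. -/
def polarImageDual (f : MvPolynomial (Fin (N + 1)) K) : Set (PSpace K N) :=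
  zariskiClosure
    (⋃ z ∈ regularLocus (polarImage f), linearSpace (dualSubspace (tangentSpace (polarImage f) z)))

/-- The Perazzo map of `V(f)` is defined at `p`, which means that the polar map sends `p` to a smooth
point `z` of `Z`, and its value there is `L`, the linear space dual to the tangent space to `Z`
at `z`. -/
def PerazzoMapsTo (f : MvPolynomial (Fin (N + 1)) K) (p : PSpace K N)
    (L : Submodule K (Fin (N + 1) → K)) : Prop :=
  ∃ z ∈ regularLocus (polarImage f), PolarMapsTo f p z ∧
    dualSubspace (tangentSpace (polarImage f) z) = L

/-- The closure `W`, in the Grassmannian of linear spaces of dimension `codim Z - 1`, of the image of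
the Perazzo map. -/
def perazzoImage (f : MvPolynomial (Fin (N + 1)) K) : Set (Submodule K (Fin (N + 1) → K)) :=
  grassClosure (polarCodim f) {L | ∃ p, PerazzoMapsTo f p L}

/-- The Perazzo rank, i.e. the dimension of the image of the Perazzo map. -/
def perazzoRank (f : MvPolynomial (Fin (N + 1)) K) : ℤ :=
  familyDim (polarCodim f) (perazzoImage f)

/-- The closure of the fibre of the Perazzo map over `w`. -/
def perazzoFiber (f : MvPolynomial (Fin (N + 1)) K) (w : Submodule K (Fin (N + 1) → K)) :
    Set (PSpace K N) :=
  zariskiClosure {p | PerazzoMapsTo f p w}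

/-- `V(f)` is a Special Perazzo Cubic Hypersurface: an irreducible cubic hypersurface with vanishing
hessian, not a cone, such that the closures of the general fibres of its Perazzo map form a congruence
of linear spaces of dimension `N - μ` passing through a fixed linear space of dimension `N - μ - 1`,
where `μ` is the Perazzo rank. -/
structure IsSpecialPerazzoCubic (f : MvPolynomial (Fin (N + 1)) K) : Prop where
  isHomogeneous : f.IsHomogeneous 3
  irreducible : Irreducible f
  hessian_eq_zero : hessian f = 0
  not_isCone : ¬ IsCone (hypersurface f)
  exists_congruence :
    ∃ (U : Set (Submodule K (Fin (N + 1) → K))) (L : Submodule K (Fin (N + 1) → K)) (k : ℕ),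
      IsOpenSubfamily (polarCodim f) U (perazzoImage f) ∧
      (k : ℤ) = N - perazzoRank f + 1 ∧ (Module.finrank K L : ℤ) = N - perazzoRank f ∧
      (∀ w ∈ U, ∃ M : Submodule K (Fin (N + 1) → K),
        perazzoFiber f w = linearSpace M ∧ Module.finrank K M = k ∧ L ≤ M) ∧
      IsCongruence k {M | ∃ w ∈ U, perazzoFiber f w = linearSpace M}

/-- The form `f (A x)`. -/
def linearSubst (A : Matrix (Fin (N + 1)) (Fin (N + 1)) K) (f : MvPolynomial (Fin (N + 1)) K) :
    MvPolynomial (Fin (N + 1)) K :=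
  bind₁ (fun i => ∑ j, C (A i j) * X j) f

/-- The hypersurfaces `V(f)` and `V(g)` are projectively equivalent. -/
def ProjectivelyEquivalent (f g : MvPolynomial (Fin (N + 1)) K) : Prop :=
  ∃ (A : GL (Fin (N + 1)) K) (c : Kˣ), g = C (c : K) * linearSubst (A : Matrix _ _ K) f

end

/-- The form `x₀x₄² + 2x₁x₄x₅ + x₂x₅² + D(x₃,x₄,x₅)`. -/
def canonicalForm {K : Type*} [Field K] (D : MvPolynomial (Fin 3) K) :
    MvPolynomial (Fin (5 + 1)) K :=
  X 0 * X 4 ^ 2 + 2 * X 1 * X 4 * X 5 + X 2 * X 5 ^ 2 + rename ![3, 4, 5] D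

end

end PerazzoCubic

namespace PerazzoCubic

/-! ### Polynomial functions -/

section PolyFun

variable {K : Type*} [Field K] {σ : Type*}

/-! Let T be the symmetric trilinear form with T(x, x, x) = 6 f(x). Since X is not a cone, T u = 0
only for u = 0 (`isNondegSymm_polarForm`), and the vanishing of the hessian gives a nonzero
polynomial vector field z with T(a, z(a), ·) = 0 for all a (`exists_kernel_field`). The algebra
comes from differentiating this identity.

Let J(a) be the span of z(a) and of the derivatives of z at a. Then J(a) is isotropic for T(a, ·,
·), and T a maps it onto the range of T(z(a)) while killing z(a); in dimension 6 this forces T(z(a))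
to have rank at most 2 (`finrank_range_field_le_two`). One of its two linear factors vanishes on all
values of z, which improves the bound to rank 1 (`rankLEOne_field`), so T(z(a)) = ℓ_a ⊗ ℓ_a. The
values of z are annihilated by all the ℓ_a; comparing dimensions shows that the ℓ_a span exactly a
plane (`exists_normalFrame`). If ℓ, m are two independent ones, the forms ℓ², ℓm, m² are, up to
constants, T(e₀), T(e₁), T(e₂) for vectors killed by ℓ and m. Completing ℓ = x₄ and m = x₅ to
coordinates gives the canonical form (ii).

In these coordinates the geometry is explicit. The derivatives of f along e₀, e₁, e₂ are x₄², 2x₄x₅,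
x₅², so Z is the quadric y₁² = 4y₀y₂ of rank 3. Its dual is the conic of the vectors r²e₀ − sr e₁ +
s²e₂, and the Perazzo map sends x to the point with (s : r) = (x₄ : x₅) (`perazzoMapsTo_iff`). The
closed fibres are the hyperplanes rx₄ = sx₅, a pencil with base x₄ = x₅ = 0. Where (x₄ : x₅) = (s :
r), f is unchanged by adding vectors of the tangent line to the conic at (s : r); hence the planes
joining this line to points of X.

Irreducibility and dimensions are read off polynomial parametrizations: the vanishing ideal is the
kernel of a map of polynomial rings, hence prime (`vanishingIdeal_eq_ker`), and an integral
extension gives the transcendence degree (`trdeg_quotient_ker`). Limits of planes of the scroll are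
controlled by polynomial relations between their vectors (`exists_tangent_le`). -/

theorem linearMap_apply_eq_sum_single {n : ℕ} {M : Type*} [AddCommGroup M] [Module K M]
    (ℓ : (Fin n → K) →ₗ[K] M) (v : Fin n → K) : ℓ v = ∑ i, v i • ℓ (Pi.single i 1) := by
  rw [LinearMap.pi_apply_eq_sum_univ ℓ v]
  refine Finset.sum_congr rfl fun i _ => ?_
  congr 2
  funext j
  simp [Pi.single_apply, eq_comm]

/-- A function on affine space that is given by a polynomial. -/
def IsPolyFun (g : (σ → K) → K) : Prop :=
  ∃ p : MvPolynomial σ K, ∀ a, eval a p = g a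

theorem isPolyFun_eval (p : MvPolynomial σ K) : IsPolyFun fun a => eval a p := ⟨p, fun _ => rfl⟩

theorem isPolyFun_const (c : K) : IsPolyFun fun _ : σ → K => c := ⟨C c, fun _ => by simp⟩

theorem isPolyFun_coord (i : σ) : IsPolyFun fun a : σ → K => a i := ⟨X i, fun _ => by simp⟩

theorem IsPolyFun.add {g h : (σ → K) → K} (hg : IsPolyFun g) (hh : IsPolyFun h) :
    IsPolyFun fun a => g a + h a := by
  obtain ⟨p, hp⟩ := hg
  obtain ⟨q, hq⟩ := hh
  exact ⟨p + q, fun a => by simp [hp, hq]⟩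

theorem IsPolyFun.sub {g h : (σ → K) → K} (hg : IsPolyFun g) (hh : IsPolyFun h) :
    IsPolyFun fun a => g a - h a := by
  obtain ⟨p, hp⟩ := hg
  obtain ⟨q, hq⟩ := hh
  exact ⟨p - q, fun a => by simp [hp, hq]⟩

theorem IsPolyFun.mul {g h : (σ → K) → K} (hg : IsPolyFun g) (hh : IsPolyFun h) :
    IsPolyFun fun a => g a * h a := by
  obtain ⟨p, hp⟩ := hg
  obtain ⟨q, hq⟩ := hh
  exact ⟨p * q, fun a => by simp [hp, hq]⟩

theorem IsPolyFun.pow {g : (σ → K) → K} (hg : IsPolyFun g) (n : ℕ) :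
    IsPolyFun fun a => g a ^ n := by
  obtain ⟨p, hp⟩ := hg
  exact ⟨p ^ n, fun a => by simp [hp]⟩

theorem IsPolyFun.sum {ι : Type*} (s : Finset ι) {g : ι → (σ → K) → K}
    (hg : ∀ i, IsPolyFun (g i)) : IsPolyFun fun a => ∑ i ∈ s, g i a := by
  choose p hp using hg
  exact ⟨∑ i ∈ s, p i, fun a => by simp [hp]⟩

theorem IsPolyFun.comp {τ : Type*} {g : (σ → K) → K} (hg : IsPolyFun g)
    {φ : (τ → K) → σ → K} (hφ : ∀ i, IsPolyFun fun a => φ a i) : IsPolyFun fun a => g (φ a) := by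
  obtain ⟨p, hp⟩ := hg
  choose q hq using hφ
  refine ⟨bind₁ q p, fun a => ?_⟩
  change eval a (bind₁ q p) = g (φ a)
  have : φ a = fun i => eval a (q i) := funext fun i => (hq i a).symm
  rw [← hp, this]
  simp only [← coe_aeval_eq_eval]
  exact aeval_bind₁ _ _ _

theorem IsPolyFun.linearMap {n : ℕ} (ℓ : (Fin n → K) →ₗ[K] K) {φ : (σ → K) → Fin n → K}
    (hφ : ∀ i, IsPolyFun fun a => φ a i) : IsPolyFun fun a => ℓ (φ a) := by
  have : (fun a => ℓ (φ a)) = fun a => ∑ i, φ a i * ℓ (Pi.single i 1) := by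
    funext a
    rw [linearMap_apply_eq_sum_single ℓ (φ a)]
    simp
  rw [this]
  exact .sum _ fun i => (hφ i).mul (isPolyFun_const _)

theorem IsPolyFun.bilin {n : ℕ} (B : (Fin n → K) →ₗ[K] (Fin n → K) →ₗ[K] K)
    {φ ψ : (σ → K) → Fin n → K}
    (hφ : ∀ i, IsPolyFun fun a => φ a i) (hψ : ∀ i, IsPolyFun fun a => ψ a i) :
    IsPolyFun fun a => B (φ a) (ψ a) := by
  have : (fun a => B (φ a) (ψ a)) = fun a => ∑ i, φ a i * B (Pi.single i 1) (ψ a) := by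
    funext a
    rw [linearMap_apply_eq_sum_single B (φ a), LinearMap.sum_apply]
    simp
  rw [this]
  exact .sum _ fun i => (hφ i).mul (.linearMap _ hψ)

theorem IsPolyFun.eq_zero_or_eq_zero [Infinite K] {g h : (σ → K) → K} (hg : IsPolyFun g)
    (hh : IsPolyFun h) (H : ∀ a, g a * h a = 0) : (∀ a, g a = 0) ∨ ∀ a, h a = 0 := by
  obtain ⟨p, hp⟩ := hg
  obtain ⟨q, hq⟩ := hh
  have : p * q = 0 := MvPolynomial.funext fun a => by simp [hp, hq, H]
  rcases mul_eq_zero.1 this with rfl | rfl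
  · exact .inl fun a => by simp [← hp]
  · exact .inr fun a => by simp [← hq]

/-- The density principle behind the general-point arguments: the set h ≠ 0 is dense as soon as it
is nonempty, so an identity need only be checked there. -/
theorem IsPolyFun.eq_zero_of_mul [Infinite K] {g h : (σ → K) → K} (hg : IsPolyFun g)
    (hh : IsPolyFun h) (H : ∀ a, h a ≠ 0 → g a = 0) {b : σ → K} (hb : h b ≠ 0) (a : σ → K) :
    g a = 0 := by
  rcases hg.eq_zero_or_eq_zero hh fun a => by
    by_cases h0 : h a = 0
    · simp [h0]
    · simp [H a h0] with h | h
  · exact h a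
  · exact absurd (h b) hb

end PolyFun

/-! ### Polynomial vector fields and their derivatives -/

section VectorField

variable {K : Type*} [Field K] {n m : ℕ}

/-- The value of a polynomial map at a point. -/
noncomputable def fieldAt (z : Fin m → MvPolynomial (Fin n) K) (a : Fin n → K) : Fin m → K :=
  fun i => eval a (z i)

/-- The derivative of a polynomial at a point. -/
noncomputable def polyDeriv (p : MvPolynomial (Fin n) K) (a : Fin n → K) : (Fin n → K) →ₗ[K] K :=
  ∑ j, eval a (pderiv j p) • LinearMap.proj j

/-- The derivative of a polynomial map at a point. -/
noncomputable def fieldDeriv (z : Fin m → MvPolynomial (Fin n) K) (a : Fin n → K) :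
    (Fin n → K) →ₗ[K] (Fin m → K) :=
  LinearMap.pi fun i => polyDeriv (z i) a

theorem fieldDeriv_apply (z : Fin m → MvPolynomial (Fin n) K) (a y : Fin n → K) (i : Fin m) :
    fieldDeriv z a y i = polyDeriv (z i) a y := rfl

theorem polyDeriv_apply (p : MvPolynomial (Fin n) K) (a y : Fin n → K) :
    polyDeriv p a y = ∑ j, eval a (pderiv j p) * y j := by
  simp [polyDeriv]

theorem isPolyFun_fieldAt (z : Fin m → MvPolynomial (Fin n) K) (i : Fin m) :
    IsPolyFun fun a => fieldAt z a i := isPolyFun_eval _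

@[simp] theorem fieldAt_X (a : Fin n → K) : fieldAt X a = a := by
  funext i
  simp [fieldAt]

@[simp] theorem fieldDeriv_X (a y : Fin n → K) : fieldDeriv X a y = y := by
  funext i
  simp only [fieldDeriv_apply, polyDeriv_apply, pderiv_X]
  simp [Pi.single_apply, apply_ite]

theorem polyDeriv_mul (p q : MvPolynomial (Fin n) K) (a y : Fin n → K) :
    polyDeriv (p * q) a y = eval a p * polyDeriv q a y + eval a q * polyDeriv p a y := by
  simp only [polyDeriv_apply, Finset.mul_sum, ← Finset.sum_add_distrib]
  refine Finset.sum_congr rfl fun j _ => ?_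
  simp
  ring

theorem polyDeriv_C_mul (c : K) (q : MvPolynomial (Fin n) K) (a y : Fin n → K) :
    polyDeriv (C c * q) a y = c * polyDeriv q a y := by
  rw [polyDeriv_mul]
  simp [polyDeriv_apply]

theorem polyDeriv_sum {ι : Type*} (s : Finset ι) (p : ι → MvPolynomial (Fin n) K)
    (a y : Fin n → K) : polyDeriv (∑ i ∈ s, p i) a y = ∑ i ∈ s, polyDeriv (p i) a y := by
  simp only [polyDeriv_apply, map_sum, Finset.sum_mul]
  exact Finset.sum_comm

theorem linearMap_eq_sum (ℓ : (Fin m → K) →ₗ[K] K) (v : Fin m → K) :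
    ℓ v = ∑ i, ℓ (Pi.single i 1) * v i := by
  rw [linearMap_apply_eq_sum_single ℓ v]
  simp [mul_comm]

theorem bilin_eq_sum (B : (Fin m → K) →ₗ[K] (Fin m → K) →ₗ[K] K) (v w : Fin m → K) :
    B v w = ∑ i, ∑ j, B (Pi.single i 1) (Pi.single j 1) * (v i * w j) := by
  have h := linearMap_eq_sum (B.flip w) v
  rw [LinearMap.flip_apply] at h
  rw [h]
  refine Finset.sum_congr rfl fun i _ => ?_
  rw [LinearMap.flip_apply, linearMap_eq_sum, Finset.sum_mul]
  exact Finset.sum_congr rfl fun j _ => by ring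

theorem linearMap_fieldDeriv_eq_zero [Infinite K] (ℓ : (Fin m → K) →ₗ[K] K)
    (z : Fin m → MvPolynomial (Fin n) K) (h : ∀ a, ℓ (fieldAt z a) = 0) (a y : Fin n → K) :
    ℓ (fieldDeriv z a y) = 0 := by
  have h0 : ∑ i, C (ℓ (Pi.single i 1)) * z i = 0 := MvPolynomial.funext fun a => by
    have := h a
    rw [linearMap_eq_sum] at this
    simpa [fieldAt] using this
  have h1 : polyDeriv (∑ i, C (ℓ (Pi.single i 1)) * z i) a y = 0 := by
    rw [h0]
    simp [polyDeriv_apply]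
  rw [linearMap_eq_sum]
  simpa only [polyDeriv_sum, polyDeriv_C_mul, fieldDeriv_apply] using h1

/-- Over an infinite field the identity holds between polynomials and not only between their values,
so the Leibniz rule applies. -/
theorem bilin_fieldDeriv [Infinite K] (B : (Fin m → K) →ₗ[K] (Fin m → K) →ₗ[K] K)
    (z w : Fin m → MvPolynomial (Fin n) K) (h : ∀ a, B (fieldAt z a) (fieldAt w a) = 0)
    (a y : Fin n → K) :
    B (fieldDeriv z a y) (fieldAt w a) + B (fieldAt z a) (fieldDeriv w a y) = 0 := by
  have h0 : ∑ i, ∑ j, C (B (Pi.single i 1) (Pi.single j 1)) * (z i * w j) = 0 :=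
    MvPolynomial.funext fun a => by
      have := h a
      rw [bilin_eq_sum] at this
      simpa [fieldAt] using this
  have h1 : polyDeriv (∑ i, ∑ j, C (B (Pi.single i 1) (Pi.single j 1)) * (z i * w j)) a y = 0 := by
    rw [h0]
    simp [polyDeriv_apply]
  rw [bilin_eq_sum, bilin_eq_sum, ← Finset.sum_add_distrib]
  simp only [← Finset.sum_add_distrib]
  simp only [polyDeriv_sum, polyDeriv_C_mul] at h1
  simp only [polyDeriv_mul] at h1
  rw [← h1]
  refine Finset.sum_congr rfl fun i _ => Finset.sum_congr rfl fun j _ => ?_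
  simp only [fieldAt, fieldDeriv_apply]
  ring

end VectorField

/-! ### Symmetric bilinear forms of rank at most two -/

section Bilinear

variable {K V : Type*} [Field K] [AddCommGroup V] [Module K V]

/-- All minors of order two of the bilinear form vanish. -/
def RankLEOne (B : V →ₗ[K] V →ₗ[K] K) : Prop :=
  ∀ u v u' v', B u v * B u' v' = B u v' * B u' v

theorem exists_apply_self_ne_zero [CharZero K] (B : V →ₗ[K] V →ₗ[K] K)
    (hB : ∀ u v, B u v = B v u) (h0 : B ≠ 0) : ∃ u, B u u ≠ 0 := by
  by_contra! h
  refine h0 (LinearMap.ext fun u => LinearMap.ext fun v => ?_)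
  have h1 := h (u + v)
  simp only [map_add, LinearMap.add_apply, h u, h v, hB v u] at h1
  have : (2 : K) * B u v = 0 := by linear_combination h1
  simpa using this

theorem exists_eq_mul_of_rankLEOne [CharZero K] [IsAlgClosed K] (B : V →ₗ[K] V →ₗ[K] K)
    (hB : ∀ u v, B u v = B v u) (h : RankLEOne B) :
    ∃ ℓ : V →ₗ[K] K, ∀ u v, B u v = ℓ u * ℓ v := by
  by_cases h0 : B = 0
  · exact ⟨0, by simp [h0]⟩
  obtain ⟨u, hu⟩ := exists_apply_self_ne_zero B hB h0
  obtain ⟨s, hs⟩ := IsAlgClosed.exists_pow_nat_eq (B u u) (n := 2) (by norm_num)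
  have hs0 : s ≠ 0 := by
    rintro rfl
    exact hu (by rw [← hs]; ring)
  refine ⟨s⁻¹ • B u, fun v w => ?_⟩
  have := h u u v w
  rw [LinearMap.smul_apply, LinearMap.smul_apply, smul_eq_mul, smul_eq_mul]
  have e : B v w = s⁻¹ * s⁻¹ * (s ^ 2 * B v w) := by field_simp
  rw [e, hs, this, hB v u]
  ring

theorem exists_forall_eq_smul_of_finrank_le_one {M : Type*} [AddCommGroup M] [Module K M]
    (R : Submodule K M) [FiniteDimensional K R] (h : Module.finrank K R ≤ 1) :
    ∃ φ : M, ∀ ψ ∈ R, ∃ c : K, ψ = c • φ := by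
  obtain ⟨φ, hφ⟩ := finrank_le_one_iff.1 h
  refine ⟨φ, fun ψ hψ => ?_⟩
  obtain ⟨c, hc⟩ := hφ ⟨ψ, hψ⟩
  exact ⟨c, (congrArg Subtype.val hc).symm⟩

theorem rankLEOne_of_finrank_range_le_one (B : V →ₗ[K] V →ₗ[K] K)
    [FiniteDimensional K V] (h : Module.finrank K (LinearMap.range B) ≤ 1) : RankLEOne B := by
  obtain ⟨φ, hφ⟩ := exists_forall_eq_smul_of_finrank_le_one (LinearMap.range B) h
  intro u v u' v'
  obtain ⟨c, hc1⟩ := hφ (B u) ⟨u, rfl⟩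
  obtain ⟨c', hc2⟩ := hφ (B u') ⟨u', rfl⟩
  rw [hc1, hc2]
  simp only [LinearMap.smul_apply, smul_eq_mul]
  ring

/-- Subtracting the square of B(u, ·)/s, where s² = B(u, u) ≠ 0, lowers the rank. So a nonzero B is
a sum of at most two squares, which factors by means of a root of −1. -/
theorem exists_eq_symm_mul_of_finrank_range_le_two [CharZero K] [IsAlgClosed K]
    [FiniteDimensional K V] (B : V →ₗ[K] V →ₗ[K] K) (hB : ∀ u v, B u v = B v u)
    (h : Module.finrank K (LinearMap.range B) ≤ 2) :
    ∃ ℓ m : V →ₗ[K] K, ∀ u v, B u v = ℓ u * m v + m u * ℓ v := by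
  by_cases h0 : B = 0
  · exact ⟨0, 0, by simp [h0]⟩
  obtain ⟨u, hu⟩ := exists_apply_self_ne_zero B hB h0
  set B' : V →ₗ[K] V →ₗ[K] K := B - (B u).smulRight ((B u u)⁻¹ • B u) with hB'
  have hB'a : ∀ v w, B' v w = B v w - B u v * ((B u u)⁻¹ * B u w) := fun v w => by
    simp [hB']
  have hle : LinearMap.range B' ≤ LinearMap.range B := by
    rintro _ ⟨v, rfl⟩
    refine ⟨v - (B u v * (B u u)⁻¹) • u, LinearMap.ext fun w => ?_⟩
    rw [hB'a]
    simp
    ring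
  have hlt : LinearMap.range B' < LinearMap.range B := by
    refine lt_of_le_of_ne hle fun he => ?_
    have : B u ∈ LinearMap.range B' := he ▸ ⟨u, rfl⟩
    obtain ⟨v, hv⟩ := this
    have h1 := LinearMap.congr_fun hv u
    rw [hB'a, inv_mul_cancel₀ hu, hB u v] at h1
    exact hu (by rw [← h1]; ring)
  have hfr := Submodule.finrank_lt_finrank_of_lt hlt
  obtain ⟨ℓ', hℓ'⟩ := exists_eq_mul_of_rankLEOne B'
    (fun v w => by rw [hB'a, hB'a, hB v w]; ring)
    (rankLEOne_of_finrank_range_le_one B' (by omega))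
  obtain ⟨s, hs⟩ := IsAlgClosed.exists_pow_nat_eq (B u u) (n := 2) (by norm_num)
  have hs0 : s ≠ 0 := by
    rintro rfl
    exact hu (by rw [← hs]; ring)
  obtain ⟨i, hi⟩ := IsAlgClosed.exists_pow_nat_eq (-1 : K) (n := 2) (by norm_num)
  -- A² + L² = (A + iL)(A − iL); the factor 1/2 compensates for the symmetrization.
  refine ⟨s⁻¹ • B u + i • ℓ', (2 : K)⁻¹ • (s⁻¹ • B u - i • ℓ'), fun v w => ?_⟩
  have e : B v w = ℓ' v * ℓ' w + B u v * ((B u u)⁻¹ * B u w) := by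
    rw [← hℓ', hB'a]
    ring
  rw [e, ← hs]
  simp only [LinearMap.add_apply, LinearMap.smul_apply, LinearMap.sub_apply, smul_eq_mul]
  field_simp
  linear_combination (2 * ℓ' v * ℓ' w * s ^ 2) * hi

end Bilinear

theorem finrank_map_lt {K M N : Type*} [Field K] [AddCommGroup M] [Module K M] [AddCommGroup N]
    [Module K N] {φ : M →ₗ[K] N} {W : Submodule K M} [FiniteDimensional K W] {v : M} (hv : v ∈ W)
    (h0 : v ≠ 0) (hφ : φ v = 0) : Module.finrank K (W.map φ) < Module.finrank K W := by
  have h2 := LinearMap.finrank_range_add_finrank_ker (φ.domRestrict W)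
  have h3 : 0 < Module.finrank K (LinearMap.ker (φ.domRestrict W)) := by
    rw [Module.finrank_pos_iff]
    refine ⟨⟨⟨⟨v, hv⟩, hφ⟩, 0, fun h => h0 ?_⟩⟩
    exact congrArg (fun t : LinearMap.ker (φ.domRestrict W) => (t : W).1) h
  rw [LinearMap.range_domRestrict] at h2
  omega

/-! ### Symmetric trilinear forms with a kernel vector field -/

section Trilinear

variable {K : Type*} [Field K]

/-- A symmetric trilinear form on `K ^ 6` that does not come from a proper quotient. -/
structure IsNondegSymm (T : (Fin 6 → K) →ₗ[K] (Fin 6 → K) →ₗ[K] (Fin 6 → K) →ₗ[K] K) : Prop where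
  swap_left : ∀ u v w, T u v w = T v u w
  swap_right : ∀ u v w, T u v w = T u w v
  eq_zero : ∀ u, (∀ v w, T u v w = 0) → u = 0

variable {T : (Fin 6 → K) →ₗ[K] (Fin 6 → K) →ₗ[K] (Fin 6 → K) →ₗ[K] K}

theorem IsNondegSymm.rotate (hT : IsNondegSymm T) (u v w : Fin 6 → K) : T u v w = T v w u := by
  rw [hT.swap_left, hT.swap_right]

theorem IsNondegSymm.injective (hT : IsNondegSymm T) : Function.Injective T := by
  rw [injective_iff_map_eq_zero]
  exact fun u hu => hT.eq_zero u fun v w => by simp [hu]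

variable (z : Fin 6 → MvPolynomial (Fin 6) K)

/-- The span of the values of a polynomial vector field. -/
noncomputable def fieldSpan : Submodule K (Fin 6 → K) :=
  Submodule.span K (Set.range (fieldAt z))

/-- The span of the value and the derivatives of a polynomial vector field at a point. -/
noncomputable def fieldJet (a : Fin 6 → K) : Submodule K (Fin 6 → K) :=
  LinearMap.range (fieldDeriv z a) ⊔ Submodule.span K {fieldAt z a}

variable {z}

theorem fieldAt_mem_fieldSpan (a : Fin 6 → K) : fieldAt z a ∈ fieldSpan z :=
  Submodule.subset_span ⟨a, rfl⟩

theorem fieldAt_mem_fieldJet (a : Fin 6 → K) : fieldAt z a ∈ fieldJet z a :=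
  Submodule.mem_sup_right (Submodule.mem_span_singleton_self _)

theorem mem_fieldJet {a v : Fin 6 → K} :
    v ∈ fieldJet z a ↔ ∃ (y : Fin 6 → K) (c : K), v = fieldDeriv z a y + c • fieldAt z a := by
  simp only [fieldJet, Submodule.mem_sup, LinearMap.mem_range, Submodule.mem_span_singleton]
  constructor
  · rintro ⟨_, ⟨y, rfl⟩, _, ⟨c, rfl⟩, rfl⟩
    exact ⟨y, c, rfl⟩
  · rintro ⟨y, c, rfl⟩
    exact ⟨_, ⟨y, rfl⟩, _, ⟨c, rfl⟩, rfl⟩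

theorem fieldSpan_induction {M : Type*} [AddCommGroup M] [Module K M]
    (φ : (Fin 6 → K) →ₗ[K] M) (h : ∀ a, φ (fieldAt z a) = 0) {v : Fin 6 → K}
    (hv : v ∈ fieldSpan z) : φ v = 0 := by
  have : fieldSpan z ≤ LinearMap.ker φ := by
    rw [fieldSpan, Submodule.span_le]
    rintro _ ⟨a, rfl⟩
    exact h a
  exact this hv

section Derivatives

variable [CharZero K]

theorem fieldJet_le_fieldSpan (a : Fin 6 → K) : fieldJet z a ≤ fieldSpan z := by
  intro v hv
  obtain ⟨y, c, rfl⟩ := mem_fieldJet.1 hv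
  refine add_mem ?_ (Submodule.smul_mem _ _ (fieldAt_mem_fieldSpan a))
  by_contra hn
  obtain ⟨φ, hφ, hle⟩ := Submodule.exists_le_ker_of_notMem hn
  exact hφ (linearMap_fieldDeriv_eq_zero φ z (fun b => hle (fieldAt_mem_fieldSpan b)) a y)

/-- The derivative of T(a, z(a), w) = 0 with respect to a, in the direction y. -/
theorem apply_field_add_apply_fieldDeriv (hz : ∀ a w, T a (fieldAt z a) w = 0)
    (a y w : Fin 6 → K) : T y (fieldAt z a) w + T a (fieldDeriv z a y) w = 0 := by
  have h := bilin_fieldDeriv (T.compr₂ (LinearMap.applyₗ w)) X z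
    (fun b => by simpa using hz b w) a y
  simpa using h

/-- In `apply_field_add_apply_fieldDeriv` take the direction w and the last argument z(a): the
second term dies by the kernel equation. -/
theorem field_field (hT : IsNondegSymm T) (hz : ∀ a w, T a (fieldAt z a) w = 0)
    (a w : Fin 6 → K) : T (fieldAt z a) (fieldAt z a) w = 0 := by
  have h := apply_field_add_apply_fieldDeriv hz a w (fieldAt z a)
  rw [hT.swap_right a, hz, add_zero] at h
  rw [← h, hT.rotate w]

/-- Differentiating T(z(a), z(a), w) = 0 gives twice this value. -/
theorem field_fieldDeriv (hT : IsNondegSymm T) (hz : ∀ a w, T a (fieldAt z a) w = 0)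
    (a y w : Fin 6 → K) : T (fieldAt z a) (fieldDeriv z a y) w = 0 := by
  have h := bilin_fieldDeriv (T.compr₂ (LinearMap.applyₗ w)) z z
    (fun b => by simpa using field_field hT hz b w) a y
  simp only [LinearMap.compr₂_apply, LinearMap.applyₗ_apply_apply] at h
  rw [hT.swap_left (fieldDeriv z a y)] at h
  have h2 : (2 : K) * T (fieldAt z a) (fieldDeriv z a y) w = 0 := by linear_combination h
  simpa using h2

/-- The differentiated kernel equation turns T(a, dz y, dz y') into −T(y, z(a), dz y'), which is
zero by `field_fieldDeriv`. The terms containing z(a) vanish by the kernel equation itself. -/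
theorem fieldJet_isotropic (hT : IsNondegSymm T) (hz : ∀ a w, T a (fieldAt z a) w = 0)
    {a v w : Fin 6 → K} (hv : v ∈ fieldJet z a) (hw : w ∈ fieldJet z a) : T a v w = 0 := by
  obtain ⟨y, c, rfl⟩ := mem_fieldJet.1 hv
  obtain ⟨y', c', rfl⟩ := mem_fieldJet.1 hw
  have h := apply_field_add_apply_fieldDeriv hz a y (fieldDeriv z a y')
  rw [hT.rotate y, field_fieldDeriv hT hz, zero_add] at h
  simp only [map_add, LinearMap.add_apply, map_smul, LinearMap.smul_apply, h, hz,
    hT.swap_right a _ (fieldAt z a)]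
  simp

/-- Differentiating the kernel equation gives T(a, dz y) = −T(z(a), y), and the vector z(a) of the
jet contributes nothing. -/
theorem map_fieldJet (hT : IsNondegSymm T) (hz : ∀ a w, T a (fieldAt z a) w = 0)
    (a : Fin 6 → K) : (fieldJet z a).map (T a) = LinearMap.range (T (fieldAt z a)) := by
  have key : ∀ y, T a (fieldDeriv z a y) = - T (fieldAt z a) y := fun y => by
    refine LinearMap.ext fun w => ?_
    have h := apply_field_add_apply_fieldDeriv hz a y w
    rw [hT.swap_left y] at h
    rw [LinearMap.neg_apply]
    exact eq_neg_of_add_eq_zero_right h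
  apply le_antisymm
  · rintro _ ⟨v, hv, rfl⟩
    obtain ⟨y, c, rfl⟩ := mem_fieldJet.1 hv
    refine ⟨-y, LinearMap.ext fun w => ?_⟩
    simp [key, hz]
  · rintro _ ⟨y, rfl⟩
    exact ⟨fieldDeriv z a (-y), mem_fieldJet.2 ⟨-y, 0, by simp⟩, by simp [key]⟩

/-- By isotropy T a maps the jet into its own annihilator, and the image is the range of T(z(a)). -/
theorem finrank_range_field_add_finrank_fieldJet_le (hT : IsNondegSymm T)
    (hz : ∀ a w, T a (fieldAt z a) w = 0) (a : Fin 6 → K) :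
    Module.finrank K (LinearMap.range (T (fieldAt z a))) + Module.finrank K (fieldJet z a) ≤ 6 := by
  rw [← map_fieldJet hT hz]
  have h1 : (fieldJet z a).map (T a) ≤ (fieldJet z a).dualAnnihilator := by
    rintro _ ⟨v, hv, rfl⟩
    rw [Submodule.mem_dualAnnihilator]
    exact fun w hw => fieldJet_isotropic hT hz hv hw
  have h2 : Module.finrank K ((fieldJet z a).map (T a)) ≤
      Module.finrank K (fieldJet z a).dualAnnihilator := Submodule.finrank_mono h1
  have h3 := Subspace.finrank_add_finrank_dualAnnihilator_eq (fieldJet z a)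
  rw [Module.finrank_fin_fun] at h3
  omega

theorem finrank_range_field_lt (hT : IsNondegSymm T) (hz : ∀ a w, T a (fieldAt z a) w = 0)
    {a : Fin 6 → K} (ha : fieldAt z a ≠ 0) :
    Module.finrank K (LinearMap.range (T (fieldAt z a))) < Module.finrank K (fieldJet z a) := by
  rw [← map_fieldJet hT hz]
  exact finrank_map_lt (fieldAt_mem_fieldJet a) ha (LinearMap.ext fun w => hz a w)

/-- For z(a) ≠ 0, the rank ρ and the jet dimension j satisfy ρ + j ≤ 6 and ρ < j, so 2ρ < 6. -/
theorem finrank_range_field_le_two (hT : IsNondegSymm T) (hz : ∀ a w, T a (fieldAt z a) w = 0)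
    (a : Fin 6 → K) : Module.finrank K (LinearMap.range (T (fieldAt z a))) ≤ 2 := by
  by_cases ha : fieldAt z a = 0
  · rw [ha, map_zero, LinearMap.range_zero, finrank_bot]
    omega
  have h1 := finrank_range_field_lt hT hz ha
  have h2 := finrank_range_field_add_finrank_fieldJet_le hT hz a
  omega

end Derivatives

end Trilinear

/-! ### The forms given by the kernel field have rank at most one -/

section Trilinear

variable {K : Type*} [Field K]
  {T : (Fin 6 → K) →ₗ[K] (Fin 6 → K) →ₗ[K] (Fin 6 → K) →ₗ[K] K}
  {z : Fin 6 → MvPolynomial (Fin 6) K}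

theorem exists_fin_span_ge {V : Type*} [AddCommGroup V] [Module K V] (Q : Submodule K V)
    [FiniteDimensional K Q] {n : ℕ} (h : Module.finrank K Q ≤ n) :
    ∃ q : Fin n → V, Q ≤ Submodule.span K (Set.range q) := by
  let b := Module.finBasis K Q
  refine ⟨fun i => if hi : (i : ℕ) < Module.finrank K Q then (b ⟨i, hi⟩ : V) else 0, fun v hv => ?_⟩
  have e : v = ∑ i, b.repr ⟨v, hv⟩ i • (b i : V) := by
    have := congrArg Q.subtype (b.sum_repr ⟨v, hv⟩)
    rw [map_sum] at this
    exact this.symm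
  rw [e]
  refine Submodule.sum_mem _ fun i _ => Submodule.smul_mem _ _ (Submodule.subset_span ?_)
  exact ⟨⟨i, i.2.trans_le h⟩, by simp⟩

theorem IsNondegSymm.eq_zero_of_diag [CharZero K] (hT : IsNondegSymm T) {p : Fin 6 → K}
    (h : ∀ a, T a a p = 0) : p = 0 := by
  refine hT.eq_zero p fun a b => ?_
  rw [hT.rotate]
  have := h (a + b)
  simp only [map_add, LinearMap.add_apply, h a, h b, hT.swap_left b a] at this
  have h2 : (2 : K) * T a b p = 0 := by linear_combination this
  simpa using h2

/-- A subspace on which the trilinear form vanishes as soon as two arguments lie in it injects into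
the quadratic forms on a complement. -/
theorem IsNondegSymm.finrank_le_three (hT : IsNondegSymm T) {P : Submodule K (Fin 6 → K)}
    (hP : ∀ p ∈ P, ∀ q ∈ P, T p q = 0) : Module.finrank K P ≤ 3 := by
  by_contra! hlt
  obtain ⟨Q, hQ⟩ := P.exists_isCompl
  have hfr := Submodule.finrank_add_eq_of_isCompl hQ
  rw [Module.finrank_fin_fun] at hfr
  obtain ⟨q, hq⟩ := exists_fin_span_ge Q (n := 2) (by omega)
  -- The complement is spanned by two vectors, so the quadratic form that p induces on it is
  -- recorded by three numbers.
  let Φ : (Fin 6 → K) →ₗ[K] (Fin 3 → K) := LinearMap.pi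
    ![(T.flip (q 0)).flip (q 0), (T.flip (q 0)).flip (q 1), (T.flip (q 1)).flip (q 1)]
  have hinj : Function.Injective (Φ.domRestrict P) := by
    rw [injective_iff_map_eq_zero]
    rintro ⟨p, hp⟩ h
    have h0 : T p (q 0) (q 0) = 0 := congrFun h 0
    have h1 : T p (q 0) (q 1) = 0 := congrFun h 1
    have h2 : T p (q 1) (q 1) = 0 := congrFun h 2
    have key : ∀ x : Fin 6 → K, ∃ p' ∈ P, ∃ α β : K, x = p' + (α • q 0 + β • q 1) := fun x => by
      have hx : x ∈ P ⊔ Q := by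
        rw [hQ.sup_eq_top]
        trivial
      obtain ⟨p', hp', y, hy, rfl⟩ := Submodule.mem_sup.1 hx
      obtain ⟨c, hc⟩ := (Submodule.mem_span_range_iff_exists_fun K).1 (hq hy)
      exact ⟨p', hp', c 0, c 1, by rw [← hc, Fin.sum_univ_two]⟩
    ext1
    refine hT.eq_zero p fun x y => ?_
    obtain ⟨p', hp', α, β, rfl⟩ := key x
    obtain ⟨p'', hp'', α', β', rfl⟩ := key y
    have e : ∀ w, T p w p'' = 0 := fun w => by
      rw [hT.swap_right, hP p hp p'' hp'', LinearMap.zero_apply]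
    simp only [map_add, map_smul, LinearMap.add_apply, LinearMap.smul_apply, hP p hp p' hp', e,
      h0, h1, h2, hT.swap_right p (q 1) (q 0)]
    simp
  have := LinearMap.finrank_le_finrank_of_injective hinj
  rw [Module.finrank_fin_fun] at this
  omega

theorem fieldSpan_isotropic (hT : IsNondegSymm T)
    (h : ∀ a b, T (fieldAt z a) (fieldAt z b) = 0) :
    ∀ p ∈ fieldSpan z, ∀ q ∈ fieldSpan z, T p q = 0 := by
  intro p hp q hq
  refine fieldSpan_induction (T p) (fun b => ?_) hq
  have := fieldSpan_induction (T (fieldAt z b)) (fun a => h b a) hp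
  refine LinearMap.ext fun w => ?_
  rw [hT.swap_left, this]

variable [CharZero K] [IsAlgClosed K]

/-- T(z(b), z(b), z(a)) = 0 says that the product of the two factors of T(z(a)) vanishes along z.
Both factors are polynomial in b, so one of them vanishes identically. -/
theorem exists_factor_vanishing_on_field (hT : IsNondegSymm T)
    (hz : ∀ a w, T a (fieldAt z a) w = 0) (a : Fin 6 → K) :
    ∃ ℓ m : (Fin 6 → K) →ₗ[K] K, (∀ u v, T (fieldAt z a) u v = ℓ u * m v + m u * ℓ v) ∧
      ∀ b, ℓ (fieldAt z b) = 0 := by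
  obtain ⟨ℓ, m, h⟩ := exists_eq_symm_mul_of_finrank_range_le_two (T (fieldAt z a))
    (fun u v => hT.swap_right _ u v) (finrank_range_field_le_two hT hz a)
  have hp : ∀ b, ℓ (fieldAt z b) * m (fieldAt z b) = 0 := fun b => by
    have h1 := field_field hT hz b (fieldAt z a)
    rw [← hT.rotate, h] at h1
    have h2 : (2 : K) * (ℓ (fieldAt z b) * m (fieldAt z b)) = 0 := by linear_combination h1
    simpa using h2
  rcases (IsPolyFun.linearMap ℓ (isPolyFun_fieldAt z)).eq_zero_or_eq_zero
    (.linearMap m (isPolyFun_fieldAt z)) hp with h0 | h0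
  · exact ⟨ℓ, m, h, h0⟩
  · exact ⟨m, ℓ, fun u v => by rw [h]; ring, h0⟩

/-- For general c, the symmetry of T(z(a), z(c), ·) makes ℓ_c proportional to ℓ_a, and then T(c,
z(c), ·) = 0 makes m_c proportional to ℓ_c. The minors of order two are polynomial in c, so their
vanishing extends to every c. -/
theorem rankLEOne_of_not_isotropic (hT : IsNondegSymm T) (hz : ∀ a w, T a (fieldAt z a) w = 0)
    {a b : Fin 6 → K} (hab : T (fieldAt z a) (fieldAt z b) ≠ 0) (c : Fin 6 → K) :
    RankLEOne (T (fieldAt z c)) := by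
  choose ℓ m hℓm hℓ using exists_factor_vanishing_on_field hT hz
  have hmul : ∀ a b w, T (fieldAt z a) (fieldAt z b) w = m a (fieldAt z b) * ℓ a w := fun a b w => by
    rw [hℓm, hℓ, zero_mul, zero_add]
  obtain ⟨w₀, hw₀⟩ : ∃ w, T (fieldAt z a) (fieldAt z b) w ≠ 0 := by
    by_contra! h
    exact hab (LinearMap.ext h)
  intro u v u' v'
  rw [← sub_eq_zero]
  have hpoly : ∀ x y : Fin 6 → K, IsPolyFun fun c => T (fieldAt z c) x y := fun x y =>
    .bilin (T.compr₂ (LinearMap.applyₗ y)) (isPolyFun_fieldAt z) fun i => isPolyFun_const (x i)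
  have hP1 : IsPolyFun fun c => T (fieldAt z a) (fieldAt z c) w₀ :=
    .linearMap ((T (fieldAt z a)).flip w₀) (isPolyFun_fieldAt z)
  have hP2 : IsPolyFun fun c => ℓ a c := .linearMap (ℓ a) isPolyFun_coord
  have hℓa : ℓ a w₀ ≠ 0 := by
    rw [hmul] at hw₀
    exact right_ne_zero_of_mul hw₀
  revert c
  refine fun c => IsPolyFun.eq_zero_of_mul (b := w₀)
    (.sub (.mul (hpoly u v) (hpoly u' v')) (.mul (hpoly u v') (hpoly u' v))) hP2 ?_ hℓa c
  intro c hc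
  by_contra hne
  -- Two open conditions on c are used, ℓ_a(c) ≠ 0 and T(z(a), z(c), w₀) ≠ 0. Multiplying the minor
  -- by ℓ_a(c) lets the density argument for the second run over all c.
  have hmin := fun c hc => IsPolyFun.eq_zero_of_mul (b := b)
    (.mul (.sub (.mul (hpoly u v) (hpoly u' v')) (.mul (hpoly u v') (hpoly u' v))) hP2) hP1 hc hw₀ c
  refine mul_ne_zero hne hc (hmin c ?_)
  clear! c
  intro c hc
  by_cases hlc : ℓ a c = 0
  · simp [hlc]
  have h1 : ∀ w, m a (fieldAt z c) * ℓ a w = m c (fieldAt z a) * ℓ c w := fun w => by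
    rw [← hmul, ← hmul, hT.swap_left]
  have h2 : m a (fieldAt z c) ≠ 0 := by
    rw [hmul] at hc
    exact left_ne_zero_of_mul hc
  have h3 : ℓ c c ≠ 0 := by
    refine right_ne_zero_of_mul (a := m c (fieldAt z a)) ?_
    rw [← h1]
    exact mul_ne_zero h2 hlc
  have h4 : ∀ w, m c w = -(m c c / ℓ c c) * ℓ c w := fun w => by
    have := hz c w
    rw [hT.swap_left, hℓm] at this
    field_simp
    linear_combination this
  simp only [hℓm, h4 u, h4 v, h4 u', h4 v']
  ring

/-- In the remaining case all T(z(a), z(b)) vanish and the values of z span at most three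
dimensions. Rank two at one point means rank two at general a, where the jet then has dimension
three and equals that span. So z(c) lies in the jet at general a, which is killed by T(a, a, ·), and
nondegeneracy gives z(c) = 0. -/
theorem rankLEOne_field (hT : IsNondegSymm T) (hz : ∀ a w, T a (fieldAt z a) w = 0)
    (c : Fin 6 → K) : RankLEOne (T (fieldAt z c)) := by
  by_cases h : ∃ a b, T (fieldAt z a) (fieldAt z b) ≠ 0
  · obtain ⟨a, b, hab⟩ := h
    exact rankLEOne_of_not_isotropic hT hz hab c
  push Not at h
  by_contra hc
  have hP := hT.finrank_le_three (fieldSpan_isotropic hT h)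
  have hjet : ∀ a, ¬ RankLEOne (T (fieldAt z a)) → fieldJet z a = fieldSpan z := fun a ha => by
    have h0 : fieldAt z a ≠ 0 := fun h0 => ha fun u v u' v' => by simp [h0]
    have h1 := finrank_range_field_lt hT hz h0
    have h2 : ¬ Module.finrank K (LinearMap.range (T (fieldAt z a))) ≤ 1 := fun h2 =>
      ha (rankLEOne_of_finrank_range_le_one _ h2)
    exact Submodule.eq_of_le_of_finrank_le (fieldJet_le_fieldSpan a) (by omega)
  have hc0 : fieldAt z c ≠ 0 := fun h0 => hc fun u v u' v' => by simp [h0]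
  refine hc0 (hT.eq_zero_of_diag ?_)
  obtain ⟨u, v, u', v', hne⟩ : ∃ u v u' v', T (fieldAt z c) u v * T (fieldAt z c) u' v' -
      T (fieldAt z c) u v' * T (fieldAt z c) u' v ≠ 0 := by
    by_contra! hall
    exact hc fun u v u' v' => sub_eq_zero.1 (hall u v u' v')
  have hpoly : ∀ x y : Fin 6 → K, IsPolyFun fun c => T (fieldAt z c) x y := fun x y =>
    .bilin (T.compr₂ (LinearMap.applyₗ y)) (isPolyFun_fieldAt z) fun i => isPolyFun_const (x i)
  refine IsPolyFun.eq_zero_of_mul (.bilin (T.compr₂ (LinearMap.applyₗ (fieldAt z c)))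
    isPolyFun_coord isPolyFun_coord)
    (.sub (.mul (hpoly u v) (hpoly u' v')) (.mul (hpoly u v') (hpoly u' v))) (fun a ha => ?_) hne
  have hmem : fieldAt z c ∈ fieldJet z a := by
    rw [hjet a fun hr => ha (sub_eq_zero.2 (hr u v u' v'))]
    exact fieldAt_mem_fieldSpan c
  obtain ⟨y, k, hk⟩ := mem_fieldJet.1 hmem
  have h1 := apply_field_add_apply_fieldDeriv hz a y a
  rw [← hT.rotate a y, hT.swap_right a y, hz, zero_add] at h1
  change T a a (fieldAt z c) = 0
  rw [hk, map_add, map_smul, hT.swap_right a a, h1, hT.swap_right a a, hz]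
  simp

end Trilinear

/-! ### Construction of a normal frame -/

section Trilinear

variable {K : Type*} [Field K]

theorem IsPolyFun.prod {σ ι : Type*} (s : Finset ι) {g : ι → (σ → K) → K}
    (hg : ∀ i, IsPolyFun (g i)) : IsPolyFun fun a => ∏ i ∈ s, g i a := by
  choose p hp using hg
  exact ⟨∏ i ∈ s, p i, fun a => by simp [hp]⟩

/-- Dual bases `e` and `d` of `K ^ 6` in which the trilinear form becomes that of
`x₀x₄² + 2x₁x₄x₅ + x₂x₅² + D(x₃,x₄,x₅)`. -/
structure IsNormalFrame (T : (Fin 6 → K) →ₗ[K] (Fin 6 → K) →ₗ[K] (Fin 6 → K) →ₗ[K] K)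
    (e d : Fin 6 → Fin 6 → K) : Prop where
  dual : ∀ j k, d j ⬝ᵥ e k = if j = k then 1 else 0
  form_zero : ∀ x y, T (e 0) x y = 2 * ((d 4 ⬝ᵥ x) * (d 4 ⬝ᵥ y))
  form_one : ∀ x y, T (e 1) x y = 2 * ((d 4 ⬝ᵥ x) * (d 5 ⬝ᵥ y) + (d 5 ⬝ᵥ x) * (d 4 ⬝ᵥ y))
  form_two : ∀ x y, T (e 2) x y = 2 * ((d 5 ⬝ᵥ x) * (d 5 ⬝ᵥ y))

variable {T : (Fin 6 → K) →ₗ[K] (Fin 6 → K) →ₗ[K] (Fin 6 → K) →ₗ[K] K}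
  {z : Fin 6 → MvPolynomial (Fin 6) K}

/-- The vector e₃ is taken in the four-dimensional common kernel of ℓ and m, outside ⟨e₀, e₁, e₂⟩,
and e₄, e₅ are dual to ℓ, m. In the resulting basis ℓ and m are the coordinates of index 4 and 5. -/
theorem exists_normalFrame_of_forms [CharZero K] (ℓ m : (Fin 6 → K) →ₗ[K] K)
    (hlm : LinearIndependent K ![ℓ, m]) (e₀ e₁ e₂ : Fin 6 → K)
    (hℓ : ℓ e₀ = 0 ∧ ℓ e₁ = 0 ∧ ℓ e₂ = 0) (hm : m e₀ = 0 ∧ m e₁ = 0 ∧ m e₂ = 0)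
    (h0 : ∀ x y, T e₀ x y = 2 * (ℓ x * ℓ y))
    (h1 : ∀ x y, T e₁ x y = 2 * (ℓ x * m y + m x * ℓ y))
    (h2 : ∀ x y, T e₂ x y = 2 * (m x * m y)) :
    ∃ e d : Fin 6 → Fin 6 → K, IsNormalFrame T e d := by
  set Φ : (Fin 6 → K) →ₗ[K] (Fin 2 → K) := LinearMap.pi ![ℓ, m] with hΦ
  have hsurj : LinearMap.range Φ = ⊤ := by
    by_contra hne
    obtain ⟨φ, hφ, hle⟩ := Submodule.exists_le_ker_of_lt_top _ (lt_top_iff_ne_top.2 hne)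
    have hsum : φ (Pi.single 0 1) • ℓ + φ (Pi.single 1 1) • m = 0 := LinearMap.ext fun v => by
      have h : φ (Φ v) = 0 := hle ⟨v, rfl⟩
      rw [linearMap_eq_sum, Fin.sum_univ_two] at h
      exact h
    obtain ⟨ha, hb⟩ := LinearIndependent.pair_iff.1 hlm _ _ hsum
    refine hφ (LinearMap.ext fun v => ?_)
    rw [linearMap_eq_sum, Fin.sum_univ_two, ha, hb]
    simp
  have hex : ∀ α β : K, ∃ x, ℓ x = α ∧ m x = β := fun α β => by
    have : (![α, β] : Fin 2 → K) ∈ LinearMap.range Φ := hsurj ▸ Submodule.mem_top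
    obtain ⟨x, hx⟩ := this
    exact ⟨x, congrFun hx 0, congrFun hx 1⟩
  obtain ⟨e₄, h4, h4'⟩ := hex 1 0
  obtain ⟨e₅, h5, h5'⟩ := hex 0 1
  have hker : Module.finrank K (LinearMap.ker Φ) = 4 := by
    have h := LinearMap.finrank_range_add_finrank_ker Φ
    rw [hsurj, finrank_top, Module.finrank_fin_fun, Module.finrank_fin_fun] at h
    omega
  obtain ⟨e₃, h3, h3n⟩ : ∃ v ∈ LinearMap.ker Φ, v ∉ Submodule.span K (Set.range ![e₀, e₁, e₂]) := by
    by_contra! hle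
    have ha := Submodule.finrank_mono (R := K) (s := LinearMap.ker Φ) hle
    have hb := finrank_range_le_card (R := K) ![e₀, e₁, e₂]
    rw [Fintype.card_fin] at hb
    have hc : Module.finrank K (Submodule.span K (Set.range ![e₀, e₁, e₂])) ≤ 3 := hb
    omega
  have h3ℓ : ℓ e₃ = 0 := congrFun (LinearMap.mem_ker.1 h3) 0
  have h3m : m e₃ = 0 := congrFun (LinearMap.mem_ker.1 h3) 1
  have hli : LinearIndependent K ![e₀, e₁, e₂, e₃, e₄, e₅] := by
    rw [Fintype.linearIndependent_iff]
    intro g hg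
    simp only [Fin.sum_univ_six, Matrix.cons_val] at hg
    have g4 : g 4 = 0 := by
      have := congrArg ℓ hg
      simpa [hℓ, h3ℓ, h4, h5] using this
    have g5 : g 5 = 0 := by
      have := congrArg m hg
      simpa [hm, h3m, h4', h5'] using this
    have g3 : g 3 = 0 := by
      by_contra hne
      apply h3n
      rw [Submodule.mem_span_range_iff_exists_fun]
      refine ⟨![-(g 3)⁻¹ * g 0, -(g 3)⁻¹ * g 1, -(g 3)⁻¹ * g 2], ?_⟩
      rw [g4, g5, zero_smul, zero_smul, add_zero, add_zero] at hg
      have : e₃ = (g 3)⁻¹ • (g 3 • e₃) := by rw [smul_smul, inv_mul_cancel₀ hne, one_smul]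
      rw [this, eq_neg_of_add_eq_zero_right hg]
      simp only [Fin.sum_univ_three, Matrix.cons_val]
      module
    rw [g3, g4, g5, zero_smul, zero_smul, zero_smul, add_zero, add_zero, add_zero] at hg
    -- Independence of e₀, e₁, e₂ is inherited from ℓ², ℓm, m², tested on e₄ and e₅.
    have ev : ∀ x y, g 0 * T e₀ x y + g 1 * T e₁ x y + g 2 * T e₂ x y = 0 := fun x y => by
      have := congrArg (fun v => T v x y) hg
      simpa using this
    have g0 : g 0 = 0 := by simpa [h0, h1, h2, h4, h4'] using ev e₄ e₄
    have g2 : g 2 = 0 := by simpa [h0, h1, h2, h5, h5'] using ev e₅ e₅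
    have g1 : g 1 = 0 := by simpa [h0, h1, h2, h4, h4', h5, h5'] using ev e₄ e₅
    intro i
    fin_cases i <;> assumption
  let b := basisOfLinearIndependentOfCardEqFinrank hli (by simp)
  have hb : ⇑b = ![e₀, e₁, e₂, e₃, e₄, e₅] := coe_basisOfLinearIndependentOfCardEqFinrank _ _
  have hdot : ∀ j x, (fun i => b.coord j (Pi.single i 1)) ⬝ᵥ x = b.coord j x := fun j x => by
    rw [linearMap_eq_sum (b.coord j) x]
    rfl
  have hℓ4 : b.coord 4 = ℓ := b.ext fun i => by
    rw [b.coord_apply, b.repr_self, hb]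
    fin_cases i <;> simp [hℓ, h3ℓ, h4, h5]
  have hm5 : b.coord 5 = m := b.ext fun i => by
    rw [b.coord_apply, b.repr_self, hb]
    fin_cases i <;> simp [hm, h3m, h4', h5']
  refine ⟨b, fun j i => b.coord j (Pi.single i 1), ⟨fun j k => ?_, fun x y => ?_, fun x y => ?_,
    fun x y => ?_⟩⟩
  · rw [hdot, b.coord_apply, b.repr_self, Finsupp.single_apply]
    simp [eq_comm]
  · rw [hdot, hdot, hℓ4, hb]
    exact h0 x y
  · rw [hdot, hdot, hdot, hdot, hℓ4, hm5, hb]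
    exact h1 x y
  · rw [hdot, hdot, hm5, hb]
    exact h2 x y

variable [CharZero K] [IsAlgClosed K]

/-- Let the ℓ at a₀, …, aₙ₋₁ be a basis of the span of all of them. Where none of these forms
vanishes at x, T x kills no nontrivial combination of the z(aᵢ); as it kills z(x), some z(x) lies
outside their span. The values of z thus span at least n + 1 dimensions, inside a common kernel of
dimension 6 − n, so n ≤ 2. If n ≤ 1, the square of any ℓ_x is a combination of the chosen squares,
and injectivity of T puts z(x) back in the span; so n = 2. -/
theorem exists_normalFrame (hT : IsNondegSymm T) (hz : ∀ a w, T a (fieldAt z a) w = 0)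
    (hz0 : ∃ a, fieldAt z a ≠ 0) : ∃ e d : Fin 6 → Fin 6 → K, IsNormalFrame T e d := by
  have hsq : ∀ a, ∃ ℓ : (Fin 6 → K) →ₗ[K] K, ∀ u v, T (fieldAt z a) u v = ℓ u * ℓ v := fun a =>
    exists_eq_mul_of_rankLEOne _ (fun u v => hT.swap_right _ u v) (rankLEOne_field hT hz a)
  choose ℓ hℓ using hsq
  have hvan : ∀ a b, ℓ a (fieldAt z b) = 0 := fun a b => by
    have h1 := field_field hT hz b (fieldAt z a)
    rw [← hT.rotate, hℓ] at h1
    simpa using h1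
  obtain ⟨n, hn, f, hf, hspan, hli⟩ : ∃ n, n = Module.finrank K (Submodule.span K (Set.range ℓ)) ∧
      ∃ f : Fin n → (Fin 6 → K) →ₗ[K] K, (∀ i, f i ∈ Set.range ℓ) ∧
        Submodule.span K (Set.range f) = Submodule.span K (Set.range ℓ) ∧ LinearIndependent K f :=
    ⟨_, rfl, Submodule.exists_fun_fin_finrank_span_eq K (Set.range ℓ)⟩
  choose a ha using hf
  have hne : ∀ i, ∃ x, f i x ≠ 0 := fun i => by
    by_contra! h
    exact hli.ne_zero i (LinearMap.ext h)
  obtain ⟨x₀, hx₀⟩ := Module.Dual.exists_forall_ne_zero_of_forall_exists f hne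
  have hcoef : ∀ (x : Fin 6 → K) (c : Fin n → K), (∀ i, f i x ≠ 0) →
      (∀ w, T x (∑ i, c i • fieldAt z (a i)) w = 0) → c = 0 := by
    intro x c hx h
    have h1 : ∑ i, (c i * f i x) • f i = 0 := LinearMap.ext fun w => by
      have := h w
      simp only [map_sum, LinearMap.sum_apply, map_smul, LinearMap.smul_apply,
        hT.swap_left x, hℓ, ha] at this
      simpa [mul_assoc] using this
    funext i
    have := Fintype.linearIndependent_iff.1 hli _ h1 i
    simpa [hx i] using this
  have hspan_not : ∃ x, fieldAt z x ∉ Submodule.span K (Set.range fun i => fieldAt z (a i)) := by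
    by_contra! hall
    obtain ⟨b, hb⟩ := hz0
    obtain ⟨j, hj⟩ := Function.ne_iff.1 hb
    refine hj (IsPolyFun.eq_zero_of_mul (isPolyFun_fieldAt z j)
      (.prod Finset.univ fun i => .linearMap (f i) isPolyFun_coord) (fun x hx => ?_)
      (Finset.prod_ne_zero_iff.2 fun i _ => hx₀ i) b)
    obtain ⟨c, hc⟩ := (Submodule.mem_span_range_iff_exists_fun K).1 (hall x)
    have h0 := hcoef x c (fun i => Finset.prod_ne_zero_iff.1 hx i (Finset.mem_univ i))
      fun w => by rw [hc, hz]
    rw [← hc, h0]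
    simp
  obtain ⟨x₁, hx₁⟩ := hspan_not
  have hzli : LinearIndependent K fun i => fieldAt z (a i) := by
    rw [Fintype.linearIndependent_iff]
    intro c hc i
    exact congrFun (hcoef x₀ c hx₀ fun w => by rw [hc, map_zero, LinearMap.zero_apply]) i
  have hle2 : n ≤ 2 := by
    have h1 : Submodule.span K (Set.range fun i => fieldAt z (a i)) < fieldSpan z := by
      refine lt_of_le_of_ne (Submodule.span_mono ?_) fun h => hx₁ (h ▸ fieldAt_mem_fieldSpan x₁)
      rintro _ ⟨i, rfl⟩
      exact ⟨a i, rfl⟩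
    have h2 := Submodule.finrank_lt_finrank_of_lt h1
    rw [finrank_span_eq_card hzli, Fintype.card_fin] at h2
    have h3 : fieldSpan z ≤ (Submodule.span K (Set.range ℓ) :
        Subspace K (Module.Dual K (Fin 6 → K))).dualCoannihilator := by
      rw [fieldSpan, Submodule.span_le]
      rintro _ ⟨b, rfl⟩
      rw [SetLike.mem_coe, Submodule.mem_dualCoannihilator]
      intro φ hφ
      have : Submodule.span K (Set.range ℓ) ≤ LinearMap.ker (LinearMap.applyₗ (fieldAt z b)) := by
        rw [Submodule.span_le]
        rintro _ ⟨a, rfl⟩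
        exact hvan a b
      exact this hφ
    have h4 := Submodule.finrank_mono h3
    have h5 := Subspace.finrank_add_finrank_dualCoannihilator_eq
      (Submodule.span K (Set.range ℓ) : Subspace K (Module.Dual K (Fin 6 → K)))
    rw [Module.finrank_fin_fun] at h5
    have h6 : n + Module.finrank K (Submodule.span K (Set.range ℓ) :
      Subspace K (Module.Dual K (Fin 6 → K))).dualCoannihilator = 6 := hn ▸ h5
    omega
  have hcomb : ∃ c : Fin n → K, ℓ x₁ = ∑ i, c i • f i := by
    have : ℓ x₁ ∈ Submodule.span K (Set.range f) := hspan ▸ Submodule.subset_span ⟨x₁, rfl⟩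
    obtain ⟨c, hc⟩ := (Submodule.mem_span_range_iff_exists_fun K).1 this
    exact ⟨c, hc.symm⟩
  obtain ⟨c, hc⟩ := hcomb
  clear hn
  rw [Submodule.mem_span_range_iff_exists_fun] at hx₁
  have hTz : ∀ x u v, T (fieldAt z x) u v = ℓ x u * ℓ x v := hℓ
  interval_cases n
  · exact absurd ⟨0, hT.injective (LinearMap.ext₂ fun u v => by simp [hTz, hc])⟩ hx₁
  · refine absurd ⟨fun i => c i ^ 2, hT.injective (LinearMap.ext₂ fun u v => ?_)⟩ hx₁
    simp [hTz, hc, ha]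
    ring
  · have hform : ∀ x y, T (fieldAt z x₁) x y =
        (c 0 * f 0 x + c 1 * f 1 x) * (c 0 * f 0 y + c 1 * f 1 y) := fun x y => by
      simp [hTz, hc]
    -- Without a mixed term in (c₀f₀ + c₁f₁)², z(x₁) would be a combination of z(a₀) and z(a₁).
    have hcc : c 0 * c 1 ≠ 0 := fun hcc => by
      refine absurd ⟨fun i => c i ^ 2, hT.injective (LinearMap.ext₂ fun u v => ?_)⟩ hx₁
      simp only [Fin.sum_univ_two, map_add, map_smul, LinearMap.add_apply, LinearMap.smul_apply,
        hform, hTz, ha, smul_eq_mul]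
      linear_combination -(f 0 u * f 1 v + f 1 u * f 0 v) * hcc
    have hv : ∀ i b, f i (fieldAt z b) = 0 := fun i b => by rw [← ha, hvan]
    -- Removing the pure squares from T(z(x₁)) leaves c₀c₁ times the mixed form. The factors 2 are
    -- those of the second derivatives of the canonical form.
    refine exists_normalFrame_of_forms (f 0) (f 1) ?_ ((2 : K) • fieldAt z (a 0))
      ((2 / (c 0 * c 1)) • (fieldAt z x₁ - c 0 ^ 2 • fieldAt z (a 0) - c 1 ^ 2 • fieldAt z (a 1)))
      ((2 : K) • fieldAt z (a 1)) ⟨by simp [hv], by simp [hv], by simp [hv]⟩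
      ⟨by simp [hv], by simp [hv], by simp [hv]⟩ (fun x y => ?_) (fun x y => ?_) fun x y => ?_
    · convert hli using 1
      funext i
      fin_cases i <;> rfl
    · simp [hTz, ha]
    · simp only [map_sub, map_smul, LinearMap.sub_apply, LinearMap.smul_apply, hform, hTz, ha,
        smul_eq_mul]
      obtain ⟨hc0, hc1⟩ := mul_ne_zero_iff.1 hcc
      field_simp
      ring
    · simp [hTz, ha]

end Trilinear

/-! ### The polar trilinear form of a cubic -/

section CubicForm

variable {K : Type*} [Field K]

/-- The symmetric trilinear form given by the third derivatives of a cubic form. -/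
noncomputable def polarForm (f : MvPolynomial (Fin 6) K) :
    (Fin 6 → K) →ₗ[K] (Fin 6 → K) →ₗ[K] (Fin 6 → K) →ₗ[K] K :=
  ∑ i, ∑ j, ∑ k, LinearMap.smulRight (LinearMap.proj i) (LinearMap.smulRight (LinearMap.proj j)
    (eval 0 (pderiv i (pderiv j (pderiv k f))) • LinearMap.proj k))

variable {f : MvPolynomial (Fin 6) K}

theorem polarForm_apply (u v w : Fin 6 → K) : polarForm f u v w =
    ∑ i, ∑ j, ∑ k, eval 0 (pderiv i (pderiv j (pderiv k f))) * (u i * v j * w k) := by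
  simp only [polarForm, LinearMap.sum_apply, LinearMap.smulRight_apply, LinearMap.smul_apply,
    LinearMap.proj_apply, smul_eq_mul]
  exact Finset.sum_congr rfl fun i _ => Finset.sum_congr rfl fun j _ =>
    Finset.sum_congr rfl fun k _ => by ring

theorem pderiv_pderiv_comm {σ : Type*} (i j : σ) (p : MvPolynomial σ K) :
    pderiv i (pderiv j p) = pderiv j (pderiv i p) := by
  classical
  have h : ⁅pderiv (R := K) i, pderiv j⁆ = 0 := derivation_ext fun k => by
    rw [Derivation.commutator_apply, pderiv_X, pderiv_X]
    simp [Pi.single_apply, apply_ite]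
  have := congrArg (fun D => D p) h
  rw [Derivation.commutator_apply] at this
  exact sub_eq_zero.1 this

theorem eval_eq_of_isHomogeneous_zero {g : MvPolynomial (Fin 6) K} (hg : g.IsHomogeneous 0)
    (x y : Fin 6 → K) : eval x g = eval y g := by
  rw [totalDegree_eq_zero_iff_eq_C.1 (Nat.le_zero.1 hg.totalDegree_le)]
  simp

theorem eval_sum_pderiv {g : MvPolynomial (Fin 6) K} {n : ℕ} (hg : g.IsHomogeneous n)
    (x : Fin 6 → K) : ∑ i, x i * eval x (pderiv i g) = n * eval x g := by
  have := congrArg (eval x) hg.sum_X_mul_pderiv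
  simpa using this

theorem polarForm_swap_left (u v w : Fin 6 → K) : polarForm f u v w = polarForm f v u w := by
  rw [polarForm_apply, polarForm_apply, Finset.sum_comm]
  refine Finset.sum_congr rfl fun i _ => Finset.sum_congr rfl fun j _ =>
    Finset.sum_congr rfl fun k _ => ?_
  rw [pderiv_pderiv_comm i j]
  ring

theorem polarForm_swap_right (u v w : Fin 6 → K) : polarForm f u v w = polarForm f u w v := by
  rw [polarForm_apply, polarForm_apply]
  refine Finset.sum_congr rfl fun i _ => ?_
  rw [Finset.sum_comm]
  refine Finset.sum_congr rfl fun j _ => Finset.sum_congr rfl fun k _ => ?_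
  rw [pderiv_pderiv_comm k j]
  ring

variable (hf : f.IsHomogeneous 3)
include hf

theorem eval_pderiv_pderiv (x : Fin 6 → K) (j k : Fin 6) :
    eval x (pderiv j (pderiv k f)) =
      ∑ i, eval 0 (pderiv i (pderiv j (pderiv k f))) * x i := by
  have h := eval_sum_pderiv ((hf.pderiv (i := k)).pderiv (i := j)) x
  have h1 : ∀ i, (pderiv i (pderiv j (pderiv k f))).IsHomogeneous 0 := fun i =>
    ((hf.pderiv (i := k)).pderiv (i := j)).pderiv
  simp only [Nat.reduceSub, Nat.cast_one, one_mul] at h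
  rw [← h]
  exact Finset.sum_congr rfl fun i _ => by rw [eval_eq_of_isHomogeneous_zero (h1 i) x 0, mul_comm]

theorem polarForm_eq_sum (x v w : Fin 6 → K) :
    polarForm f x v w = ∑ j, ∑ k, eval x (pderiv j (pderiv k f)) * (v j * w k) := by
  rw [polarForm_apply, Finset.sum_comm]
  refine Finset.sum_congr rfl fun j _ => ?_
  rw [Finset.sum_comm]
  refine Finset.sum_congr rfl fun k _ => ?_
  rw [eval_pderiv_pderiv hf, Finset.sum_mul]
  exact Finset.sum_congr rfl fun i _ => by ring

theorem polarForm_self (x w : Fin 6 → K) : polarForm f x x w = 2 * (grad f x ⬝ᵥ w) := by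
  rw [polarForm_eq_sum hf, Finset.sum_comm, dotProduct, Finset.mul_sum]
  refine Finset.sum_congr rfl fun k _ => ?_
  have h := eval_sum_pderiv (hf.pderiv (i := k)) x
  simp only [Nat.reduceSub, Nat.cast_ofNat] at h
  rw [grad, ← mul_assoc, ← h, Finset.sum_mul]
  exact Finset.sum_congr rfl fun j _ => by ring

theorem polarForm_self_self (x : Fin 6 → K) : polarForm f x x x = 6 * eval x f := by
  have h := eval_sum_pderiv hf x
  simp only [Nat.cast_ofNat] at h
  rw [polarForm_self hf, dotProduct]
  have : ∑ i, grad f x i * x i = 3 * eval x f := by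
    rw [← h]
    exact Finset.sum_congr rfl fun i _ => mul_comm _ _
  rw [this]
  ring

/-- If T u = 0 with u ≠ 0, then f(x + cu) = f(x) for all x and c, so the point u belongs to the
vertex of X. -/
theorem isNondegSymm_polarForm [CharZero K] (hcone : ¬ IsCone (hypersurface (N := 5) f)) :
    IsNondegSymm (polarForm f) where
  swap_left := polarForm_swap_left
  swap_right := polarForm_swap_right
  eq_zero u hu := by
    by_contra h0
    have e6 : (6 : K) ≠ 0 := by norm_num
    have hinv : ∀ (x : Fin 6 → K) (c : K), eval (x + c • u) f = eval x f := fun x c => by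
      apply mul_left_cancel₀ e6
      rw [← polarForm_self_self hf, ← polarForm_self_self hf]
      have h1 : ∀ a, polarForm f a u = 0 := fun a => LinearMap.ext fun w => by
        rw [polarForm_swap_left, hu, LinearMap.zero_apply]
      have h2 : ∀ a b, polarForm f a b u = 0 := fun a b => by
        rw [polarForm_swap_right, h1, LinearMap.zero_apply]
      simp [hu, h1, h2]
    have hz : eval 0 f = 0 := by
      apply mul_left_cancel₀ e6
      rw [← polarForm_self_self hf]
      simp
    obtain ⟨a, ha⟩ := Projectivization.exists_smul_eq_mk_rep K u h0
    refine hcone ⟨Projectivization.mk K u h0, ?_, fun q hq => ?_⟩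
    · change eval _ f = 0
      rw [← ha, ← hz]
      have := hinv 0 (a : K)
      rwa [zero_add] at this
    · intro r hr
      have hr' : r.rep ∈ (Projectivization.mk K u h0).submodule ⊔ q.submodule := hr (by
        rw [Projectivization.submodule_eq]
        exact Submodule.mem_span_singleton_self _)
      rw [Projectivization.submodule_mk, Projectivization.submodule_eq, Submodule.mem_sup] at hr'
      obtain ⟨v, hv, w, hw, hvw⟩ := hr'
      obtain ⟨c, rfl⟩ := Submodule.mem_span_singleton.1 hv
      obtain ⟨c', rfl⟩ := Submodule.mem_span_singleton.1 hw
      change eval r.rep f = 0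
      have hq0 : eval q.rep f = 0 := hq
      rw [← hvw, add_comm (c • u), hinv]
      apply mul_left_cancel₀ e6
      rw [← polarForm_self_self hf]
      have := polarForm_self_self hf q.rep
      rw [hq0, mul_zero] at this
      simp [this]

/-- A singular matrix over the domain of polynomials kills a nonzero polynomial vector, and the
hessian matrix at a is the matrix of T a. -/
theorem exists_kernel_field (hhess : hessian (N := 5) f = 0) [Infinite K] :
    ∃ z : Fin 6 → MvPolynomial (Fin 6) K, (∀ a w, polarForm f a (fieldAt z a) w = 0) ∧
      ∃ a, fieldAt z a ≠ 0 := by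
  obtain ⟨z, hz0, hz⟩ := Matrix.exists_mulVec_eq_zero_iff.2 hhess
  refine ⟨z, fun a w => ?_, ?_⟩
  · rw [polarForm_swap_right, polarForm_eq_sum hf]
    refine Finset.sum_eq_zero fun j _ => ?_
    have h := congrArg (eval a) (congrFun hz j)
    simp only [Matrix.mulVec, dotProduct, Matrix.of_apply, map_sum, map_mul, Pi.zero_apply,
      map_zero] at h
    rw [← mul_zero (w j), ← h, Finset.mul_sum]
    exact Finset.sum_congr rfl fun k _ => by
      simp only [fieldAt]
      ring
  · by_contra! h
    exact hz0 (funext fun i => MvPolynomial.funext fun a => by simpa [fieldAt] using congrFun (h a) i)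

theorem exists_normalFrame_polarForm [CharZero K] [IsAlgClosed K]
    (hhess : hessian (N := 5) f = 0) (hcone : ¬ IsCone (hypersurface (N := 5) f)) :
    ∃ e d : Fin 6 → Fin 6 → K, IsNormalFrame (polarForm f) e d := by
  obtain ⟨z, hz, hz0⟩ := exists_kernel_field hf hhess
  exact exists_normalFrame (isNondegSymm_polarForm hf hcone) hz hz0

end CubicForm

/-! ### Coordinates in a normal frame -/

section NormalFrame

variable {K : Type*} [Field K]
  {T : (Fin 6 → K) →ₗ[K] (Fin 6 → K) →ₗ[K] (Fin 6 → K) →ₗ[K] K} {e d : Fin 6 → Fin 6 → K}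

/-- The component of a vector in the span of the last three vectors of a frame. -/
def frameTail (e d : Fin 6 → Fin 6 → K) (x : Fin 6 → K) : Fin 6 → K :=
  (d 3 ⬝ᵥ x) • e 3 + (d 4 ⬝ᵥ x) • e 4 + (d 5 ⬝ᵥ x) • e 5

namespace IsNormalFrame

variable (h : IsNormalFrame T e d)
include h

theorem dual_mul : Matrix.of d * (Matrix.of e).transpose = 1 := by
  ext j k
  rw [Matrix.mul_apply', Matrix.one_apply]
  exact h.dual j k

theorem mul_dual : (Matrix.of e).transpose * Matrix.of d = 1 := mul_eq_one_comm.1 h.dual_mul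

theorem dual_swap (j k : Fin 6) : e j ⬝ᵥ d k = if j = k then 1 else 0 := by
  rw [dotProduct_comm, h.dual]
  simp [eq_comm]

theorem sum_smul (x : Fin 6 → K) : ∑ j, (d j ⬝ᵥ x) • e j = x := by
  have := congrArg (fun M => M.mulVec x) h.mul_dual
  simp only [Matrix.one_mulVec, ← Matrix.mulVec_mulVec] at this
  conv_rhs => rw [← this]
  funext i
  simp [Matrix.mulVec, dotProduct, mul_comm]

theorem sum_smul_dual (y : Fin 6 → K) : ∑ j, (e j ⬝ᵥ y) • d j = y := by
  have hm : (Matrix.of d).transpose * Matrix.of e = 1 := by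
    have := congrArg Matrix.transpose h.mul_dual
    rwa [Matrix.transpose_mul, Matrix.transpose_transpose, Matrix.transpose_one] at this
  have := congrArg (fun M => M.mulVec y) hm
  simp only [Matrix.one_mulVec, ← Matrix.mulVec_mulVec] at this
  conv_rhs => rw [← this]
  funext i
  simp [Matrix.mulVec, dotProduct, mul_comm]

theorem coord_sum_smul (c : Fin 6 → K) (j : Fin 6) : d j ⬝ᵥ ∑ k, c k • e k = c j := by
  simp [dotProduct_sum, h.dual]

theorem coord_sum_smul_dual (c : Fin 6 → K) (j : Fin 6) : e j ⬝ᵥ ∑ k, c k • d k = c j := by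
  simp [dotProduct_sum, h.dual_swap]

theorem ext_coord {x y : Fin 6 → K} (hxy : ∀ j, d j ⬝ᵥ x = d j ⬝ᵥ y) : x = y := by
  rw [← h.sum_smul x, ← h.sum_smul y]
  simp [hxy]

theorem ext_coord_dual {x y : Fin 6 → K} (hxy : ∀ j, e j ⬝ᵥ x = e j ⬝ᵥ y) : x = y := by
  rw [← h.sum_smul_dual x, ← h.sum_smul_dual y]
  simp [hxy]

theorem eq_add_frameTail (x : Fin 6 → K) :
    x = ((d 0 ⬝ᵥ x) • e 0 + (d 1 ⬝ᵥ x) • e 1 + (d 2 ⬝ᵥ x) • e 2) + frameTail e d x := by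
  conv_lhs => rw [← h.sum_smul x]
  rw [Fin.sum_univ_six, frameTail]
  abel

/-- Only the first argument is split; using this on the arguments in turn, by symmetry, expands the
cubic and its gradient. -/
theorem form_eq_add (x y v : Fin 6 → K) : T x y v =
    2 * ((d 0 ⬝ᵥ x) * (d 4 ⬝ᵥ y) * (d 4 ⬝ᵥ v) +
      (d 1 ⬝ᵥ x) * ((d 4 ⬝ᵥ y) * (d 5 ⬝ᵥ v) + (d 5 ⬝ᵥ y) * (d 4 ⬝ᵥ v)) +
      (d 2 ⬝ᵥ x) * (d 5 ⬝ᵥ y) * (d 5 ⬝ᵥ v)) + T (frameTail e d x) y v := by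
  conv_lhs => rw [h.eq_add_frameTail x]
  rw [map_add T, map_add T, map_add T, map_smul T, map_smul T, map_smul T]
  simp only [LinearMap.add_apply, LinearMap.smul_apply, h.form_zero, h.form_one, h.form_two,
    smul_eq_mul]
  ring

theorem coord_frameTail (x : Fin 6 → K) (j : Fin 6) :
    d j ⬝ᵥ frameTail e d x = if 3 ≤ j then d j ⬝ᵥ x else 0 := by
  simp only [frameTail, dotProduct_add, dotProduct_smul, h.dual, smul_eq_mul]
  fin_cases j <;> simp

theorem coord_four_frameTail (x : Fin 6 → K) : d 4 ⬝ᵥ frameTail e d x = d 4 ⬝ᵥ x := by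
  rw [h.coord_frameTail, if_pos (by decide)]

theorem coord_five_frameTail (x : Fin 6 → K) : d 5 ⬝ᵥ frameTail e d x = d 5 ⬝ᵥ x := by
  rw [h.coord_frameTail, if_pos (by decide)]

/-- The cubic form in the coordinates of the frame. -/
theorem form_self (hT : IsNondegSymm T) (x : Fin 6 → K) : T x x x =
    6 * ((d 0 ⬝ᵥ x) * (d 4 ⬝ᵥ x) ^ 2 + 2 * (d 1 ⬝ᵥ x) * (d 4 ⬝ᵥ x) * (d 5 ⬝ᵥ x) +
      (d 2 ⬝ᵥ x) * (d 5 ⬝ᵥ x) ^ 2) +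
    T (frameTail e d x) (frameTail e d x) (frameTail e d x) := by
  rw [h.form_eq_add x x x, hT.rotate (frameTail e d x) x x, h.form_eq_add x x, hT.swap_left _ x,
    h.form_eq_add x (frameTail e d x), h.coord_four_frameTail, h.coord_five_frameTail]
  ring

theorem form_self_apply (hT : IsNondegSymm T) (x v : Fin 6 → K) : T x x v =
    2 * ((d 0 ⬝ᵥ x) * (d 4 ⬝ᵥ x) * (d 4 ⬝ᵥ v) +
      (d 1 ⬝ᵥ x) * ((d 4 ⬝ᵥ x) * (d 5 ⬝ᵥ v) + (d 5 ⬝ᵥ x) * (d 4 ⬝ᵥ v)) +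
      (d 2 ⬝ᵥ x) * (d 5 ⬝ᵥ x) * (d 5 ⬝ᵥ v)) * 2 + T (frameTail e d x) (frameTail e d x) v := by
  rw [h.form_eq_add x x v, hT.swap_left _ x, h.form_eq_add x (frameTail e d x),
    h.coord_four_frameTail, h.coord_five_frameTail]
  ring

end IsNormalFrame

/-! ### The canonical form -/

theorem eval_linearSubst {n : ℕ} (A : Matrix (Fin (n + 1)) (Fin (n + 1)) K)
    (f : MvPolynomial (Fin (n + 1)) K) (x : Fin (n + 1) → K) :
    eval x (linearSubst A f) = eval (A.mulVec x) f := by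
  rw [linearSubst, ← coe_aeval_eq_eval, RingHom.coe_coe, aeval_bind₁, ← coe_aeval_eq_eval,
    RingHom.coe_coe]
  congr 2
  funext i
  simp [Matrix.mulVec, dotProduct]

/-- At (0, 0, t, 0, 0, 1), where x₄ = 0, the polynomial is t plus a constant, so it is not
identically zero there. -/
theorem X_four_not_dvd (D : MvPolynomial (Fin 3) K) :
    ¬ (X 4 : MvPolynomial (Fin 6) K) ∣ 2 * X 1 * X 4 * X 5 + X 2 * X 5 ^ 2 + rename ![3, 4, 5] D := by
  rintro ⟨q, hq⟩
  have key : ∀ t : K, t + eval ![0, 0, 1] D = 0 := fun t => by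
    have := congrArg (eval ![0, 0, t, 0, 0, 1]) hq
    simp only [map_add, map_mul, map_pow, eval_X, eval_rename] at this
    have e : (![0, 0, t, 0, 0, 1] ∘ ![3, 4, 5] : Fin 3 → K) = ![0, 0, 1] := by
      funext i
      fin_cases i <;> rfl
    rw [e] at this
    simpa using this
  have h0 := key 0
  have h1 := key 1
  rw [zero_add] at h0
  rw [h0, add_zero] at h1
  exact one_ne_zero h1

/-- The form is linear in x₀, with leading coefficient x₄² prime to the remaining terms. -/
theorem irreducible_canonicalForm (D : MvPolynomial (Fin 3) K) : Irreducible (canonicalForm D) := by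
  set R : MvPolynomial (Fin 6) K := 2 * X 1 * X 4 * X 5 + X 2 * X 5 ^ 2 + rename ![3, 4, 5] D with hR
  have hX4 : Irreducible (X 4 : MvPolynomial (Fin 6) K) := X_prime.irreducible
  have e : canonicalForm D = X 4 ^ 2 * X 0 + R := by
    rw [canonicalForm, hR]
    ring
  rw [e]
  refine irreducible_mul_X_add _ _ 0 (pow_ne_zero 2 (X_ne_zero _)) (fun hm => ?_) (fun hm => ?_) ?_
  · have := vars_pow _ _ hm
    simp at this
  · have hmem : R ∈ supported K ({0}ᶜ : Set (Fin 6)) := by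
      have hX : ∀ i : Fin 6, i ≠ 0 → (X i : MvPolynomial (Fin 6) K) ∈ supported K ({0}ᶜ : Set _) :=
        fun i hi => X_mem_supported.2 hi
      refine add_mem (add_mem (mul_mem (mul_mem (mul_mem ?_ (hX 1 (by decide))) (hX 4 (by decide)))
        (hX 5 (by decide))) (mul_mem (hX 2 (by decide)) (pow_mem (hX 5 (by decide)) 2))) ?_
      · exact ofNat_mem _ 2
      · rw [mem_supported]
        intro i hi
        obtain ⟨j, -, rfl⟩ := Finset.mem_image.1 (vars_rename _ _ hi)
        fin_cases j <;> simp
    exact mem_supported.1 hmem hm rfl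
  · exact (hX4.isRelPrime_iff_not_dvd.2 (X_four_not_dvd D)).pow_left

end NormalFrame

/-! ### Reduction of the cubic to canonical form -/

section

variable {K : Type*} [Field K] {e d : Fin 6 → Fin 6 → K} {f : MvPolynomial (Fin 6) K}

theorem exists_linearSubst_eq_canonicalForm [CharZero K]
    (hf : f.IsHomogeneous 3) (hT : IsNondegSymm (polarForm f))
    (h : IsNormalFrame (polarForm f) e d) :
    ∃ D : MvPolynomial (Fin 3) K, D.IsHomogeneous 3 ∧
      linearSubst (N := 5) (Matrix.of e).transpose f = canonicalForm D := by
  let t : Fin 3 → Fin 6 → K := ![e 3, e 4, e 5]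
  -- This is f restricted to ⟨e₃, e₄, e₅⟩, by T(x, x, x) = 6 f(x).
  let D : MvPolynomial (Fin 3) K := ∑ i, ∑ j, ∑ k,
    C (6⁻¹ * polarForm f (t i) (t j) (t k)) * (X i * X j * X k)
  refine ⟨D, ?_, ?_⟩
  · refine .sum _ _ _ fun i _ => .sum _ _ _ fun j _ => .sum _ _ _ fun k _ => ?_
    exact ((isHomogeneous_C _ _).mul (((isHomogeneous_X K i).mul (isHomogeneous_X K j)).mul
      (isHomogeneous_X K k)))
  · refine MvPolynomial.funext fun c => ?_
    have hx : (Matrix.of e).transpose.mulVec c = ∑ j, c j • e j := by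
      funext i
      simp [Matrix.mulVec, dotProduct, mul_comm]
    have e6 : (6 : K) ≠ 0 := by norm_num
    rw [eval_linearSubst, hx]
    apply mul_left_cancel₀ e6
    rw [← polarForm_self_self hf, h.form_self hT]
    simp only [frameTail, h.coord_sum_smul]
    have hD : eval (c ∘ ![3, 4, 5]) D =
        6⁻¹ * polarForm f (c 3 • e 3 + c 4 • e 4 + c 5 • e 5) (c 3 • e 3 + c 4 • e 4 + c 5 • e 5)
          (c 3 • e 3 + c 4 • e 4 + c 5 • e 5) := by
      simp only [D, Fin.sum_univ_three, map_add, map_mul, eval_C, eval_X, Function.comp_apply,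
        LinearMap.add_apply, map_smul, LinearMap.smul_apply, smul_eq_mul, t, Matrix.cons_val]
      ring
    rw [canonicalForm]
    simp only [map_add, map_mul, map_pow, eval_X, eval_rename, hD, map_ofNat]
    field_simp

theorem irreducible_of_normalFrame [CharZero K] (hf : f.IsHomogeneous 3)
    (hT : IsNondegSymm (polarForm f)) (h : IsNormalFrame (polarForm f) e d) : Irreducible f := by
  obtain ⟨D, -, hD⟩ := exists_linearSubst_eq_canonicalForm hf hT h
  -- The substitution has an inverse, so it reflects units and irreducibility can be pulled back.
  have hloc : IsLocalHom (bind₁ fun i => ∑ j, C ((Matrix.of e).transpose i j) * X j :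
      MvPolynomial (Fin 6) K →ₐ[K] MvPolynomial (Fin 6) K) := ⟨fun g hg => by
    have h1 : IsUnit (linearSubst (N := 5) (Matrix.of d)
      (linearSubst (N := 5) (Matrix.of e).transpose g)) := hg.map (bind₁ _)
    have h2 : linearSubst (N := 5) (Matrix.of d)
        (linearSubst (N := 5) (Matrix.of e).transpose g) = g := MvPolynomial.funext fun x => by
      rw [eval_linearSubst, eval_linearSubst, Matrix.mulVec_mulVec, h.mul_dual, Matrix.one_mulVec]
    rwa [h2] at h1⟩
  refine Irreducible.of_map (f := (bind₁ fun i => ∑ j, C ((Matrix.of e).transpose i j) * X j :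
      MvPolynomial (Fin 6) K →ₐ[K] MvPolynomial (Fin 6) K)) ?_
  exact (hD ▸ irreducible_canonicalForm D : Irreducible (linearSubst (N := 5) _ f))

theorem exists_projectivelyEquivalent_canonicalForm [CharZero K]
    (hf : f.IsHomogeneous 3) (hT : IsNondegSymm (polarForm f))
    (h : IsNormalFrame (polarForm f) e d) :
    ∃ D : MvPolynomial (Fin 3) K, D.IsHomogeneous 3 ∧
      ProjectivelyEquivalent (N := 5) f (canonicalForm D) := by
  obtain ⟨D, hD, hfD⟩ := exists_linearSubst_eq_canonicalForm hf hT h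
  exact ⟨D, hD, ⟨(Matrix.of e).transpose, Matrix.of d, h.mul_dual, h.dual_mul⟩, 1, by simp [hfD]⟩

end

/-! ### Parametrized sets -/

section Param

variable {K : Type*} [Field K]

theorem aeval_eval {σ τ : Type*} (θ : σ → MvPolynomial τ K) (t : τ → K) (p : MvPolynomial σ K) :
    aeval (fun i => eval t (θ i)) p = eval t (aeval θ p) := by
  rw [← coe_aeval_eq_eval, RingHom.coe_coe, ← aeval_bind₁]
  rfl

/-- A polynomial vanishes on S exactly when its pullback by θ is zero: the image of θ covers S, and
θ lands in S on the dense set g ≠ 0. The coordinate ring of S thus becomes a subring of a polynomial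
ring, which makes irreducibility automatic. -/
theorem vanishingIdeal_eq_ker [Infinite K] {σ τ : Type*} {S : Set (σ → K)}
    (θ : σ → MvPolynomial τ K) (g : MvPolynomial τ K) {b : τ → K} (hb : eval b g ≠ 0)
    (h1 : ∀ t, eval t g ≠ 0 → (fun i => eval t (θ i)) ∈ S)
    (h2 : ∀ a ∈ S, ∃ t, (fun i => eval t (θ i)) = a) :
    vanishingIdeal K S = RingHom.ker (aeval θ : MvPolynomial σ K →ₐ[K] MvPolynomial τ K) := by
  ext p
  rw [mem_vanishingIdeal_iff, RingHom.mem_ker]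
  constructor
  · intro hp
    refine MvPolynomial.funext fun t => ?_
    rw [map_zero]
    refine (isPolyFun_eval (aeval θ p)).eq_zero_of_mul (isPolyFun_eval g) (fun t ht => ?_) hb t
    rw [← aeval_eval]
    exact hp _ (h1 t ht)
  · intro hp a ha
    obtain ⟨t, rfl⟩ := h2 a ha
    rw [aeval_eval, hp, map_zero]

theorem isPrime_ker_aeval {σ τ : Type*} (θ : σ → MvPolynomial τ K) :
    (RingHom.ker (aeval θ : MvPolynomial σ K →ₐ[K] MvPolynomial τ K)).IsPrime :=
  RingHom.ker_isPrime _

/-- The quotient is isomorphic to the image of θ, over which the polynomial ring in n variables is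
integral, so both have the same transcendence degree. -/
theorem trdeg_quotient_ker {σ : Type} {n : ℕ} (θ : σ → MvPolynomial (Fin n) K)
    (hθ : ∀ j, IsIntegral (aeval θ : MvPolynomial σ K →ₐ[K] MvPolynomial (Fin n) K).range
      (X j : MvPolynomial (Fin n) K)) :
    Cardinal.toNat (Algebra.trdeg K (MvPolynomial σ K ⧸
      RingHom.ker (aeval θ : MvPolynomial σ K →ₐ[K] MvPolynomial (Fin n) K))) = n := by
  set φ := (aeval θ : MvPolynomial σ K →ₐ[K] MvPolynomial (Fin n) K) with hφ
  have hint : Algebra.IsIntegral φ.range (MvPolynomial (Fin n) K) := ⟨fun p => by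
    induction p using MvPolynomial.induction_on with
    | C a => exact isIntegral_algebraMap (x := (⟨C a, C a, by simp [hφ]⟩ : φ.range))
    | add p q hp hq => exact hp.add hq
    | mul_X p i hp => exact hp.mul (hθ i)⟩
  have h1 := trdeg_add_eq K φ.range (A := MvPolynomial (Fin n) K)
  rw [trdeg_eq_zero (R := φ.range) (A := MvPolynomial (Fin n) K), add_zero,
    MvPolynomial.trdeg_of_isDomain] at h1
  have h2 : Algebra.trdeg K (MvPolynomial σ K ⧸ RingHom.ker φ) = Algebra.trdeg K φ.range :=
    (Ideal.quotientKerEquivRange φ).trdeg_eq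
  rw [h2, h1]
  simp

/-- The chain rule. -/
theorem polyDeriv_aeval {n m : ℕ} (θ : Fin m → MvPolynomial (Fin n) K)
    (g : MvPolynomial (Fin m) K) (t v : Fin n → K) :
    polyDeriv (aeval θ g) t v = polyDeriv g (fieldAt θ t) (fieldDeriv θ t v) := by
  induction g using MvPolynomial.induction_on with
  | C a => simp [polyDeriv_apply]
  | add p q hp hq =>
    have hadd : ∀ {k : ℕ} (p q : MvPolynomial (Fin k) K) (a y : Fin k → K),
        polyDeriv (p + q) a y = polyDeriv p a y + polyDeriv q a y := fun p q a y => by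
      simp [polyDeriv_apply, add_mul, Finset.sum_add_distrib]
    rw [map_add, hadd, hadd, hp, hq]
  | mul_X p i hp =>
    have hX : polyDeriv (X i) (fieldAt θ t) (fieldDeriv θ t v) = polyDeriv (θ i) t v := by
      simp [polyDeriv_apply, pderiv_X, Pi.single_apply, apply_ite, fieldDeriv_apply]
    rw [map_mul, aeval_X, polyDeriv_mul, polyDeriv_mul, hp, hX, eval_X]
    have : eval (fieldAt θ t) p = eval t (aeval θ p) := by
      rw [← aeval_eval]
      rfl
    rw [this]
    rfl

/-- The linear form given by a vector. -/
noncomputable def linPoly {n : ℕ} (a : Fin n → K) : MvPolynomial (Fin n) K := ∑ i, C (a i) * X i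

@[simp] theorem eval_linPoly {n : ℕ} (a x : Fin n → K) : eval x (linPoly a) = a ⬝ᵥ x := by
  simp [linPoly, dotProduct]

theorem polyDeriv_linPoly {n : ℕ} (a x y : Fin n → K) : polyDeriv (linPoly a) x y = a ⬝ᵥ y := by
  rw [linPoly, polyDeriv_sum, dotProduct]
  refine Finset.sum_congr rfl fun i _ => ?_
  rw [polyDeriv_C_mul]
  simp [polyDeriv_apply, pderiv_X, Pi.single_apply, apply_ite]

theorem polyDeriv_eq_zero_of_line [Infinite K] {n : ℕ} {g : MvPolynomial (Fin n) K}
    {x y : Fin n → K} (h : ∀ E : K, eval (x + E • y) g = 0) : polyDeriv g x y = 0 := by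
  let θ : Fin n → MvPolynomial (Fin 1) K := fun i => C (x i) + C (y i) * X 0
  have hθ : ∀ t, fieldAt θ t = x + t 0 • y := fun t => by
    funext i
    simp [fieldAt, θ, mul_comm]
  have h0 : aeval θ g = 0 := MvPolynomial.funext fun t => by
    rw [← aeval_eval, map_zero]
    exact (congrArg (fun v => eval v g) (hθ t)).trans (h _)
  have h1 := polyDeriv_aeval θ g 0 1
  rw [h0, hθ] at h1
  have h2 : fieldDeriv θ 0 1 = y := by
    funext i
    simp [fieldDeriv_apply, polyDeriv_apply, θ]
  rw [h2] at h1
  simpa [polyDeriv_apply] using h1.symm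

/-- The hyperplane orthogonal to a vector. -/
def dotKer {n : ℕ} (a : Fin n → K) : Submodule K (Fin n → K) :=
  LinearMap.ker (dotProductBilin K K a)

theorem mem_dotKer {n : ℕ} {a x : Fin n → K} : x ∈ dotKer a ↔ a ⬝ᵥ x = 0 := Iff.rfl

theorem finrank_dotKer {n : ℕ} {a : Fin (n + 1) → K} (ha : a ≠ 0) :
    Module.finrank K (dotKer a) = n := by
  have hne : dotProductBilin K K a ≠ 0 := fun h => ha (by
    rw [← dotProduct_eq_zero_iff]
    exact fun w => LinearMap.congr_fun h w)
  have := Module.Dual.finrank_ker_add_one_of_ne_zero hne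
  rw [Module.finrank_fin_fun] at this
  exact Nat.add_right_cancel this

theorem dualSubspace_dotKer {N : ℕ} {a : Fin (N + 1) → K} (ha : a ≠ 0) :
    dualSubspace (dotKer a) = K ∙ a := by
  ext x
  rw [Submodule.mem_span_singleton]
  constructor
  · intro hx
    obtain ⟨i, hi⟩ := Function.ne_iff.1 ha
    refine ⟨x i / a i, funext fun j => ?_⟩
    have h := hx (a i • Pi.single j 1 - a j • Pi.single i 1) (by
      rw [mem_dotKer]
      simp [mul_comm])
    change (a i • Pi.single j 1 - a j • Pi.single i 1) ⬝ᵥ x = 0 at h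
    simp at h
    have hi' : a i ≠ 0 := hi
    simp only [Pi.smul_apply, smul_eq_mul]
    field_simp
    linear_combination -h
  · rintro ⟨c, rfl⟩ y hy
    have : a ⬝ᵥ y = 0 := hy
    change y ⬝ᵥ (c • a) = 0
    rw [dotProduct_smul, dotProduct_comm, this, smul_zero]

theorem exists_rep_mk {N : ℕ} (v : Fin (N + 1) → K) (hv : v ≠ 0) :
    ∃ c : K, c ≠ 0 ∧ (Projectivization.mk K v hv).rep = c • v := by
  obtain ⟨a, ha⟩ := Projectivization.exists_smul_eq_mk_rep K v hv
  exact ⟨a, a.ne_zero, ha.symm⟩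

theorem rep_mem_affineCone {N : ℕ} {S : Set (PSpace K N)} {p : PSpace K N} (hp : p ∈ S) :
    p.rep ∈ affineCone S :=
  ⟨p.rep_nonzero, by rwa [p.mk_rep]⟩

theorem mem_linearSpace {N : ℕ} {L : Submodule K (Fin (N + 1) → K)} {p : PSpace K N} :
    p ∈ linearSpace L ↔ p.rep ∈ L := by
  change p.submodule ≤ L ↔ _
  rw [Projectivization.submodule_eq, Submodule.span_singleton_le_iff_mem]

theorem mem_tangentSpace {N : ℕ} {S : Set (PSpace K N)} {z : PSpace K N} {y : Fin (N + 1) → K} :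
    y ∈ tangentSpace S z ↔ ∀ g ∈ projIdeal S, polyDeriv g z.rep y = 0 := by
  simp only [polyDeriv_apply]
  rfl

end Param

/-! ### The polar image -/

section PolarImage

variable {K : Type*} [Field K] {e d : Fin 6 → Fin 6 → K}
  {T : (Fin 6 → K) →ₗ[K] (Fin 6 → K) →ₗ[K] (Fin 6 → K) →ₗ[K] K}

/-- The quadratic equation of the polar image. -/
noncomputable def quadricPoly (e : Fin 6 → Fin 6 → K) : MvPolynomial (Fin 6) K :=
  linPoly (e 1) * linPoly (e 1) - C 4 * (linPoly (e 0) * linPoly (e 2))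

theorem eval_quadricPoly (y : Fin 6 → K) : eval y (quadricPoly e) =
    (e 1 ⬝ᵥ y) ^ 2 - 4 * ((e 0 ⬝ᵥ y) * (e 2 ⬝ᵥ y)) := by
  simp [quadricPoly]
  ring

theorem polyDeriv_quadricPoly (y v : Fin 6 → K) : polyDeriv (quadricPoly e) y v =
    2 * (e 1 ⬝ᵥ y) * (e 1 ⬝ᵥ v) -
      4 * ((e 0 ⬝ᵥ y) * (e 2 ⬝ᵥ v) + (e 2 ⬝ᵥ y) * (e 0 ⬝ᵥ v)) := by
  have hsub : ∀ (p q : MvPolynomial (Fin 6) K), polyDeriv (p - q) y v =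
      polyDeriv p y v - polyDeriv q y v := fun p q => by
    simp [polyDeriv_apply, sub_mul, Finset.sum_sub_distrib]
  rw [quadricPoly, hsub, polyDeriv_mul, polyDeriv_C_mul, polyDeriv_mul]
  simp only [polyDeriv_linPoly, eval_linPoly]
  ring

/-- The coordinates of the parametrization of the polar image in the dual frame. -/
noncomputable def polarCoord : Fin 6 → MvPolynomial (Fin 5) K :=
  ![X 0 * X 0, C 2 * (X 0 * X 1), X 1 * X 1, X 2, X 3, X 4]

/-- The parametrization of the polar image. -/
noncomputable def polarParam (d : Fin 6 → Fin 6 → K) : Fin 6 → MvPolynomial (Fin 5) K :=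
  fun i => ∑ j, C (d j i) * polarCoord j

theorem eval_polarParam (t : Fin 5 → K) : (fun i => eval t (polarParam d i)) =
    ∑ j, (![t 0 * t 0, 2 * (t 0 * t 1), t 1 * t 1, t 2, t 3, t 4] j) • d j := by
  funext i
  simp only [polarParam, map_sum, map_mul, eval_C, Finset.sum_apply, Pi.smul_apply, smul_eq_mul]
  refine Finset.sum_congr rfl fun j _ => ?_
  rw [mul_comm]
  congr 1
  fin_cases j <;> simp [polarCoord]

/-- The point of the conic `Z^*` with parameters `s` and `r`. -/
def conicVec (e : Fin 6 → Fin 6 → K) (s r : K) : Fin 6 → K :=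
  (r * r) • e 0 - (s * r) • e 1 + (s * s) • e 2

theorem conicVec_smul (c s r : K) : conicVec e (c * s) (c * r) = (c * c) • conicVec e s r := by
  simp only [conicVec]
  module

theorem conicVec_dot (s r : K) (y : Fin 6 → K) : conicVec e s r ⬝ᵥ y =
    r * r * (e 0 ⬝ᵥ y) - s * r * (e 1 ⬝ᵥ y) + s * s * (e 2 ⬝ᵥ y) := by
  simp [conicVec, add_dotProduct, sub_dotProduct, smul_dotProduct]

/-- Square roots s, r of a and c give b = ±2sr, and the sign is absorbed into r. -/
theorem exists_conic_param [IsAlgClosed K] [CharZero K] {a b c : K} (h : b ^ 2 - 4 * (a * c) = 0) :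
    ∃ s r : K, a = s * s ∧ b = 2 * (s * r) ∧ c = r * r := by
  obtain ⟨s, hs⟩ := IsAlgClosed.exists_pow_nat_eq a (n := 2) (by norm_num)
  obtain ⟨r, hr⟩ := IsAlgClosed.exists_pow_nat_eq c (n := 2) (by norm_num)
  have h1 : (b - 2 * (s * r)) * (b + 2 * (s * r)) = 0 := by
    rw [← hs, ← hr] at h
    linear_combination h
  rcases mul_eq_zero.1 h1 with h2 | h2
  · exact ⟨s, r, by rw [← hs]; ring, by linear_combination h2, by rw [← hr]; ring⟩
  · exact ⟨s, -r, by rw [← hs]; ring, by linear_combination h2, by rw [← hr]; ring⟩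

theorem exists_root_of_ne_zero [IsAlgClosed K] [CharZero K] (a b c : K) (h : a ≠ 0 ∨ b ≠ 0) :
    ∃ x, a * (x * x) + b * x + c = 0 := by
  by_cases ha : a = 0
  · have hb : b ≠ 0 := by simpa [ha] using h
    exact ⟨-c / b, by rw [ha]; field_simp; ring⟩
  · have : NeZero (2 : K) := ⟨two_ne_zero⟩
    exact exists_quadratic_eq_zero ha (IsAlgClosed.exists_eq_mul_self _)

namespace IsNormalFrame

variable (h : IsNormalFrame T e d)
include h

theorem conicVec_ne_zero {s r : K} (hsr : ¬ (s = 0 ∧ r = 0)) : conicVec e s r ≠ 0 := by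
  intro h0
  have ha := congrArg (fun v => d 0 ⬝ᵥ v) h0
  have hb := congrArg (fun v => d 2 ⬝ᵥ v) h0
  simp only [conicVec, dotProduct_add, dotProduct_sub, dotProduct_smul, h.dual, smul_eq_mul,
    dotProduct_zero] at ha hb
  simp at ha hb
  exact hsr ⟨hb, ha⟩

theorem coord_polarParam (t : Fin 5 → K) (j : Fin 6) :
    e j ⬝ᵥ (fun i => eval t (polarParam d i)) =
      ![t 0 * t 0, 2 * (t 0 * t 1), t 1 * t 1, t 2, t 3, t 4] j := by
  rw [eval_polarParam, h.coord_sum_smul_dual]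

theorem eval_polarParam_quadric (t : Fin 5 → K) :
    eval (fun i => eval t (polarParam d i)) (quadricPoly e) = 0 := by
  rw [eval_quadricPoly, h.coord_polarParam, h.coord_polarParam, h.coord_polarParam]
  simp
  ring

theorem exists_polarParam_eq [IsAlgClosed K] [CharZero K] {y : Fin 6 → K}
    (hy : eval y (quadricPoly e) = 0) : ∃ t, (fun i => eval t (polarParam d i)) = y := by
  rw [eval_quadricPoly] at hy
  obtain ⟨s, r, h0, h1, h2⟩ := exists_conic_param hy
  refine ⟨![s, r, e 3 ⬝ᵥ y, e 4 ⬝ᵥ y, e 5 ⬝ᵥ y], h.ext_coord_dual fun j => ?_⟩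
  rw [h.coord_polarParam]
  fin_cases j <;> simp [h0, h1, h2]

/-- The dual frame coordinates of the parametrization include t₀², t₁², t₂, t₃, t₄. -/
theorem isIntegral_polarParam (j : Fin 5) : IsIntegral
    (aeval (polarParam d) : MvPolynomial (Fin 6) K →ₐ[K] MvPolynomial (Fin 5) K).range
      (X j : MvPolynomial (Fin 5) K) := by
  have hmem : ∀ k, polarCoord k ∈
      (aeval (polarParam d) : MvPolynomial (Fin 6) K →ₐ[K] MvPolynomial (Fin 5) K).range :=
    fun k => ⟨linPoly (e k), by
      rw [linPoly]
      simp only [RingHom.coe_coe, AlgHom.toRingHom_eq_coe, map_sum, map_mul, aeval_X, polarParam]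
      simp only [algHom_C, algebraMap_eq, Finset.mul_sum]
      rw [Finset.sum_comm]
      have : ∀ j, ∑ i, C (e k i) * (C (d j i) * polarCoord j) =
          C (e k ⬝ᵥ d j) * (polarCoord j : MvPolynomial (Fin 5) K) := fun j => by
        rw [dotProduct, map_sum, Finset.sum_mul]
        exact Finset.sum_congr rfl fun i _ => by rw [C_mul, mul_assoc]
      simp only [this, h.dual_swap]
      simp⟩
  have hint : ∀ k, IsIntegral
      (aeval (polarParam d) : MvPolynomial (Fin 6) K →ₐ[K] MvPolynomial (Fin 5) K).range
      (polarCoord k : MvPolynomial (Fin 5) K) := fun k =>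
    isIntegral_algebraMap (x := (⟨polarCoord k, hmem k⟩ : (aeval (polarParam d) :
      MvPolynomial (Fin 6) K →ₐ[K] MvPolynomial (Fin 5) K).range))
  fin_cases j
  · refine IsIntegral.of_pow (n := 2) two_pos ?_
    rw [pow_two]
    exact hint 0
  · refine IsIntegral.of_pow (n := 2) two_pos ?_
    rw [pow_two]
    exact hint 2
  · exact hint 3
  · exact hint 4
  · exact hint 5

/-- This makes the polar map dominant onto the quadric. If the three values vanished, T(e₃) would be
a combination of T(e₀), T(e₁), T(e₂), involving only the coordinates 4 and 5, and injectivity of T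
would put e₃ in ⟨e₀, e₁, e₂⟩. -/
theorem form_three_three [CharZero K] (hT : IsNondegSymm T) :
    T (e 3) (e 3) (e 3) ≠ 0 ∨ T (e 3) (e 3) (e 4) ≠ 0 ∨ T (e 3) (e 3) (e 5) ≠ 0 := by
  by_contra! hall
  obtain ⟨h3, h4, h5⟩ := hall
  have hl : ∀ x y, T (e 3) x y = T (e 3) (frameTail e d x) y := fun x y => by
    rw [hT.swap_left, h.form_eq_add x, hT.swap_left _ (e 3)]
    simp [h.dual]
  have hu : e 3 = (2⁻¹ * T (e 3) (e 4) (e 4)) • e 0 + (2⁻¹ * T (e 3) (e 4) (e 5)) • e 1 +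
      (2⁻¹ * T (e 3) (e 5) (e 5)) • e 2 := by
    refine hT.injective (LinearMap.ext₂ fun x y => ?_)
    rw [hl, hT.swap_right, hl]
    simp only [map_add, map_smul, LinearMap.add_apply, LinearMap.smul_apply, h.form_zero,
      h.form_one, h.form_two, frameTail, h3, h4, h5, hT.swap_right (e 3) (e 4) (e 3),
      hT.swap_right (e 3) (e 5) (e 3), hT.swap_right (e 3) (e 5) (e 4), smul_eq_mul]
    ring
  have := congrArg (fun v => d 3 ⬝ᵥ v) hu
  simp [h.dual] at this

end IsNormalFrame

section

variable [CharZero K] {f : MvPolynomial (Fin 6) K}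

/-- The gradient is half of T(x, x, ·). Its first three components put the polar image on the
quadric y₁² = 4y₀y₂. -/
theorem dot_grad_eq (hf : f.IsHomogeneous 3) (hT : IsNondegSymm (polarForm f))
    (h : IsNormalFrame (polarForm f) e d) (x : Fin 6 → K) (j : Fin 6) :
    e j ⬝ᵥ grad (N := 5) f x = ![(d 4 ⬝ᵥ x) * (d 4 ⬝ᵥ x), 2 * ((d 4 ⬝ᵥ x) * (d 5 ⬝ᵥ x)),
      (d 5 ⬝ᵥ x) * (d 5 ⬝ᵥ x),
      2⁻¹ * polarForm f (frameTail e d x) (frameTail e d x) (e 3),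
      2 * ((d 0 ⬝ᵥ x) * (d 4 ⬝ᵥ x) + (d 1 ⬝ᵥ x) * (d 5 ⬝ᵥ x)) +
        2⁻¹ * polarForm f (frameTail e d x) (frameTail e d x) (e 4),
      2 * ((d 1 ⬝ᵥ x) * (d 4 ⬝ᵥ x) + (d 2 ⬝ᵥ x) * (d 5 ⬝ᵥ x)) +
        2⁻¹ * polarForm f (frameTail e d x) (frameTail e d x) (e 5)] j := by
  have h1 : ∀ v, v ⬝ᵥ grad (N := 5) f x = 2⁻¹ * polarForm f x x v := fun v => by
    rw [polarForm_self hf, dotProduct_comm]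
    ring
  rw [h1]
  have h2 : ∀ v, polarForm f x x v = polarForm f v x x := fun v => by
    rw [hT.rotate, hT.rotate]
  fin_cases j <;> simp only [Fin.reduceFinMk, Fin.zero_eta, Fin.mk_one, Matrix.cons_val]
  · rw [h2, h.form_zero, inv_mul_cancel_left₀ two_ne_zero]
  · rw [h2, h.form_one]
    ring
  · rw [h2, h.form_two, inv_mul_cancel_left₀ two_ne_zero]
  · rw [h.form_self_apply hT]
    simp [h.dual]
  · rw [h.form_self_apply hT]
    simp [h.dual]
    ring
  · rw [h.form_self_apply hT]
    simp [h.dual]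
    ring

theorem grad_smul (hf : f.IsHomogeneous 3) (c : K) (x : Fin 6 → K) :
    grad (N := 5) f (c • x) = (c * c) • grad (N := 5) f x := by
  refine dotProduct_eq _ _ fun v => ?_
  have h1 : ∀ x, grad (N := 5) f x ⬝ᵥ v = 2⁻¹ * polarForm f x x v := fun v => by
    rw [polarForm_self hf]
    ring
  rw [h1, smul_dotProduct, h1]
  simp
  ring

variable [IsAlgClosed K]

/-- Take x₄ = t₀, x₅ = t₁, x₂ = 0. The component along e₃ is an equation of degree one or two for
x₃, by `ht'`; the last two components are then linear in x₁ and x₀, with coefficient 2t₀. -/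
theorem exists_grad_eq (hf : f.IsHomogeneous 3) (hT : IsNondegSymm (polarForm f))
    (h : IsNormalFrame (polarForm f) e d) (t : Fin 5 → K) (ht : t 0 ≠ 0)
    (ht' : polarForm f (e 3) (e 3) (e 3) ≠ 0 ∨ t 0 * polarForm f (e 3) (e 3) (e 4) +
      t 1 * polarForm f (e 3) (e 3) (e 5) ≠ 0) :
    ∃ x, grad (N := 5) f x = fun i => eval t (polarParam d i) := by
  set w : Fin 6 → K := t 0 • e 4 + t 1 • e 5 with hw
  obtain ⟨r, hr⟩ := exists_root_of_ne_zero (polarForm f (e 3) (e 3) (e 3))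
    (2 * polarForm f (e 3) (e 3) w) (polarForm f w w (e 3) - 2 * t 2) (by
      simpa [hw] using ht')
  set v : Fin 6 → K := r • e 3 + t 0 • e 4 + t 1 • e 5 with hv
  let b : K := (2 * t 0)⁻¹ * (t 4 - 2⁻¹ * polarForm f v v (e 5))
  let a : K := (2 * t 0)⁻¹ * (t 3 - 2 * b * t 1 - 2⁻¹ * polarForm f v v (e 4))
  refine ⟨∑ j, ![a, b, 0, r, t 0, t 1] j • e j, h.ext_coord_dual fun j => ?_⟩
  rw [dot_grad_eq hf hT h, h.coord_polarParam, frameTail]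
  simp only [h.coord_sum_smul]
  simp only [Matrix.cons_val]
  rw [← hv]
  fin_cases j
  · simp
  · simp
  · simp
  · have e1 : polarForm f v v (e 3) = polarForm f (e 3) (e 3) (e 3) * (r * r) +
        2 * polarForm f (e 3) (e 3) w * r + polarForm f w w (e 3) := by
      have hvw : v = r • e 3 + w := by
        rw [hv, hw, add_assoc]
      rw [hvw]
      simp only [map_add, map_smul, LinearMap.add_apply, LinearMap.smul_apply, smul_eq_mul,
        hT.swap_left w (e 3), hT.swap_right (e 3) w (e 3)]
      ring
    simp only [Fin.reduceFinMk, Matrix.cons_val]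
    rw [e1]
    linear_combination 2⁻¹ * hr
  · simp [a, b]
    field_simp
    ring
  · simp [a, b]
    field_simp
    ring

theorem projIdeal_polarMap (hf : f.IsHomogeneous 3) (hT : IsNondegSymm (polarForm f))
    (h : IsNormalFrame (polarForm f) e d) :
    projIdeal {z : PSpace K 5 | ∃ p, PolarMapsTo f p z} = RingHom.ker (aeval (polarParam d) :
      MvPolynomial (Fin 6) K →ₐ[K] MvPolynomial (Fin 5) K) := by
  classical
  -- Nonvanishing of g is the hypothesis of `exists_grad_eq`; the second factor matters only when
  -- T(e₃, e₃, e₃) = 0.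
  let g : MvPolynomial (Fin 5) K := if polarForm f (e 3) (e 3) (e 3) = 0 then
    X 0 * (X 0 * C (polarForm f (e 3) (e 3) (e 4)) + X 1 * C (polarForm f (e 3) (e 3) (e 5))) else X 0
  have hg : ∀ t : Fin 5 → K, eval t g ≠ 0 ↔ t 0 ≠ 0 ∧ (polarForm f (e 3) (e 3) (e 3) ≠ 0 ∨
      t 0 * polarForm f (e 3) (e 3) (e 4) + t 1 * polarForm f (e 3) (e 3) (e 5) ≠ 0) := fun t => by
    by_cases h0 : polarForm f (e 3) (e 3) (e 3) = 0 <;> simp [g, h0]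
  obtain ⟨b, hb⟩ : ∃ b : Fin 5 → K, eval b g ≠ 0 := by
    simp only [hg]
    rcases h.form_three_three hT with h3 | h45
    · exact ⟨1, by simp [h3]⟩
    · by_cases h4 : polarForm f (e 3) (e 3) (e 4) = 0
      · exact ⟨1, by simp, .inr (by simpa [h4] using h45)⟩
      · exact ⟨![1, 0, 0, 0, 0], by simp [h4]⟩
  refine vanishingIdeal_eq_ker _ g hb (fun t ht => ?_) ?_
  · obtain ⟨ht0, ht1⟩ := (hg t).1 ht
    obtain ⟨x, hx⟩ := exists_grad_eq hf hT h t ht0 ht1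
    have hy : (fun i => eval t (polarParam d i)) ≠ 0 := fun hy => by
      have := h.coord_polarParam t 0
      rw [hy] at this
      simp [ht0] at this
    rw [← hx] at hy ⊢
    have hx0 : x ≠ 0 := by
      rintro rfl
      have := grad_smul hf 0 (0 : Fin 6 → K)
      rw [zero_smul, mul_zero, zero_smul] at this
      exact hy this
    obtain ⟨c, hc, hrep⟩ := exists_rep_mk (N := 5) x hx0
    have hgr : grad (N := 5) f (Projectivization.mk K x hx0).rep = (c * c) • grad (N := 5) f x := by
      rw [hrep, grad_smul hf]
    refine ⟨hy, Projectivization.mk K x hx0, ?_, ?_⟩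
    · rw [hgr]
      exact smul_ne_zero (mul_ne_zero hc hc) hy
    · rw [Projectivization.mk_eq_mk_iff']
      exact ⟨c * c, hgr.symm⟩
  · rintro y ⟨hy, p, hp, hpy⟩
    rw [Projectivization.mk_eq_mk_iff'] at hpy
    obtain ⟨c, hc⟩ := hpy
    have hc0 : c ≠ 0 := by
      rintro rfl
      exact hp (by rw [← hc, zero_smul])
    apply h.exists_polarParam_eq
    have hq : eval (c • y) (quadricPoly e) = 0 := by
      rw [hc, eval_quadricPoly, dot_grad_eq hf hT h, dot_grad_eq hf hT h, dot_grad_eq hf hT h]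
      simp
      ring
    rw [eval_quadricPoly] at hq ⊢
    simp only [dotProduct_smul, smul_eq_mul] at hq
    apply mul_left_cancel₀ (mul_ne_zero hc0 hc0)
    linear_combination hq

theorem mem_polarImage (hf : f.IsHomogeneous 3) (hT : IsNondegSymm (polarForm f))
    (h : IsNormalFrame (polarForm f) e d) (z : PSpace K 5) :
    z ∈ polarImage (N := 5) f ↔ eval z.rep (quadricPoly e) = 0 := by
  change z.rep ∈ zeroLocus K (projIdeal _) ↔ _
  rw [projIdeal_polarMap hf hT h, mem_zeroLocus_iff]
  constructor
  · intro hz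
    have := hz (quadricPoly e) ?_
    · rwa [← coe_aeval_eq_eval]
    · exact MvPolynomial.funext fun t => by
        rw [← aeval_eval, map_zero]
        exact h.eval_polarParam_quadric t
  · intro hz p hp
    obtain ⟨t, ht⟩ := h.exists_polarParam_eq hz
    rw [← ht, aeval_eval, hp, map_zero]

theorem projIdeal_polarImage (hf : f.IsHomogeneous 3) (hT : IsNondegSymm (polarForm f))
    (h : IsNormalFrame (polarForm f) e d) :
    projIdeal (polarImage (N := 5) f) = RingHom.ker (aeval (polarParam d) :
      MvPolynomial (Fin 6) K →ₐ[K] MvPolynomial (Fin 5) K) := by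
  have hsc : ∀ (c : K) (y : Fin 6 → K), eval (c • y) (quadricPoly e) =
      c * c * eval y (quadricPoly e) := fun c y => by
    simp only [eval_quadricPoly, dotProduct_smul, smul_eq_mul]
    ring
  refine vanishingIdeal_eq_ker _ (X 0) (b := 1) (by simp) (fun t ht => ?_) ?_
  · have hy : (fun i => eval t (polarParam d i)) ≠ 0 := fun hy => by
      have := h.coord_polarParam t 0
      rw [hy] at this
      simp at this ht
      exact ht this
    refine ⟨hy, ?_⟩
    rw [mem_polarImage hf hT h]
    obtain ⟨c, hc, hrep⟩ := exists_rep_mk (N := 5) _ hy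
    rw [hrep, hsc, h.eval_polarParam_quadric, mul_zero]
  · rintro y ⟨hy, hmem⟩
    rw [mem_polarImage hf hT h] at hmem
    obtain ⟨c, hc, hrep⟩ := exists_rep_mk (N := 5) _ hy
    rw [hrep, hsc] at hmem
    exact h.exists_polarParam_eq ((mul_eq_zero.1 hmem).resolve_left (mul_ne_zero hc hc))

theorem coneDim_polarImage (hf : f.IsHomogeneous 3) (hT : IsNondegSymm (polarForm f))
    (h : IsNormalFrame (polarForm f) e d) : coneDim (polarImage (N := 5) f) = 5 := by
  rw [coneDim, projIdeal_polarImage hf hT h]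
  exact trdeg_quotient_ker _ h.isIntegral_polarParam

theorem polarCodim_eq_one (hf : f.IsHomogeneous 3) (hT : IsNondegSymm (polarForm f))
    (h : IsNormalFrame (polarForm f) e d) : polarCodim (N := 5) f = 1 := by
  rw [polarCodim, coneDim_polarImage hf hT h]

end

end PolarImage

/-! ### The Perazzo map -/

section PerazzoMap

variable {K : Type*} [Field K] {e d : Fin 6 → Fin 6 → K}
  {T : (Fin 6 → K) →ₗ[K] (Fin 6 → K) →ₗ[K] (Fin 6 → K) →ₗ[K] K}

theorem eq_zero_of_mem_zeroLocus {σ : Type*} {S : Set (σ → K)} {a : σ → K}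
    (ha : a ∈ zeroLocus K (vanishingIdeal K S)) {g : (σ → K) → K} (hg : IsPolyFun g)
    (h0 : ∀ b ∈ S, g b = 0) : g a = 0 := by
  obtain ⟨p, hp⟩ := hg
  rw [← hp, ← coe_aeval_eq_eval]
  exact ha p fun b hb => (h0 b hb) ▸ (by rw [← hp, ← coe_aeval_eq_eval, RingHom.coe_coe])

theorem isPolyFun_dot {σ : Type*} {n : ℕ} (c : Fin n → K) {φ : (σ → K) → Fin n → K}
    (hφ : ∀ i, IsPolyFun fun a => φ a i) : IsPolyFun fun a => c ⬝ᵥ φ a :=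
  .sum _ fun i => (isPolyFun_const (c i)).mul (hφ i)

theorem fieldDeriv_polarParam (h : IsNormalFrame T e d) (t v : Fin 5 → K) (j : Fin 6) :
    e j ⬝ᵥ fieldDeriv (polarParam d) t v = ![2 * (t 0 * v 0), 2 * (t 0 * v 1 + t 1 * v 0),
      2 * (t 1 * v 1), v 2, v 3, v 4] j := by
  have h1 : fieldDeriv (polarParam d) t v = ∑ j, polyDeriv (polarCoord j) t v • d j := by
    funext i
    rw [fieldDeriv_apply, polarParam, polyDeriv_sum, Finset.sum_apply]
    refine Finset.sum_congr rfl fun j _ => ?_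
    rw [polyDeriv_C_mul, Pi.smul_apply, smul_eq_mul, mul_comm]
  have hX : ∀ i, polyDeriv (X i) t v = v i := fun i => by
    simp [polyDeriv_apply, pderiv_X, Pi.single_apply, apply_ite]
  have hC : polyDeriv (C 2) t v = 0 := by simp [polyDeriv_apply]
  rw [h1, h.coord_sum_smul_dual]
  fin_cases j <;> simp only [Fin.reduceFinMk, Fin.zero_eta, Fin.mk_one, Matrix.cons_val, polarCoord,
    polyDeriv_mul, hC, hX, eval_X, eval_C] <;> ring

theorem coord_conicVec (h : IsNormalFrame T e d) (s r : K) (j : Fin 6) :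
    d j ⬝ᵥ conicVec e s r = ![r * r, -(s * r), s * s, 0, 0, 0] j := by
  simp only [conicVec, dotProduct_add, dotProduct_sub, dotProduct_smul, h.dual, smul_eq_mul]
  fin_cases j <;> simp

theorem exists_conicVec_eq [CharZero K] [IsAlgClosed K] (h : IsNormalFrame T e d)
    {v : Fin 6 → K} (h3 : d 3 ⬝ᵥ v = 0) (h4 : d 4 ⬝ᵥ v = 0) (h5 : d 5 ⬝ᵥ v = 0)
    (hq : (d 1 ⬝ᵥ v) ^ 2 - (d 0 ⬝ᵥ v) * (d 2 ⬝ᵥ v) = 0) : ∃ s r, v = conicVec e s r := by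
  obtain ⟨s, r, ha, hb, hc⟩ := exists_conic_param (a := d 2 ⬝ᵥ v) (b := -2 * (d 1 ⬝ᵥ v))
    (c := d 0 ⬝ᵥ v) (by linear_combination 4 * hq)
  refine ⟨s, r, h.ext_coord fun j => ?_⟩
  rw [coord_conicVec h]
  fin_cases j
  · exact hc
  · simp only [Fin.mk_one, Matrix.cons_val]
    linear_combination (-2⁻¹ : K) * hb
  · exact ha
  · exact h3
  · exact h4
  · exact h5

/-- Proportionality of the coordinates r², −sr, s² forces (sr' − rs')² = 0; conversely, proportional
parameters give proportional vectors. -/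
theorem span_conicVec_eq_iff (h : IsNormalFrame T e d) {s r s' r' : K} (hsr : ¬ (s = 0 ∧ r = 0))
    (hsr' : ¬ (s' = 0 ∧ r' = 0)) : K ∙ conicVec e s r = K ∙ conicVec e s' r' ↔ s * r' = r * s' := by
  constructor
  · intro heq
    have hm : conicVec e s r ∈ K ∙ conicVec e s' r' := heq ▸ Submodule.mem_span_singleton_self _
    obtain ⟨c, hc⟩ := Submodule.mem_span_singleton.1 hm
    have hj : ∀ j, c * ![r' * r', -(s' * r'), s' * s', 0, 0, 0] j =
        ![r * r, -(s * r), s * s, 0, 0, 0] j := fun j => by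
      rw [← coord_conicVec h, ← coord_conicVec h, ← hc, dotProduct_smul, smul_eq_mul]
    have h0 : c * (r' * r') = r * r := hj 0
    have h1 : c * -(s' * r') = -(s * r) := hj 1
    have h2 : c * (s' * s') = s * s := hj 2
    have : (s * r' - r * s') ^ 2 = 0 := by
      linear_combination (-r' ^ 2) * h2 - (2 * r' * s') * h1 - s' ^ 2 * h0
    exact sub_eq_zero.1 (pow_eq_zero_iff two_ne_zero |>.1 this)
  · intro heq
    obtain ⟨c, hc, hs, hr⟩ : ∃ c : K, c ≠ 0 ∧ s = c * s' ∧ r = c * r' := by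
      by_cases hs' : s' = 0
      · have hr' : r' ≠ 0 := fun hr' => hsr' ⟨hs', hr'⟩
        have hs : s = 0 := by simpa [hs', hr'] using heq
        exact ⟨r / r', div_ne_zero (fun hr => hsr ⟨hs, hr⟩) hr', by simp [hs, hs'], by field_simp⟩
      · refine ⟨s / s', div_ne_zero (fun hs => hsr ⟨hs, ?_⟩) hs', by field_simp, by
          field_simp
          linear_combination -heq⟩
        rw [hs, zero_mul] at heq
        exact (mul_eq_zero.1 heq.symm).resolve_right hs'
    rw [hs, hr, conicVec_smul]
    exact Submodule.span_singleton_smul_eq (IsUnit.mk0 _ (mul_ne_zero hc hc)) _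

section

variable [CharZero K] [IsAlgClosed K] {f : MvPolynomial (Fin 6) K} (hf : f.IsHomogeneous 3)
  (hT : IsNondegSymm (polarForm f)) (h : IsNormalFrame (polarForm f) e d)
include hf hT h

theorem eval_eq_zero_of_mem_projIdeal {g : MvPolynomial (Fin 6) K}
    (hg : g ∈ projIdeal (polarImage (N := 5) f)) {y : Fin 6 → K}
    (hy : eval y (quadricPoly e) = 0) : eval y g = 0 := by
  rw [projIdeal_polarImage hf hT h] at hg
  obtain ⟨t, rfl⟩ := h.exists_polarParam_eq hy
  rw [← coe_aeval_eq_eval, RingHom.coe_coe, aeval_eval, hg, map_zero]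

theorem quadricPoly_mem_projIdeal : quadricPoly e ∈ projIdeal (polarImage (N := 5) f) := by
  rw [projIdeal_polarImage hf hT h]
  exact MvPolynomial.funext fun t => by
    rw [← aeval_eval, map_zero]
    exact h.eval_polarParam_quadric t

/-- The gradient of the quadric is −4 times the conic vector, which gives one inclusion. For the
other, the differential of the parametrization maps onto the whole hyperplane, so no generators of
the ideal are needed. -/
theorem tangentSpace_polarImage {z : PSpace K 5} {s r : K} (h0 : e 0 ⬝ᵥ z.rep = s * s)
    (h1 : e 1 ⬝ᵥ z.rep = 2 * (s * r)) (h2 : e 2 ⬝ᵥ z.rep = r * r) (hsr : ¬ (s = 0 ∧ r = 0)) :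
    tangentSpace (polarImage (N := 5) f) z = dotKer (conicVec e s r) := by
  ext y
  rw [mem_tangentSpace, mem_dotKer, conicVec_dot]
  constructor
  · intro hy
    have := hy _ (quadricPoly_mem_projIdeal hf hT h)
    rw [polyDeriv_quadricPoly, h0, h1, h2] at this
    linear_combination (-4⁻¹ : K) * this
  · intro hy g hg
    let t : Fin 5 → K := ![s, r, e 3 ⬝ᵥ z.rep, e 4 ⬝ᵥ z.rep, e 5 ⬝ᵥ z.rep]
    have hz : fieldAt (polarParam d) t = z.rep := h.ext_coord_dual fun j => by
      refine (h.coord_polarParam t j).trans ?_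
      fin_cases j <;> simp [t, h0, h1, h2]
    obtain ⟨a, b, ha, hab, hb⟩ : ∃ a b, e 0 ⬝ᵥ y = 2 * (s * a) ∧
        e 1 ⬝ᵥ y = 2 * (s * b + r * a) ∧ e 2 ⬝ᵥ y = 2 * (r * b) := by
      by_cases hs : s = 0
      · have hr : r ≠ 0 := fun hr => hsr ⟨hs, hr⟩
        subst hs
        have : e 0 ⬝ᵥ y = 0 := by simpa [hr] using hy
        exact ⟨(e 1 ⬝ᵥ y) / (2 * r), (e 2 ⬝ᵥ y) / (2 * r), by simp [this], by field_simp; ring,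
          by field_simp⟩
      · refine ⟨(e 0 ⬝ᵥ y) / (2 * s), ((e 1 ⬝ᵥ y) - r * (e 0 ⬝ᵥ y) / s) / (2 * s), by field_simp,
          by field_simp; ring, ?_⟩
        field_simp
        linear_combination hy
    have hyv : fieldDeriv (polarParam d) t ![a, b, e 3 ⬝ᵥ y, e 4 ⬝ᵥ y, e 5 ⬝ᵥ y] = y :=
      h.ext_coord_dual fun j => by
        rw [fieldDeriv_polarParam h]
        fin_cases j <;> simp [t, ha, hab, hb]
    rw [projIdeal_polarImage hf hT h] at hg
    rw [← hz, ← hyv, ← polyDeriv_aeval, hg]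
    simp [polyDeriv_apply]

/-- A line from a vertex point towards a point of the quadric stays in the quadric. Hence all
vectors of the quadric are tangent directions, and they span K⁶. -/
theorem tangentSpace_polarImage_vertex {z : PSpace K 5} (h0 : e 0 ⬝ᵥ z.rep = 0)
    (h1 : e 1 ⬝ᵥ z.rep = 0) (h2 : e 2 ⬝ᵥ z.rep = 0) :
    tangentSpace (polarImage (N := 5) f) z = ⊤ := by
  have key : ∀ y : Fin 6 → K, eval y (quadricPoly e) = 0 →
      y ∈ tangentSpace (polarImage (N := 5) f) z := fun y hy => by
    rw [mem_tangentSpace]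
    intro g hg
    refine polyDeriv_eq_zero_of_line fun E => eval_eq_zero_of_mem_projIdeal hf hT h hg ?_
    rw [eval_quadricPoly] at hy ⊢
    simp only [dotProduct_add, dotProduct_smul, h0, h1, h2, smul_eq_mul]
    linear_combination E ^ 2 * hy
  have hd : ∀ j : Fin 6, j ≠ 1 → d j ∈ tangentSpace (polarImage (N := 5) f) z := fun j hj => by
    refine key _ ?_
    rw [eval_quadricPoly, h.dual_swap, h.dual_swap, h.dual_swap]
    fin_cases j <;> simp at hj ⊢
  -- The vector d₁ is not on the quadric, but d₀ + 2d₁ + d₂ is.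
  have h012 := key (d 0 + (2 : K) • d 1 + d 2) (by
    rw [eval_quadricPoly]
    simp only [dotProduct_add, dotProduct_smul, h.dual_swap]
    simp
    norm_num)
  have hd1 : d 1 ∈ tangentSpace (polarImage (N := 5) f) z := by
    have hsub := Submodule.smul_mem _ (2⁻¹ : K) (Submodule.sub_mem _ (Submodule.sub_mem _ h012
      (hd 0 (by decide))) (hd 2 (by decide)))
    convert hsub using 1
    module
  rw [eq_top_iff]
  intro y _
  rw [← h.sum_smul_dual y]
  refine Submodule.sum_mem _ fun j _ => Submodule.smul_mem _ _ ?_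
  by_cases hj : j = 1
  · exact hj ▸ hd1
  · exact hd j hj

theorem mem_regularLocus_polarImage {z : PSpace K 5} :
    z ∈ regularLocus (polarImage (N := 5) f) ↔ ∃ s r, ¬ (s = 0 ∧ r = 0) ∧ e 0 ⬝ᵥ z.rep = s * s ∧
      e 1 ⬝ᵥ z.rep = 2 * (s * r) ∧ e 2 ⬝ᵥ z.rep = r * r := by
  constructor
  · rintro ⟨hz, hfr⟩
    rw [mem_polarImage hf hT h, eval_quadricPoly] at hz
    obtain ⟨s, r, h0, h1, h2⟩ := exists_conic_param hz
    refine ⟨s, r, ?_, h0, h1, h2⟩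
    rintro ⟨rfl, rfl⟩
    rw [tangentSpace_polarImage_vertex hf hT h (by simpa using h0) (by simpa using h1)
      (by simpa using h2), coneDim_polarImage hf hT h, finrank_top, Module.finrank_fin_fun] at hfr
    omega
  · rintro ⟨s, r, hsr, h0, h1, h2⟩
    refine ⟨?_, ?_⟩
    · rw [mem_polarImage hf hT h, eval_quadricPoly, h0, h1, h2]
      ring
    · rw [tangentSpace_polarImage hf hT h h0 h1 h2 hsr, coneDim_polarImage hf hT h,
        finrank_dotKer (h.conicVec_ne_zero hsr)]

/-- The gradient begins with x₄², 2x₄x₅, x₅², so the polar map hits a smooth point exactly off x₄ =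
x₅ = 0, and the dual of the tangent hyperplane there has parameters (x₄ : x₅). -/
theorem perazzoMapsTo_iff {p : PSpace K 5} {L : Submodule K (Fin 6 → K)} :
    PerazzoMapsTo (N := 5) f p L ↔ ¬ (d 4 ⬝ᵥ p.rep = 0 ∧ d 5 ⬝ᵥ p.rep = 0) ∧
      K ∙ conicVec e (d 4 ⬝ᵥ p.rep) (d 5 ⬝ᵥ p.rep) = L := by
  have key : ∀ hg : grad (N := 5) f p.rep ≠ 0, ∃ c : K, c ≠ 0 ∧
      e 0 ⬝ᵥ (Projectivization.mk K _ hg).rep = (c * (d 4 ⬝ᵥ p.rep)) * (c * (d 4 ⬝ᵥ p.rep)) ∧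
      e 1 ⬝ᵥ (Projectivization.mk K _ hg).rep = 2 * ((c * (d 4 ⬝ᵥ p.rep)) * (c * (d 5 ⬝ᵥ p.rep))) ∧
      e 2 ⬝ᵥ (Projectivization.mk K _ hg).rep = (c * (d 5 ⬝ᵥ p.rep)) * (c * (d 5 ⬝ᵥ p.rep)) := by
    intro hg
    obtain ⟨c, hc, hrep⟩ := exists_rep_mk (N := 5) _ hg
    -- The representative multiplies the gradient by c; on the parameters this is multiplication by
    -- a square root of c.
    obtain ⟨b, hb⟩ := IsAlgClosed.exists_pow_nat_eq c (n := 2) (by norm_num)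
    refine ⟨b, fun hb0 => hc (by rw [← hb, hb0]; ring), ?_, ?_, ?_⟩ <;>
    · rw [hrep, dotProduct_smul, dot_grad_eq hf hT h, ← hb]
      simp only [Matrix.cons_val, smul_eq_mul]
      ring
  have hspan : ∀ {c : K}, c ≠ 0 → K ∙ conicVec e (c * (d 4 ⬝ᵥ p.rep)) (c * (d 5 ⬝ᵥ p.rep)) =
      K ∙ conicVec e (d 4 ⬝ᵥ p.rep) (d 5 ⬝ᵥ p.rep) := fun {c} hc => by
    rw [conicVec_smul]
    exact Submodule.span_singleton_smul_eq (IsUnit.mk0 _ (mul_ne_zero hc hc)) _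
  constructor
  · rintro ⟨z, hz, ⟨hg, rfl⟩, rfl⟩
    obtain ⟨c, hc, h0, h1, h2⟩ := key hg
    have hne : ¬ (d 4 ⬝ᵥ p.rep = 0 ∧ d 5 ⬝ᵥ p.rep = 0) := by
      rintro ⟨h4, h5⟩
      obtain ⟨s, r, hsr, hs0, -, hr0⟩ := (mem_regularLocus_polarImage hf hT h).1 hz
      rw [h0, h4] at hs0
      rw [h2, h5] at hr0
      exact hsr ⟨by simpa using hs0.symm, by simpa using hr0.symm⟩
    have hne' : ¬ (c * (d 4 ⬝ᵥ p.rep) = 0 ∧ c * (d 5 ⬝ᵥ p.rep) = 0) := by simpa [hc] using hne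
    refine ⟨hne, ?_⟩
    rw [tangentSpace_polarImage hf hT h h0 h1 h2 hne',
      dualSubspace_dotKer (h.conicVec_ne_zero hne'), hspan hc]
  · rintro ⟨hne, rfl⟩
    have hg : grad (N := 5) f p.rep ≠ 0 := fun hg => hne (by
      have h0 := dot_grad_eq hf hT h p.rep 0
      have h2 := dot_grad_eq hf hT h p.rep 2
      rw [hg] at h0 h2
      simp at h0 h2
      exact ⟨h0, h2⟩)
    obtain ⟨c, hc, h0, h1, h2⟩ := key hg
    have hne' : ¬ (c * (d 4 ⬝ᵥ p.rep) = 0 ∧ c * (d 5 ⬝ᵥ p.rep) = 0) := by simpa [hc] using hne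
    refine ⟨_, (mem_regularLocus_polarImage hf hT h).2 ⟨_, _, hne', h0, h1, h2⟩, ⟨hg, rfl⟩, ?_⟩
    rw [tangentSpace_polarImage hf hT h h0 h1 h2 hne',
      dualSubspace_dotKer (h.conicVec_ne_zero hne'), hspan hc]

end

end PerazzoMap

/-! ### Families of linear spaces -/

section Families

variable {K : Type*} [Field K] {N : ℕ}

theorem mem_frames {k : ℕ} {F : Set (Submodule K (Fin (N + 1) → K))} {a : Fin k × Fin (N + 1) → K} :
    a ∈ frames k F ↔ LinearIndependent K (fun (i : Fin k) (j : Fin (N + 1)) => a (i, j)) ∧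
      Submodule.span K (Set.range fun (i : Fin k) (j : Fin (N + 1)) => a (i, j)) ∈ F := Iff.rfl

theorem frames_mono {k : ℕ} {F G : Set (Submodule K (Fin (N + 1) → K))} (hFG : F ⊆ G) :
    frames k F ⊆ frames k G := fun _ ha => ⟨ha.1, hFG ha.2⟩

theorem frames_nonempty {k : ℕ} {L : Submodule K (Fin (N + 1) → K)}
    (hL : Module.finrank K L = k) : ∃ a, a ∈ frames k {L} := by
  let b := Module.finBasisOfFinrankEq K L hL
  refine ⟨fun ij => (b ij.1 : Fin (N + 1) → K) ij.2, ?_, ?_⟩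
  · exact b.linearIndependent.map' L.subtype (Submodule.ker_subtype L)
  · have h1 : Set.range (fun i => (b i : Fin (N + 1) → K)) = L.subtype '' Set.range b := by
      rw [← Set.range_comp]
      rfl
    have h2 : Submodule.span K (Set.range fun i => (b i : Fin (N + 1) → K)) = L := by
      rw [h1, Submodule.span_image, b.span_eq, Submodule.map_top, Submodule.range_subtype]
    exact h2

theorem subset_grassClosure {k : ℕ} {F : Set (Submodule K (Fin (N + 1) → K))}
    (hF : ∀ L ∈ F, Module.finrank K L = k) : F ⊆ grassClosure k F := fun L hL =>
  ⟨hF L hL, fun _ ha _ hp => hp _ (frames_mono (Set.singleton_subset_iff.2 hL) ha)⟩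

theorem vanishingIdeal_frames_grassClosure {k : ℕ} {F : Set (Submodule K (Fin (N + 1) → K))}
    (hF : ∀ L ∈ F, Module.finrank K L = k) :
    vanishingIdeal K (frames k (grassClosure k F)) = vanishingIdeal K (frames k F) := by
  apply le_antisymm
  · exact vanishingIdeal_anti_mono (frames_mono (subset_grassClosure hF))
  · exact fun p hp a ha => ha.2.2 ⟨ha.1, rfl⟩ p hp

theorem grassClosure_grassClosure {k : ℕ} {F : Set (Submodule K (Fin (N + 1) → K))}
    (hF : ∀ L ∈ F, Module.finrank K L = k) :
    grassClosure k (grassClosure k F) = grassClosure k F := by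
  unfold grassClosure at *
  ext L
  have := vanishingIdeal_frames_grassClosure hF
  unfold grassClosure at this
  simp only [this]

/-- A polynomial relation between vectors that holds in all members of a family also holds in the
members of its closure. -/
theorem eq_zero_of_mem_grassClosure {k m : ℕ} {F : Set (Submodule K (Fin (N + 1) → K))}
    {L : Submodule K (Fin (N + 1) → K)} (hL : L ∈ grassClosure k F)
    {g : (Fin m × Fin (N + 1) → K) → K} (hg : IsPolyFun g)
    (h0 : ∀ M ∈ F, ∀ x : Fin m → Fin (N + 1) → K, (∀ i, x i ∈ M) → g (fun ij => x ij.1 ij.2) = 0)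
    {x : Fin m → Fin (N + 1) → K} (hx : ∀ i, x i ∈ L) : g (fun ij => x ij.1 ij.2) = 0 := by
  obtain ⟨a, ha⟩ := frames_nonempty hL.1
  have hx' : ∀ i, ∃ c : Fin k → K, ∑ l, c l • (fun j => a (l, j)) = x i := fun i => by
    rw [← Submodule.mem_span_range_iff_exists_fun, show Submodule.span K _ = L from ha.2]
    exact hx i
  choose c hc using hx'
  have hpoly : IsPolyFun fun b : Fin k × Fin (N + 1) → K =>
      g (fun ij => ∑ l, c ij.1 l * b (l, ij.2)) :=
    hg.comp fun ij => .sum _ fun l => (isPolyFun_const _).mul (isPolyFun_coord _)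
  have := eq_zero_of_mem_zeroLocus (hL.2 ha) hpoly fun b hb => by
    refine h0 _ hb.2 (fun i j => ∑ l, c i l * b (l, j)) fun i => ?_
    rw [Submodule.mem_span_range_iff_exists_fun]
    exact ⟨c i, by funext j; simp⟩
  rw [← this]
  congr 1
  funext ij
  rw [← hc]
  simp

theorem linearSpace_injective {L M : Submodule K (Fin (N + 1) → K)}
    (hLM : linearSpace L = linearSpace M) : L = M := by
  ext v
  by_cases hv : v = 0
  · simp [hv]
  have : ∀ L : Submodule K (Fin (N + 1) → K), v ∈ L ↔ Projectivization.mk K v hv ∈ linearSpace L :=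
    fun L => by
      change _ ↔ Projectivization.submodule _ ≤ L
      rw [Projectivization.submodule_mk, Submodule.span_singleton_le_iff_mem]
  rw [this, this, hLM]

end Families

/-! ### The image and the fibres of the Perazzo map -/

section PerazzoImage

variable {K : Type*} [Field K] {e d : Fin 6 → Fin 6 → K}

/-- The lines in `K ^ 6` that are the points of the conic. -/
def conicFamily (e : Fin 6 → Fin 6 → K) : Set (Submodule K (Fin (5 + 1) → K)) :=
  {L | ∃ s r : K, ¬ (s = 0 ∧ r = 0) ∧ K ∙ conicVec e s r = L}

/-- The hyperplane that is the fibre of the Perazzo map over a point of the conic. -/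
def fiberSpace (d : Fin 6 → Fin 6 → K) (s r : K) : Submodule K (Fin (5 + 1) → K) :=
  dotKer (r • d 4 - s • d 5)

theorem mem_fiberSpace {s r : K} {x : Fin 6 → K} :
    x ∈ fiberSpace d s r ↔ r * (d 4 ⬝ᵥ x) = s * (d 5 ⬝ᵥ x) := by
  rw [fiberSpace, mem_dotKer, sub_dotProduct, smul_dotProduct, smul_dotProduct, smul_eq_mul,
    smul_eq_mul, sub_eq_zero]

theorem finrank_of_mem_conicFamily
    {T : (Fin 6 → K) →ₗ[K] (Fin 6 → K) →ₗ[K] (Fin 6 → K) →ₗ[K] K} (h : IsNormalFrame T e d)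
    {L : Submodule K (Fin 6 → K)}
    (hL : L ∈ conicFamily e) : Module.finrank K L = 1 := by
  obtain ⟨s, r, hsr, rfl⟩ := hL
  exact finrank_span_singleton (h.conicVec_ne_zero hsr)

/-- The parametrization of the vectors on the conic. -/
noncomputable def conicParam (e : Fin 6 → Fin 6 → K) (ij : Fin 1 × Fin (5 + 1)) :
    MvPolynomial (Fin 2) K :=
  C (e 0 ij.2) * X 1 ^ 2 - C (e 1 ij.2) * (X 0 * X 1) + C (e 2 ij.2) * X 0 ^ 2

theorem eval_conicParam (t : Fin 2 → K) (ij : Fin 1 × Fin (5 + 1)) :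
    eval t (conicParam e ij) = conicVec e (t 0) (t 1) ij.2 := by
  simp [conicParam, conicVec]
  ring

theorem exists_point_coord
    {T : (Fin 6 → K) →ₗ[K] (Fin 6 → K) →ₗ[K] (Fin 6 → K) →ₗ[K] K} (h : IsNormalFrame T e d)
    {s r : K} (hsr : ¬ (s = 0 ∧ r = 0)) :
    ∃ (p : PSpace K 5) (c : K), c ≠ 0 ∧ d 4 ⬝ᵥ p.rep = c * s ∧ d 5 ⬝ᵥ p.rep = c * r := by
  have h4 : d 4 ⬝ᵥ (s • e 4 + r • e 5) = s := by simp [h.dual]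
  have h5 : d 5 ⬝ᵥ (s • e 4 + r • e 5) = r := by simp [h.dual]
  have hne : s • e 4 + r • e 5 ≠ 0 := fun h0 => hsr (by
    rw [h0, dotProduct_zero] at h4 h5
    exact ⟨h4.symm, h5.symm⟩)
  obtain ⟨c, hc, hrep⟩ := exists_rep_mk (N := 5) _ hne
  exact ⟨_, c, hc, by rw [hrep, dotProduct_smul, h4, smul_eq_mul],
    by rw [hrep, dotProduct_smul, h5, smul_eq_mul]⟩

variable [IsAlgClosed K]

/-- Scaling a conic vector by c is scaling its parameters by a square root of c, so every generator
of a member is itself a conic vector. -/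
theorem mem_frames_conicFamily {T : (Fin 6 → K) →ₗ[K] (Fin 6 → K) →ₗ[K] (Fin 6 → K) →ₗ[K] K}
    (h : IsNormalFrame T e d) {a : Fin 1 × Fin (5 + 1) → K} :
    a ∈ frames 1 (conicFamily e) ↔
      ∃ s r : K, ¬ (s = 0 ∧ r = 0) ∧ (fun j => a (0, j)) = conicVec e s r := by
  rw [mem_frames]
  have hr : Set.range (fun (i : Fin 1) (j : Fin 6) => a (i, j)) = {fun j => a (0, j)} := by
    rw [Set.range_unique]
    rfl
  constructor
  · rintro ⟨hli, s, r, hsr, hs⟩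
    rw [hr] at hs
    have hm : (fun j => a (0, j)) ∈ K ∙ conicVec e s r := hs ▸ Submodule.mem_span_singleton_self _
    obtain ⟨c, hc⟩ := Submodule.mem_span_singleton.1 hm
    obtain ⟨b, hb⟩ := IsAlgClosed.exists_pow_nat_eq c (n := 2) (by norm_num)
    have hb0 : b ≠ 0 := by
      rintro rfl
      have : (fun j => a (0, j)) ≠ 0 := hli.ne_zero 0
      rw [← hc, ← hb] at this
      simp at this
    exact ⟨b * s, b * r, by simpa [hb0] using hsr, by rw [conicVec_smul, ← hc, ← hb, pow_two]⟩
  · rintro ⟨s, r, hsr, hs⟩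
    refine ⟨?_, s, r, hsr, by rw [hr, hs]⟩
    rw [linearIndependent_unique_iff]
    change (fun j => a (0, j)) ≠ 0
    rw [hs]
    exact h.conicVec_ne_zero hsr

variable [CharZero K]

/-- The conic is cut out by x₃ = x₄ = x₅ = 0 and x₁² = x₀x₂, and these equations persist in the
closure. -/
theorem grassClosure_conicFamily {T : (Fin 6 → K) →ₗ[K] (Fin 6 → K) →ₗ[K] (Fin 6 → K) →ₗ[K] K}
    (h : IsNormalFrame T e d) : grassClosure 1 (conicFamily e) = conicFamily e := by
  refine Set.Subset.antisymm (fun L hL => ?_)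
    (subset_grassClosure fun L hL => finrank_of_mem_conicFamily h hL)
  obtain ⟨a, ha⟩ := frames_nonempty hL.1
  have hz := hL.2 ha
  have hrow : ∀ c : Fin 6 → K, IsPolyFun fun b : Fin 1 × Fin (5 + 1) → K => c ⬝ᵥ fun j => b (0, j) :=
    fun c => isPolyFun_dot c fun i => isPolyFun_coord _
  have hlin : ∀ i : Fin 6, 3 ≤ i → d i ⬝ᵥ (fun j => a (0, j)) = 0 := fun i hi =>
    eq_zero_of_mem_zeroLocus hz (hrow (d i)) fun b hb => by
      obtain ⟨s, r, -, hs⟩ := (mem_frames_conicFamily h).1 hb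
      rw [hs, coord_conicVec h]
      fin_cases i <;> simp at hi ⊢
  have hq := eq_zero_of_mem_zeroLocus hz (((hrow (d 1)).pow 2).sub ((hrow (d 0)).mul (hrow (d 2))))
    fun b hb => by
      obtain ⟨s, r, -, hs⟩ := (mem_frames_conicFamily h).1 hb
      rw [hs, coord_conicVec h, coord_conicVec h, coord_conicVec h]
      simp
      ring
  obtain ⟨s, r, hs⟩ := exists_conicVec_eq h (hlin 3 (by decide)) (hlin 4 (by decide))
    (hlin 5 (by decide)) hq
  have hne : ¬ (s = 0 ∧ r = 0) := by
    rintro ⟨rfl, rfl⟩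
    have := ha.1.ne_zero 0
    exact this (hs.trans (by simp [conicVec]))
  have ha' : a ∈ frames 1 (conicFamily e) := (mem_frames_conicFamily h).2 ⟨s, r, hne, hs⟩
  have h1 := ha'.2
  rwa [show Submodule.span K _ = L from ha.2] at h1

theorem vanishingIdeal_frames_conicFamily
    {T : (Fin 6 → K) →ₗ[K] (Fin 6 → K) →ₗ[K] (Fin 6 → K) →ₗ[K] K} (h : IsNormalFrame T e d) :
    vanishingIdeal K (frames 1 (conicFamily e)) = RingHom.ker (aeval (conicParam e) :
      MvPolynomial (Fin 1 × Fin (5 + 1)) K →ₐ[K] MvPolynomial (Fin 2) K) := by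
  refine vanishingIdeal_eq_ker _ (X 0) (b := 1) (by simp) (fun t ht => ?_) fun a ha => ?_
  · rw [mem_frames_conicFamily h]
    exact ⟨t 0, t 1, fun h0 => ht (by simpa using h0.1), by
      funext j
      exact eval_conicParam t (0, j)⟩
  · obtain ⟨s, r, -, hs⟩ := (mem_frames_conicFamily h).1 ha
    refine ⟨![s, r], ?_⟩
    funext ⟨i, j⟩
    rw [eval_conicParam, Subsingleton.elim i 0]
    exact (congrFun hs j).symm

/-- The generators fill the cone over the conic, of dimension 2, and scaling takes away one. -/
theorem familyDim_conicFamily {T : (Fin 6 → K) →ₗ[K] (Fin 6 → K) →ₗ[K] (Fin 6 → K) →ₗ[K] K}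
    (h : IsNormalFrame T e d) : familyDim 1 (conicFamily e) = 1 := by
  rw [familyDim, vanishingIdeal_frames_conicFamily h, trdeg_quotient_ker]
  · norm_num
  intro j
  have hmem : ∀ k, aeval (conicParam e) (∑ j, C (d k j) * X (0, j)) ∈
      (aeval (conicParam e) : MvPolynomial (Fin 1 × Fin (5 + 1)) K →ₐ[K] MvPolynomial (Fin 2) K).range :=
    fun k => ⟨_, rfl⟩
  have hval : ∀ k, aeval (conicParam e) (∑ j, C (d k j) * X (0, j)) =
      (![X 1 ^ 2, -(X 0 * X 1), X 0 ^ 2, 0, 0, 0] : Fin 6 → MvPolynomial (Fin 2) K) k := fun k =>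
    MvPolynomial.funext fun t => by
      simp only [map_sum, map_mul, aeval_X, algHom_C, algebraMap_eq, eval_C, eval_conicParam]
      refine (coord_conicVec h (t 0) (t 1) k).trans ?_
      fin_cases k <;> simp [pow_two]
  have hint : ∀ k, IsIntegral
      (aeval (conicParam e) : MvPolynomial (Fin 1 × Fin (5 + 1)) K →ₐ[K] MvPolynomial (Fin 2) K).range
      ((![X 1 ^ 2, -(X 0 * X 1), X 0 ^ 2, 0, 0, 0] : Fin 6 → MvPolynomial (Fin 2) K) k) := fun k => by
    rw [← hval]
    exact isIntegral_algebraMap (x := (⟨_, hmem k⟩ : (aeval (conicParam e) :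
      MvPolynomial (Fin 1 × Fin (5 + 1)) K →ₐ[K] MvPolynomial (Fin 2) K).range))
  fin_cases j
  · exact IsIntegral.of_pow two_pos (hint 2)
  · exact IsIntegral.of_pow two_pos (hint 0)

section

variable {f : MvPolynomial (Fin 6) K} (hf : f.IsHomogeneous 3)
  (hT : IsNondegSymm (polarForm f)) (h : IsNormalFrame (polarForm f) e d)
include hf hT h

theorem perazzoImage_eq : perazzoImage (N := 5) f = conicFamily e := by
  have himg : {L | ∃ p, PerazzoMapsTo (N := 5) f p L} = conicFamily e := by
    ext L
    constructor
    · rintro ⟨p, hp⟩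
      obtain ⟨hne, hL⟩ := (perazzoMapsTo_iff hf hT h).1 hp
      exact ⟨_, _, hne, hL⟩
    · rintro ⟨s, r, hsr, rfl⟩
      obtain ⟨p, c, hc, h4, h5⟩ := exists_point_coord h hsr
      have hne : ¬ (c * s = 0 ∧ c * r = 0) := by simpa [hc] using hsr
      refine ⟨p, (perazzoMapsTo_iff hf hT h).2 ?_⟩
      rw [h4, h5]
      exact ⟨hne, (span_conicVec_eq_iff h hne hsr).2 (by ring)⟩
  rw [perazzoImage, polarCodim_eq_one hf hT h, himg, grassClosure_conicFamily h]

theorem perazzoRank_eq_one : perazzoRank (N := 5) f = 1 := by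
  rw [perazzoRank, polarCodim_eq_one hf hT h, perazzoImage_eq hf hT h, familyDim_conicFamily h]

/-- The fibre is the hyperplane rx₄ = sx₅ without its subspace x₄ = x₅ = 0. A point of that subspace
is a limit along the direction s e₄ + r e₅, since the general point of such a line is in the fibre.
-/
theorem perazzoFiber_eq {s r : K} (hsr : ¬ (s = 0 ∧ r = 0)) :
    perazzoFiber (N := 5) f (K ∙ conicVec e s r) = linearSpace (fiberSpace d s r) := by
  have hfib : ∀ p : PSpace K 5, PerazzoMapsTo (N := 5) f p (K ∙ conicVec e s r) ↔
      ¬ (d 4 ⬝ᵥ p.rep = 0 ∧ d 5 ⬝ᵥ p.rep = 0) ∧ p.rep ∈ fiberSpace d s r := fun p => by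
    rw [perazzoMapsTo_iff hf hT h, mem_fiberSpace]
    refine and_congr_right fun hne => ?_
    rw [span_conicVec_eq_iff h hne hsr]
    constructor <;> intro h1 <;> linear_combination h1
  have hdot : ∀ (c : Fin 6 → K), IsPolyFun fun x : Fin 6 → K => c ⬝ᵥ x := fun c =>
    isPolyFun_dot c isPolyFun_coord
  ext p
  rw [mem_linearSpace]
  constructor
  · intro hp
    refine eq_zero_of_mem_zeroLocus hp (hdot (r • d 4 - s • d 5)) ?_
    rintro y ⟨hy, hmem⟩
    have hy1 := ((hfib _).1 hmem).2
    obtain ⟨c, hc, hrep⟩ := exists_rep_mk (N := 5) y hy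
    rw [hrep, Submodule.smul_mem_iff _ hc] at hy1
    exact hy1
  · intro hp g hg
    have key : ∀ x ∈ fiberSpace d s r, ¬ (d 4 ⬝ᵥ x = 0 ∧ d 5 ⬝ᵥ x = 0) → eval x g = 0 := by
      intro x hx hne
      have hx0 : x ≠ 0 := fun hx0 => hne (by simp [hx0])
      have := hg x ⟨hx0, (hfib _).2 ?_⟩
      · rwa [← coe_aeval_eq_eval]
      · obtain ⟨c, hc, hrep⟩ := exists_rep_mk (N := 5) x hx0
        rw [hrep]
        refine ⟨?_, Submodule.smul_mem _ _ hx⟩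
        simpa [dotProduct_smul, hc] using hne
    obtain ⟨v, hv, hdir⟩ : ∃ v, v = s • e 4 + r • e 5 ∧ v ∈ fiberSpace d s r := by
      refine ⟨_, rfl, ?_⟩
      rw [mem_fiberSpace]
      simp [h.dual]
      ring
    have hE : ∀ E : Fin 1 → K, eval (p.rep + E 0 • v) g = 0 := by
      have hpoly : ∀ i, IsPolyFun fun E : Fin 1 → K => (p.rep + E 0 • v) i :=
        fun i => (isPolyFun_const _).add ((isPolyFun_coord 0).mul (isPolyFun_const _))
      obtain ⟨c, hc0, hc⟩ : ∃ c : Fin 6 → K, (c = d 4 ∨ c = d 5) ∧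
          c ⬝ᵥ v ≠ 0 := by
        by_cases hs : s = 0
        · exact ⟨d 5, .inr rfl, by
            simpa [hv, h.dual] using fun hr => hsr ⟨hs, hr⟩⟩
        · exact ⟨d 4, .inl rfl, by simpa [hv, h.dual] using hs⟩
      refine IsPolyFun.eq_zero_of_mul ((isPolyFun_eval g).comp hpoly) ((hdot c).comp hpoly)
        (fun E hE => key _ (Submodule.add_mem _ hp (Submodule.smul_mem _ _ hdir)) ?_)
        (b := fun _ => (1 - c ⬝ᵥ p.rep) / (c ⬝ᵥ v)) ?_
      · rintro ⟨ha, hb⟩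
        rcases hc0 with rfl | rfl
        · exact hE ha
        · exact hE hb
      · change c ⬝ᵥ (p.rep + ((1 - c ⬝ᵥ p.rep) / (c ⬝ᵥ v)) • v) ≠ 0
        rw [dotProduct_add, dotProduct_smul, smul_eq_mul, div_mul_cancel₀ _ hc]
        simp
    have := hE 0
    simp only [Pi.zero_apply, zero_smul, add_zero] at this
    rwa [← coe_aeval_eq_eval] at this

end

end PerazzoImage

/-! ### The congruence of fibres -/

section Congruence

variable {K : Type*} [Field K]

/-- With `exists_matrix_of_mem_frames`, this parametrizes the bases of all members of a family by an
invertible matrix and the parameters of one chosen basis. -/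
theorem sum_smul_mem_frames {N k : ℕ} {M : Submodule K (Fin (N + 1) → K)}
    (hM : Module.finrank K M = k) {m : Fin k → Fin (N + 1) → K} (hm : LinearIndependent K m)
    (hmem : ∀ l, m l ∈ M) {G : Matrix (Fin k) (Fin k) K} (hG : G.det ≠ 0) :
    (fun ij : Fin k × Fin (N + 1) => ∑ l, G ij.1 l * m l ij.2) ∈ frames k {M} := by
  have hrow : (fun (i : Fin k) (j : Fin (N + 1)) => ∑ l, G i l * m l j) =
      fun i => ∑ l, G i l • m l := by
    funext i j
    simp
  have hli : LinearIndependent K fun i => ∑ l, G i l • m l := by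
    rw [Fintype.linearIndependent_iff]
    intro c hc
    have h1 : ∑ l, (∑ i, c i * G i l) • m l = 0 := by
      rw [← hc]
      simp only [Finset.sum_smul, Finset.smul_sum, smul_smul]
      exact Finset.sum_comm
    have h2 : Matrix.vecMul c G = 0 := funext fun l => Fintype.linearIndependent_iff.1 hm _ h1 l
    exact congrFun (Matrix.eq_zero_of_vecMul_eq_zero hG h2)
  rw [mem_frames]
  simp only [hrow]
  refine ⟨hli, Submodule.eq_of_le_of_finrank_le ?_ ?_⟩
  · rw [Submodule.span_le]
    rintro _ ⟨i, rfl⟩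
    exact Submodule.sum_mem _ fun l _ => Submodule.smul_mem _ _ (hmem l)
  · rw [hM, finrank_span_eq_card hli, Fintype.card_fin]

theorem exists_matrix_of_mem_frames {N k : ℕ} {M : Submodule K (Fin (N + 1) → K)}
    (hM : Module.finrank K M = k) {m : Fin k → Fin (N + 1) → K} (hm : LinearIndependent K m)
    (hmem : ∀ l, m l ∈ M) {a : Fin k × Fin (N + 1) → K} (ha : a ∈ frames k {M}) :
    ∃ G : Matrix (Fin k) (Fin k) K, ∀ i j, ∑ l, G i l * m l j = a (i, j) := by
  have hspan : Submodule.span K (Set.range m) = M := by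
    refine Submodule.eq_of_le_of_finrank_le ?_ ?_
    · rw [Submodule.span_le]
      rintro _ ⟨i, rfl⟩
      exact hmem i
    · rw [hM, finrank_span_eq_card hm, Fintype.card_fin]
  have hrow : ∀ i, ∃ c : Fin k → K, ∑ l, c l • m l = fun j => a (i, j) := fun i => by
    rw [← Submodule.mem_span_range_iff_exists_fun, hspan,
      ← show Submodule.span K _ = M from ha.2]
    exact Submodule.subset_span ⟨i, rfl⟩
  choose c hc using hrow
  refine ⟨c, fun i j => ?_⟩
  rw [← show _ = a (i, j) from congrFun (hc i) j]
  simp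

theorem isHomogeneous_linPoly {n : ℕ} (a : Fin n → K) : (linPoly a).IsHomogeneous 1 :=
  .sum _ _ _ fun i _ => by
    have := (isHomogeneous_C (Fin n) (a i)).mul (isHomogeneous_X K i)
    rwa [zero_add] at this

variable {e d : Fin 6 → Fin 6 → K}
  {T : (Fin 6 → K) →ₗ[K] (Fin 6 → K) →ₗ[K] (Fin 6 → K) →ₗ[K] K}

/-- A basis of a fibre of the Perazzo map. -/
def fiberBasis (e : Fin 6 → Fin 6 → K) (s r : K) : Fin 5 → Fin (5 + 1) → K :=
  ![e 0, e 1, e 2, e 3, s • e 4 + r • e 5]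

theorem fiberBasis_mem (h : IsNormalFrame T e d) (s r : K) (l : Fin 5) :
    fiberBasis e s r l ∈ fiberSpace d s r := by
  rw [mem_fiberSpace]
  fin_cases l <;> simp [fiberBasis, h.dual, mul_comm]

theorem finrank_fiberSpace (h : IsNormalFrame T e d) {s r : K} (hsr : ¬ (s = 0 ∧ r = 0)) :
    Module.finrank K (fiberSpace d s r) = 5 := by
  refine finrank_dotKer fun h0 => hsr ?_
  have h4 := congrArg (fun v => v ⬝ᵥ e 4) h0
  have h5 := congrArg (fun v => v ⬝ᵥ e 5) h0
  simp only [sub_dotProduct, smul_dotProduct, h.dual, zero_dotProduct, smul_eq_mul] at h4 h5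
  simp at h4 h5
  exact ⟨h5, h4⟩

theorem linearIndependent_fiberBasis (h : IsNormalFrame T e d) {s r : K}
    (hsr : ¬ (s = 0 ∧ r = 0)) : LinearIndependent K (fiberBasis e s r) := by
  rw [Fintype.linearIndependent_iff]
  intro c hc
  have hd : ∀ j, d j ⬝ᵥ ∑ l, c l • fiberBasis e s r l = 0 := fun j => by rw [hc, dotProduct_zero]
  simp only [fiberBasis, Fin.sum_univ_five, Matrix.cons_val, dotProduct_add, dotProduct_smul,
    h.dual, smul_eq_mul] at hd
  have h4 := hd 4
  have h5 := hd 5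
  simp at h4 h5
  intro i
  fin_cases i
  · simpa using hd 0
  · simpa using hd 1
  · simpa using hd 2
  · simpa using hd 3
  · by_contra hne
    exact hsr ⟨h4.resolve_left hne, h5.resolve_left hne⟩

theorem fiberSpace_eq {s r s' r' : K} (hsr : ¬ (s = 0 ∧ r = 0)) (hsr' : ¬ (s' = 0 ∧ r' = 0))
    (heq : s * r' = r * s') : fiberSpace d s r = fiberSpace d s' r' := by
  have key : ∀ {s r s' r' : K}, ¬ (s = 0 ∧ r = 0) → s * r' = r * s' →
      fiberSpace d s r ≤ fiberSpace d s' r' := by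
    intro s r s' r' hsr heq x hx
    rw [mem_fiberSpace] at hx ⊢
    rw [← sub_eq_zero]
    by_contra hne
    refine hsr ⟨(mul_eq_zero.1 ?_).resolve_right hne, (mul_eq_zero.1 ?_).resolve_right hne⟩
    · linear_combination s' * hx + (d 4 ⬝ᵥ x) * heq
    · linear_combination r' * hx + (d 5 ⬝ᵥ x) * heq
  exact le_antisymm (key hsr heq) (key hsr' (by linear_combination -heq))

/-- The family of the fibres of the Perazzo map. -/
def fiberFamily (d : Fin 6 → Fin 6 → K) : Set (Submodule K (Fin (5 + 1) → K)) :=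
  {M | ∃ s r : K, ¬ (s = 0 ∧ r = 0) ∧ fiberSpace d s r = M}

/-- The parametrization of the bases of the fibres of the Perazzo map. -/
noncomputable def fiberParam (e : Fin 6 → Fin 6 → K) (ij : Fin 5 × Fin (5 + 1)) :
    MvPolynomial ((Fin 5 × Fin 5) ⊕ Fin 2) K :=
  ∑ l, X (.inl (ij.1, l)) * (![C (e 0 ij.2), C (e 1 ij.2), C (e 2 ij.2), C (e 3 ij.2),
    X (.inr 0) * C (e 4 ij.2) + X (.inr 1) * C (e 5 ij.2)] : Fin 5 → _) l

theorem eval_fiberParam (t : (Fin 5 × Fin 5) ⊕ Fin 2 → K) (ij : Fin 5 × Fin (5 + 1)) :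
    eval t (fiberParam e ij) =
      ∑ l, t (.inl (ij.1, l)) * fiberBasis e (t (.inr 0)) (t (.inr 1)) l ij.2 := by
  rw [fiberParam, map_sum]
  refine Finset.sum_congr rfl fun l _ => ?_
  rw [map_mul, eval_X]
  congr 1
  fin_cases l <;> simp [fiberBasis]

theorem eval_det_X {τ : Type*} {k : ℕ} (t : τ → K) (φ : Fin k × Fin k → τ) :
    eval t (Matrix.det (Matrix.of fun i j => (X (φ (i, j)) : MvPolynomial τ K))) =
      Matrix.det (Matrix.of fun i j => t (φ (i, j))) := by
  rw [RingHom.map_det]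
  congr 1
  ext i j
  simp

/-- The parametrization of the bases gives irreducibility; through a point with x₄ ≠ 0 passes only
the hyperplane with (s : r) = (x₄ : x₅). -/
theorem isCongruence_fiberFamily [Infinite K] (h : IsNormalFrame T e d) :
    IsCongruence 5 (fiberFamily d) := by
  refine ⟨⟨?_, ?_⟩, ?_⟩
  · rintro M ⟨s, r, hsr, rfl⟩
    exact finrank_fiberSpace h hsr
  · rw [vanishingIdeal_eq_ker (fiberParam e)
      (Matrix.det (Matrix.of fun i j => X (.inl (i, j))) * X (.inr 0))
      (b := Sum.elim (fun ij => if ij.1 = ij.2 then 1 else 0) 1)]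
    · exact isPrime_ker_aeval _
    · rw [map_mul, eval_X, eval_det_X _ (Sum.inl : Fin 5 × Fin 5 → (Fin 5 × Fin 5) ⊕ Fin 2)]
      have : (Matrix.of fun i j => Sum.elim (fun ij : Fin 5 × Fin 5 =>
          if ij.1 = ij.2 then (1 : K) else 0) (1 : Fin 2 → K) (Sum.inl (i, j))) = 1 := by
        ext i j
        simp [Matrix.one_apply]
      rw [this]
      simp
    · intro t ht
      rw [map_mul, eval_X, eval_det_X _ (Sum.inl : Fin 5 × Fin 5 → (Fin 5 × Fin 5) ⊕ Fin 2)] at ht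
      obtain ⟨hdet, hs⟩ := mul_ne_zero_iff.1 ht
      have hsr : ¬ (t (.inr 0) = 0 ∧ t (.inr 1) = 0) := fun h0 => hs h0.1
      have := sum_smul_mem_frames (finrank_fiberSpace h hsr) (linearIndependent_fiberBasis h hsr)
        (fiberBasis_mem h _ _) hdet
      simp only [eval_fiberParam]
      have hmem : fiberSpace d (t (.inr 0)) (t (.inr 1)) ∈ fiberFamily d := ⟨_, _, hsr, rfl⟩
      exact frames_mono (Set.singleton_subset_iff.2 hmem) this
    · intro a ha
      obtain ⟨s, r, hsr, hM⟩ := ha.2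
      obtain ⟨G, hG⟩ := exists_matrix_of_mem_frames (finrank_fiberSpace h hsr)
        (linearIndependent_fiberBasis h hsr) (fiberBasis_mem h _ _) (a := a) ⟨ha.1, hM.symm⟩
      refine ⟨Sum.elim (fun ij => G ij.1 ij.2) ![s, r], ?_⟩
      funext ⟨i, j⟩
      rw [eval_fiberParam, ← hG]
      rfl
  · refine ⟨1, linPoly (d 4), isHomogeneous_linPoly _, ?_, ?_⟩
    · obtain ⟨p, c, hc, h4, -⟩ := exists_point_coord h (s := 1) (r := 0) (by simp)
      exact ⟨p, trivial, by rw [eval_linPoly, h4]; simpa using hc⟩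
    · intro p _ hp
      rw [eval_linPoly] at hp
      have hne : ¬ (d 4 ⬝ᵥ p.rep = 0 ∧ d 5 ⬝ᵥ p.rep = 0) := fun h0 => hp h0.1
      refine ⟨fiberSpace d (d 4 ⬝ᵥ p.rep) (d 5 ⬝ᵥ p.rep), ⟨⟨_, _, hne, rfl⟩, ?_⟩, ?_⟩
      · rw [mem_linearSpace, mem_fiberSpace, mul_comm]
      · rintro _ ⟨⟨s, r, hsr, rfl⟩, hmem⟩
        rw [mem_linearSpace, mem_fiberSpace] at hmem
        exact fiberSpace_eq hsr hne hmem.symm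

variable [CharZero K] [IsAlgClosed K] {f : MvPolynomial (Fin 6) K} (hf : f.IsHomogeneous 3)
  (hT : IsNondegSymm (polarForm f)) (h : IsNormalFrame (polarForm f) e d)
include hf hT h

theorem isSpecialPerazzoCubic_of_normalFrame (hhess : hessian (N := 5) f = 0)
    (hcone : ¬ IsCone (hypersurface (N := 5) f)) : IsSpecialPerazzoCubic (N := 5) f := by
  refine ⟨hf, irreducible_of_normalFrame hf hT h, hhess, hcone, conicFamily e,
    Submodule.span K (Set.range ![e 0, e 1, e 2, e 3]), 5, ?_, ?_, ?_, ?_, ?_⟩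
  · rw [polarCodim_eq_one hf hT h, perazzoImage_eq hf hT h]
    -- Every member of the Perazzo image is general enough, so the open subfamily is all of it, with
    -- g = 1.
    refine ⟨⟨_, 1, 0, by simp, rfl⟩, 1, ?_⟩
    ext L
    simp only [map_one, ne_eq, one_ne_zero, not_false_eq_true, and_true, Set.mem_ofPred_eq]
    exact ⟨fun hL => ⟨hL, frames_nonempty (finrank_of_mem_conicFamily h hL)⟩, fun hL => hL.1⟩
  · rw [perazzoRank_eq_one hf hT h]
    norm_num
  · have hli : LinearIndependent K ![e 0, e 1, e 2, e 3] := by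
      have := (linearIndependent_fiberBasis h (s := 1) (r := 0) (by simp)).comp
        (Fin.castSucc : Fin 4 → Fin 5) (Fin.castSucc_injective 4)
      convert this using 1
      funext i
      fin_cases i <;> rfl
    rw [perazzoRank_eq_one hf hT h, finrank_span_eq_card hli]
    norm_num
  · rintro _ ⟨s, r, hsr, rfl⟩
    refine ⟨fiberSpace d s r, perazzoFiber_eq hf hT h hsr, finrank_fiberSpace h hsr, ?_⟩
    rw [Submodule.span_le]
    rintro _ ⟨i, rfl⟩
    rw [SetLike.mem_coe, mem_fiberSpace]
    fin_cases i <;> simp [h.dual]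
  · convert isCongruence_fiberFamily h using 1
    ext M
    constructor
    · rintro ⟨_, ⟨s, r, hsr, rfl⟩, hM⟩
      rw [perazzoFiber_eq hf hT h hsr] at hM
      exact ⟨s, r, hsr, linearSpace_injective hM⟩
    · rintro ⟨s, r, hsr, rfl⟩
      exact ⟨_, ⟨s, r, hsr, rfl⟩, perazzoFiber_eq hf hT h hsr⟩

end Congruence

/-! ### The dual of the polar image -/

section Conic

variable {K : Type*} [Field K] {e d : Fin 6 → Fin 6 → K}

theorem subset_zariskiClosure {N : ℕ} (S : Set (PSpace K N)) : S ⊆ zariskiClosure S :=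
  fun _ hp _ hg => hg _ (rep_mem_affineCone hp)

theorem irreducible_conic : Irreducible (X 1 ^ 2 - X 0 * X 2 : MvPolynomial (Fin 3) K) := by
  have h0 : (X 1 ^ 2 - X 0 * X 2 : MvPolynomial (Fin 3) K) = -X 0 * X 2 + X 1 ^ 2 := by ring
  rw [h0]
  refine irreducible_mul_X_add _ _ 2 (neg_ne_zero.2 (X_ne_zero _)) (fun hm => ?_) (fun hm => ?_) ?_
  · rw [vars_neg, vars_X] at hm
    simp at hm
  · have := vars_pow _ _ hm
    simp at this
  · rw [IsRelPrime.neg_left_iff]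
    refine IsRelPrime.pow_right ?_
    rw [X_prime.irreducible.isRelPrime_iff_not_dvd, X_dvd_X]
    simp

variable [CharZero K] [IsAlgClosed K] {f : MvPolynomial (Fin 6) K} (hf : f.IsHomogeneous 3)
  (hT : IsNondegSymm (polarForm f)) (h : IsNormalFrame (polarForm f) e d)
include hf hT h

/-- Each tangent hyperplane at a smooth point is dual to a conic vector. Conversely the conic vector
with parameters s, r comes from the point s²d₀ + 2sr d₁ + r²d₂ of Z. -/
theorem mem_polarImageDual {p : PSpace K 5} :
    p ∈ polarImageDual (N := 5) f ↔ ∃ s r, p.rep = conicVec e s r := by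
  constructor
  · intro hp
    have key : ∀ x ∈ affineCone (⋃ z ∈ regularLocus (polarImage (N := 5) f),
        linearSpace (dualSubspace (tangentSpace (polarImage f) z))),
        ∃ c s r : K, x = c • conicVec e s r := by
      rintro x ⟨hx, hmem⟩
      obtain ⟨z, hz, hmem⟩ := Set.mem_iUnion₂.1 hmem
      obtain ⟨s, r, hsr, h0, h1, h2⟩ := (mem_regularLocus_polarImage hf hT h).1 hz
      rw [mem_linearSpace, tangentSpace_polarImage hf hT h h0 h1 h2 hsr,
        dualSubspace_dotKer (h.conicVec_ne_zero hsr)] at hmem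
      obtain ⟨c, hc, hrep⟩ := exists_rep_mk (N := 5) x hx
      rw [hrep, Submodule.smul_mem_iff _ hc] at hmem
      obtain ⟨c, rfl⟩ := Submodule.mem_span_singleton.1 hmem
      exact ⟨c, s, r, rfl⟩
    have hdot : ∀ (c : Fin 6 → K), IsPolyFun fun x : Fin 6 → K => c ⬝ᵥ x := fun c =>
      isPolyFun_dot c isPolyFun_coord
    have hlin : ∀ i : Fin 6, 3 ≤ i → d i ⬝ᵥ p.rep = 0 := fun i hi =>
      eq_zero_of_mem_zeroLocus hp (hdot (d i)) fun x hx => by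
        obtain ⟨c, s, r, rfl⟩ := key x hx
        rw [dotProduct_smul, coord_conicVec h]
        fin_cases i <;> simp at hi ⊢
    refine exists_conicVec_eq h (hlin 3 (by decide)) (hlin 4 (by decide)) (hlin 5 (by decide)) ?_
    refine eq_zero_of_mem_zeroLocus hp (((hdot (d 1)).pow 2).sub ((hdot (d 0)).mul (hdot (d 2))))
      fun x hx => ?_
    obtain ⟨c, s, r, rfl⟩ := key x hx
    simp only [dotProduct_smul, coord_conicVec h]
    simp
    ring
  · rintro ⟨s, r, hp⟩
    have hsr : ¬ (s = 0 ∧ r = 0) := by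
      rintro ⟨rfl, rfl⟩
      exact p.rep_nonzero (hp.trans (by simp [conicVec]))
    have hc : ∀ j, e j ⬝ᵥ ((s * s) • d 0 + (2 * (s * r)) • d 1 + (r * r) • d 2) =
        ![s * s, 2 * (s * r), r * r, 0, 0, 0] j := fun j => by
      simp only [dotProduct_add, dotProduct_smul, h.dual_swap]
      fin_cases j <;> simp
    have hv : (s * s) • d 0 + (2 * (s * r)) • d 1 + (r * r) • d 2 ≠ 0 := fun hv => hsr (by
      have h0 := hc 0
      have h2 := hc 2
      rw [hv] at h0 h2
      simp at h0 h2
      exact ⟨h0, h2⟩)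
    obtain ⟨c, hc0, hrep⟩ := exists_rep_mk (N := 5) _ hv
    obtain ⟨b, hb⟩ := IsAlgClosed.exists_pow_nat_eq c (n := 2) (by norm_num)
    have hb0 : b ≠ 0 := by
      rintro rfl
      exact hc0 (by rw [← hb]; ring)
    have hsr' : ¬ (b * s = 0 ∧ b * r = 0) := by simpa [hb0] using hsr
    have hz : ∀ j, e j ⬝ᵥ (Projectivization.mk K _ hv).rep =
        c * ![s * s, 2 * (s * r), r * r, 0, 0, 0] j := fun j => by
      rw [hrep, dotProduct_smul, hc, smul_eq_mul]
    have h0 : e 0 ⬝ᵥ (Projectivization.mk K _ hv).rep = b * s * (b * s) := by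
      rw [hz, ← hb]
      simp
      ring
    have h1 : e 1 ⬝ᵥ (Projectivization.mk K _ hv).rep = 2 * (b * s * (b * r)) := by
      rw [hz, ← hb]
      simp
      ring
    have h2 : e 2 ⬝ᵥ (Projectivization.mk K _ hv).rep = b * r * (b * r) := by
      rw [hz, ← hb]
      simp
      ring
    refine subset_zariskiClosure _ (Set.mem_iUnion₂.2 ⟨Projectivization.mk K _ hv,
      (mem_regularLocus_polarImage hf hT h).2 ⟨_, _, hsr', h0, h1, h2⟩, ?_⟩)
    rw [mem_linearSpace, tangentSpace_polarImage hf hT h h0 h1 h2 hsr',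
      dualSubspace_dotKer (h.conicVec_ne_zero hsr'), conicVec_smul,
      Submodule.span_singleton_smul_eq (IsUnit.mk0 _ (mul_ne_zero hb0 hb0)), hp]
    exact Submodule.mem_span_singleton_self _

theorem isConic_polarImageDual : IsConic (polarImageDual (N := 5) f) := by
  have hφ : ∀ v : Fin 3 → K, Fintype.linearCombination K ![e 0, e 1, e 2] v =
      v 0 • e 0 + v 1 • e 1 + v 2 • e 2 := fun v => by
    simp [Fintype.linearCombination_apply, Fin.sum_univ_three]
  have hd : ∀ (v : Fin 3 → K) (j : Fin 6), d j ⬝ᵥ Fintype.linearCombination K ![e 0, e 1, e 2] v =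
      ![v 0, v 1, v 2, 0, 0, 0] j := fun v j => by
    rw [hφ]
    simp only [dotProduct_add, dotProduct_smul, h.dual]
    fin_cases j <;> simp
  refine ⟨Fintype.linearCombination K ![e 0, e 1, e 2], X 1 ^ 2 - X 0 * X 2, ?_, ?_,
    irreducible_conic, ?_⟩
  · rw [← LinearMap.ker_eq_bot, LinearMap.ker_eq_bot']
    intro v hv
    have hv' := hd v
    simp only [hv, dotProduct_zero] at hv'
    funext i
    fin_cases i
    · exact (hv' 0).symm
    · exact (hv' 1).symm
    · exact (hv' 2).symm
  · exact ((isHomogeneous_X K 1).pow 2).sub ((isHomogeneous_X K 0).mul (isHomogeneous_X K 2))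
  · ext p
    rw [mem_polarImageDual hf hT h]
    constructor
    · rintro ⟨s, r, hp⟩
      refine ⟨![r * r, -(s * r), s * s], ?_, ?_⟩
      · rw [hφ, hp, conicVec]
        simp [sub_eq_add_neg]
      · simp
        ring
    · rintro ⟨v, hv, hq⟩
      refine exists_conicVec_eq h ?_ ?_ ?_ ?_ <;> rw [← hv]
      · exact hd v 3
      · exact hd v 4
      · exact hd v 5
      · rw [hd, hd, hd]
        simpa using hq

/-- Differentiating the equations of the conic bounds the tangent space from above, which suffices
for a plane to contain it. -/
theorem tangentSpace_polarImageDual {p : PSpace K 5} {c s r : K} (hc : c ≠ 0)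
    (hp : p.rep = c • conicVec e s r) {y : Fin 6 → K}
    (hy : y ∈ tangentSpace (polarImageDual (N := 5) f) p) :
    d 3 ⬝ᵥ y = 0 ∧ d 4 ⬝ᵥ y = 0 ∧ d 5 ⬝ᵥ y = 0 ∧
      s * s * (d 0 ⬝ᵥ y) + 2 * (s * r) * (d 1 ⬝ᵥ y) + r * r * (d 2 ⬝ᵥ y) = 0 := by
  rw [mem_tangentSpace] at hy
  have key : ∀ x ∈ affineCone (polarImageDual (N := 5) f), ∃ c s r : K, x = c • conicVec e s r := by
    rintro x ⟨hx, hmem⟩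
    obtain ⟨s, r, hsr⟩ := (mem_polarImageDual hf hT h).1 hmem
    obtain ⟨c, hc, hrep⟩ := exists_rep_mk (N := 5) x hx
    exact ⟨c⁻¹, s, r, by rw [← hsr, hrep, inv_smul_smul₀ hc]⟩
  have hlin : ∀ i : Fin 6, 3 ≤ i → d i ⬝ᵥ y = 0 := fun i hi => by
    rw [← polyDeriv_linPoly (d i) p.rep y]
    refine hy _ fun x hx => ?_
    obtain ⟨c, s, r, rfl⟩ := key x hx
    rw [← RingHom.coe_coe, coe_aeval_eq_eval, eval_linPoly, dotProduct_smul, coord_conicVec h]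
    fin_cases i <;> simp at hi ⊢
  refine ⟨hlin 3 (by decide), hlin 4 (by decide), hlin 5 (by decide), ?_⟩
  -- For these vectors the quadric is (2x₁)² − 4x₀x₂, four times the equation of the conic.
  have hq := hy (quadricPoly ![d 0, (2 : K) • d 1, d 2, 0, 0, 0]) fun x hx => by
    obtain ⟨c, s, r, rfl⟩ := key x hx
    rw [← RingHom.coe_coe, coe_aeval_eq_eval, eval_quadricPoly]
    simp only [Matrix.cons_val, smul_dotProduct, dotProduct_smul, coord_conicVec h, smul_eq_mul]
    ring
  rw [polyDeriv_quadricPoly, hp] at hq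
  simp only [Matrix.cons_val, smul_dotProduct, dotProduct_smul, coord_conicVec h, smul_eq_mul] at hq
  refine (mul_eq_zero.1 ?_).resolve_left hc
  linear_combination (-4⁻¹ : K) * hq

end Conic

/-! ### The planes of the scroll -/

section Scroll

variable {K : Type*} [Field K] {e d : Fin 6 → Fin 6 → K}
  {T : (Fin 6 → K) →ₗ[K] (Fin 6 → K) →ₗ[K] (Fin 6 → K) →ₗ[K] K}

/-- Two vectors that span the tangent line to the conic at the point with parameters `s` and `r`,
and a third vector. -/
def planeBasis (e : Fin 6 → Fin 6 → K) (s r : K) (v : Fin 6 → K) : Fin 3 → Fin (5 + 1) → K :=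
  ![(2 * r) • e 0 - s • e 1, (2 * s) • e 2 - r • e 1, v]

/-- The plane joining a point with the tangent line to the conic at the point with parameters `s`
and `r`. -/
def scrollPlane (e : Fin 6 → Fin 6 → K) (s r : K) (v : Fin 6 → K) :
    Submodule K (Fin (5 + 1) → K) :=
  Submodule.span K (Set.range (planeBasis e s r v))

/-- The general planes of the scroll. -/
def scrollFamily (f : MvPolynomial (Fin 6) K) (e d : Fin 6 → Fin 6 → K) :
    Set (Submodule K (Fin (5 + 1) → K)) :=
  {M | ∃ (s r : K) (v : Fin 6 → K), s ≠ 0 ∧ d 4 ⬝ᵥ v ≠ 0 ∧ s * (d 5 ⬝ᵥ v) = r * (d 4 ⬝ᵥ v) ∧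
    eval v f = 0 ∧ scrollPlane e s r v = M}

theorem mem_scrollPlane_iff {s r : K} {v x : Fin 6 → K} : x ∈ scrollPlane e s r v ↔
    ∃ a b c : K, x = a • ((2 * r) • e 0 - s • e 1) + b • ((2 * s) • e 2 - r • e 1) + c • v := by
  rw [scrollPlane, Submodule.mem_span_range_iff_exists_fun]
  simp only [Fin.sum_univ_three, planeBasis, Matrix.cons_val]
  constructor
  · rintro ⟨c, rfl⟩
    exact ⟨c 0, c 1, c 2, rfl⟩
  · rintro ⟨a, b, c, rfl⟩
    exact ⟨![a, b, c], rfl⟩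

theorem coord_scrollPlane (h : IsNormalFrame T e d) (s r a b c : K) (v : Fin 6 → K) (j : Fin 6) :
    d j ⬝ᵥ (a • ((2 * r) • e 0 - s • e 1) + b • ((2 * s) • e 2 - r • e 1) + c • v) =
      (![2 * r * a, -(s * a + r * b), 2 * s * b, 0, 0, 0] : Fin 6 → K) j + c * (d j ⬝ᵥ v) := by
  simp only [dotProduct_add, dotProduct_sub, dotProduct_smul, h.dual, smul_eq_mul]
  fin_cases j <;> simp <;> ring

theorem linearIndependent_planeBasis [CharZero K] (h : IsNormalFrame T e d) {s r : K}
    (hs : s ≠ 0) {v : Fin 6 → K} (hv : d 4 ⬝ᵥ v ≠ 0) : LinearIndependent K (planeBasis e s r v) := by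
  rw [Fintype.linearIndependent_iff]
  intro c hc
  simp only [Fin.sum_univ_three, planeBasis, Matrix.cons_val] at hc
  have hj := fun j => (coord_scrollPlane h s r (c 0) (c 1) (c 2) v j).symm.trans
    ((congrArg (fun x => d j ⬝ᵥ x) hc).trans (dotProduct_zero _))
  have h2 : c 2 = 0 := by simpa [hv] using hj 4
  have h1 : c 1 = 0 := by simpa [h2, hs] using hj 2
  have h0 : c 0 = 0 := by simpa [h2, h1, hs] using hj 1
  intro i
  fin_cases i
  exacts [h0, h1, h2]

theorem finrank_scrollPlane [CharZero K] (h : IsNormalFrame T e d) {s r : K}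
    (hs : s ≠ 0) {v : Fin 6 → K} (hv : d 4 ⬝ᵥ v ≠ 0) :
    Module.finrank K (scrollPlane e s r v) = 3 := by
  rw [scrollPlane, finrank_span_eq_card (linearIndependent_planeBasis h hs hv), Fintype.card_fin]

theorem finrank_of_mem_scrollFamily [CharZero K] (h : IsNormalFrame T e d)
    {f : MvPolynomial (Fin 6) K} : ∀ M ∈ scrollFamily f e d, Module.finrank K M = 3 := by
  rintro _ ⟨s, r, v, hs, hv, -, -, rfl⟩
  exact finrank_scrollPlane h hs hv

theorem eval_eq_form [CharZero K] {f : MvPolynomial (Fin 6) K} (hf : f.IsHomogeneous 3)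
    (hT : IsNondegSymm (polarForm f)) (h : IsNormalFrame (polarForm f) e d) (x : Fin 6 → K) :
    eval x f = (d 0 ⬝ᵥ x) * (d 4 ⬝ᵥ x) ^ 2 + 2 * (d 1 ⬝ᵥ x) * (d 4 ⬝ᵥ x) * (d 5 ⬝ᵥ x) +
      (d 2 ⬝ᵥ x) * (d 5 ⬝ᵥ x) ^ 2 + eval (frameTail e d x) f := by
  have h1 := h.form_self hT x
  rw [polarForm_self_self hf, polarForm_self_self hf] at h1
  have h6 : (6 : K) ≠ 0 := by norm_num
  refine mul_left_cancel₀ h6 ?_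
  rw [h1]
  ring

theorem eval_smul_of_cubic [CharZero K] {f : MvPolynomial (Fin 6) K} (hf : f.IsHomogeneous 3)
    (c : K) (x : Fin 6 → K) : eval (c • x) f = c ^ 3 * eval x f := by
  have h6 : (6 : K) ≠ 0 := by norm_num
  refine mul_left_cancel₀ h6 ?_
  rw [← polarForm_self_self hf, mul_left_comm, ← polarForm_self_self hf]
  simp
  ring

section

variable [CharZero K] {f : MvPolynomial (Fin 6) K} (hf : f.IsHomogeneous 3)
  (hT : IsNondegSymm (polarForm f)) (h : IsNormalFrame (polarForm f) e d)
include hf hT h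

/-- When (x₄ : x₅) = (s : r), adding a vector of the tangent line at (s : r) does not change x₀x₄² +
2x₁x₄x₅ + x₂x₅², and the tail of f ignores x₀, x₁, x₂. -/
theorem eval_eq_zero_of_mem_scrollPlane {s r : K} {v x : Fin 6 → K}
    (hv : s * (d 5 ⬝ᵥ v) = r * (d 4 ⬝ᵥ v)) (h0 : eval v f = 0) (hx : x ∈ scrollPlane e s r v) :
    eval x f = 0 := by
  obtain ⟨a, b, c, rfl⟩ := mem_scrollPlane_iff.1 hx
  set x := a • ((2 * r) • e 0 - s • e 1) + b • ((2 * s) • e 2 - r • e 1) + c • v with hxdef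
  have hj : ∀ j, d j ⬝ᵥ x = _ := fun j => coord_scrollPlane h s r a b c v j
  have htail : frameTail e d x = c • frameTail e d v := by
    simp only [frameTail, hj, Matrix.cons_val, zero_add]
    module
  rw [eval_eq_form hf hT h] at h0
  rw [eval_eq_form hf hT h, htail, eval_smul_of_cubic hf]
  simp only [hj, Matrix.cons_val, zero_add]
  linear_combination c ^ 3 * h0 + 2 * c ^ 2 * (b * (d 5 ⬝ᵥ v) - a * (d 4 ⬝ᵥ v)) * hv

end

/-- The last component of `scrollVec`. -/
def scrollTail (e : Fin 6 → Fin 6 → K) (y : Fin 5 → K) : Fin 6 → K :=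
  y 4 • e 3 + y 0 • e 4 + y 1 • e 5

/-- A rational parametrization of the cubic, with denominators cleared. -/
noncomputable def scrollVec (f : MvPolynomial (Fin 6) K) (e : Fin 6 → Fin 6 → K) (y : Fin 5 → K) :
    Fin 6 → K :=
  (-(2 * (y 2 * y 0 * y 1) + y 3 * y 1 ^ 2 + eval (scrollTail e y) f)) • e 0 +
    y 0 ^ 2 • (y 2 • e 1 + y 3 • e 2 + scrollTail e y)

theorem coord_scrollVec (h : IsNormalFrame T e d) (f : MvPolynomial (Fin 6) K) (y : Fin 5 → K)
    (j : Fin 6) : d j ⬝ᵥ scrollVec f e y =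
      ![-(2 * (y 2 * y 0 * y 1) + y 3 * y 1 ^ 2 + eval (scrollTail e y) f), y 0 ^ 2 * y 2,
        y 0 ^ 2 * y 3, y 0 ^ 2 * y 4, y 0 ^ 2 * y 0, y 0 ^ 2 * y 1] j := by
  rw [scrollVec]
  generalize eval (scrollTail e y) f = E
  simp only [scrollTail, dotProduct_add, dotProduct_smul, h.dual, smul_eq_mul]
  fin_cases j <;> simp

/-- The coordinate along e₀ in `scrollVec` solves f = 0, an equation linear in x₀ with coefficient
x₄². -/
theorem eval_scrollVec [CharZero K] {f : MvPolynomial (Fin 6) K} (hf : f.IsHomogeneous 3)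
    (hT : IsNondegSymm (polarForm f)) (h : IsNormalFrame (polarForm f) e d) (y : Fin 5 → K) :
    eval (scrollVec f e y) f = 0 := by
  have htail : frameTail e d (scrollVec f e y) = y 0 ^ 2 • scrollTail e y := by
    simp only [frameTail, coord_scrollVec h, Matrix.cons_val, scrollTail]
    module
  rw [eval_eq_form hf hT h, htail, eval_smul_of_cubic hf]
  simp only [coord_scrollVec h, Matrix.cons_val]
  ring

/-- Converse to `eval_scrollVec`: points of X with x₄ ≠ 0 are recovered up to a scalar. The factor c
allows y₀, y₁ to be adjusted to prescribed s, r. -/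
theorem scrollVec_eq_smul [CharZero K] {f : MvPolynomial (Fin 6) K} (hf : f.IsHomogeneous 3)
    (hT : IsNondegSymm (polarForm f)) (h : IsNormalFrame (polarForm f) e d) {c : K}
    {v : Fin 6 → K} (h0 : eval v f = 0) :
    scrollVec f e ![c * (d 4 ⬝ᵥ v), c * (d 5 ⬝ᵥ v), c * (d 1 ⬝ᵥ v), c * (d 2 ⬝ᵥ v), c * (d 3 ⬝ᵥ v)] =
      ((c * (d 4 ⬝ᵥ v)) ^ 2 * c) • v := by
  refine h.ext_coord fun j => ?_
  have htail : scrollTail e ![c * (d 4 ⬝ᵥ v), c * (d 5 ⬝ᵥ v), c * (d 1 ⬝ᵥ v), c * (d 2 ⬝ᵥ v),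
      c * (d 3 ⬝ᵥ v)] = c • frameTail e d v := by
    simp only [frameTail, Matrix.cons_val, scrollTail]
    module
  rw [eval_eq_form hf hT h] at h0
  rw [coord_scrollVec h, htail, eval_smul_of_cubic hf, dotProduct_smul, smul_eq_mul]
  fin_cases j <;> simp
  · linear_combination (-c ^ 3) * h0
  all_goals ring

/-- The parametrization of the bases of the general planes of the scroll. -/
noncomputable def scrollParam (f : MvPolynomial (Fin 6) K) (e : Fin 6 → Fin 6 → K)
    (ij : Fin 3 × Fin (5 + 1)) : MvPolynomial ((Fin 3 × Fin 3) ⊕ Fin 5) K :=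
  ∑ l, X (.inl (ij.1, l)) *
    (![2 * X (.inr 1) * C (e 0 ij.2) - X (.inr 0) * C (e 1 ij.2),
      2 * X (.inr 0) * C (e 2 ij.2) - X (.inr 1) * C (e 1 ij.2),
      -(2 * (X (.inr 2) * X (.inr 0) * X (.inr 1)) + X (.inr 3) * X (.inr 1) ^ 2 +
        aeval (fun i => X (.inr 4) * C (e 3 i) + X (.inr 0) * C (e 4 i) + X (.inr 1) * C (e 5 i) :
          Fin 6 → MvPolynomial ((Fin 3 × Fin 3) ⊕ Fin 5) K) f) * C (e 0 ij.2) +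
      X (.inr 0) ^ 2 * (X (.inr 2) * C (e 1 ij.2) + X (.inr 3) * C (e 2 ij.2) +
        (X (.inr 4) * C (e 3 ij.2) + X (.inr 0) * C (e 4 ij.2) + X (.inr 1) * C (e 5 ij.2)))] :
      Fin 3 → MvPolynomial ((Fin 3 × Fin 3) ⊕ Fin 5) K) l

theorem eval_scrollParam (f : MvPolynomial (Fin 6) K) (t : (Fin 3 × Fin 3) ⊕ Fin 5 → K)
    (ij : Fin 3 × Fin (5 + 1)) : eval t (scrollParam f e ij) = ∑ l, t (.inl (ij.1, l)) *
      planeBasis e (t (.inr 0)) (t (.inr 1)) (scrollVec f e fun i => t (.inr i)) l ij.2 := by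
  rw [scrollParam, map_sum]
  refine Finset.sum_congr rfl fun l _ => ?_
  rw [map_mul, eval_X]
  congr 1
  have htail : eval t (aeval (fun i => X (.inr 4) * C (e 3 i) + X (.inr 0) * C (e 4 i) +
      X (.inr 1) * C (e 5 i) : Fin 6 → MvPolynomial ((Fin 3 × Fin 3) ⊕ Fin 5) K) f) =
      eval (scrollTail e fun i => t (.inr i)) f := by
    rw [← aeval_eval, ← RingHom.coe_coe (aeval _), coe_aeval_eq_eval]
    congr 2
    funext i
    simp [scrollTail]
  fin_cases l
  · simp [planeBasis]
  · simp [planeBasis]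
  · simp only [Fin.reduceFinMk, Matrix.cons_val, planeBasis, map_add, map_mul, map_neg, htail,
      scrollVec, Pi.add_apply, Pi.smul_apply, smul_eq_mul, eval_X, eval_C, map_pow, map_ofNat,
      scrollTail]

theorem vanishingIdeal_frames_scrollFamily [CharZero K] {f : MvPolynomial (Fin 6) K}
    (hf : f.IsHomogeneous 3) (hT : IsNondegSymm (polarForm f))
    (h : IsNormalFrame (polarForm f) e d) :
    vanishingIdeal K (frames 3 (scrollFamily f e d)) = RingHom.ker (aeval (scrollParam f e) :
      MvPolynomial (Fin 3 × Fin (5 + 1)) K →ₐ[K] MvPolynomial ((Fin 3 × Fin 3) ⊕ Fin 5) K) := by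
  refine vanishingIdeal_eq_ker (scrollParam f e)
    (Matrix.det (Matrix.of fun i j => X (.inl (i, j))) * X (.inr 0))
    (b := Sum.elim (fun ij => if ij.1 = ij.2 then 1 else 0) 1) ?_ (fun t ht => ?_) fun a ha => ?_
  · rw [map_mul, eval_X, eval_det_X _ (Sum.inl : Fin 3 × Fin 3 → (Fin 3 × Fin 3) ⊕ Fin 5)]
    have : (Matrix.of fun i j => Sum.elim (fun ij : Fin 3 × Fin 3 =>
        if ij.1 = ij.2 then (1 : K) else 0) (1 : Fin 5 → K) (Sum.inl (i, j))) = 1 := by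
      ext i j
      simp [Matrix.one_apply]
    rw [this]
    simp
  · rw [map_mul, eval_X, eval_det_X _ (Sum.inl : Fin 3 × Fin 3 → (Fin 3 × Fin 3) ⊕ Fin 5)] at ht
    obtain ⟨hdet, hs⟩ := mul_ne_zero_iff.1 ht
    have h4 : d 4 ⬝ᵥ scrollVec f e (fun i => t (.inr i)) ≠ 0 := by
      rw [coord_scrollVec h]
      simpa using hs
    have hmem : scrollPlane e (t (.inr 0)) (t (.inr 1)) (scrollVec f e fun i => t (.inr i)) ∈
        scrollFamily f e d := by
      refine ⟨_, _, _, hs, h4, ?_, eval_scrollVec hf hT h _, rfl⟩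
      rw [coord_scrollVec h, coord_scrollVec h]
      simp only [Matrix.cons_val]
      ring
    have := sum_smul_mem_frames (finrank_scrollPlane h (r := t (.inr 1)) hs h4)
      (linearIndependent_planeBasis h hs h4)
      (fun l => Submodule.subset_span ⟨l, rfl⟩) hdet
    simp only [eval_scrollParam]
    exact frames_mono (Set.singleton_subset_iff.2 hmem) this
  · obtain ⟨s, r, v, hs, hv, hsv, h0, hM⟩ := ha.2
    -- Since (x₄ : x₅) = (s : r) at v, a single factor matches both parameters.
    obtain ⟨c, hcs⟩ : ∃ c, c * (d 4 ⬝ᵥ v) = s := ⟨s / (d 4 ⬝ᵥ v), div_mul_cancel₀ _ hv⟩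
    have hcr : c * (d 5 ⬝ᵥ v) = r := by
      refine mul_right_cancel₀ hv ?_
      rw [← hsv, ← hcs]
      ring
    have hc : c ≠ 0 := by
      rintro rfl
      exact hs (by rw [← hcs, zero_mul])
    have hvec := scrollVec_eq_smul hf hT h (c := c) h0
    rw [hcs, hcr] at hvec
    have h4 : d 4 ⬝ᵥ ((s ^ 2 * c) • v) ≠ 0 := by
      rw [dotProduct_smul, smul_eq_mul]
      exact mul_ne_zero (mul_ne_zero (pow_ne_zero 2 hs) hc) hv
    have hbasis : ∀ l, planeBasis e s r ((s ^ 2 * c) • v) l ∈ scrollPlane e s r v := fun l => by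
      rw [mem_scrollPlane_iff]
      fin_cases l
      · exact ⟨1, 0, 0, by simp [planeBasis]⟩
      · exact ⟨0, 1, 0, by simp [planeBasis]⟩
      · exact ⟨0, 0, s ^ 2 * c, by simp [planeBasis]⟩
    obtain ⟨G, hG⟩ := exists_matrix_of_mem_frames (finrank_scrollPlane h hs hv)
      (linearIndependent_planeBasis h hs h4) hbasis (a := a) ⟨ha.1, hM.symm⟩
    refine ⟨Sum.elim (fun ij => G ij.1 ij.2)
      ![s, r, c * (d 1 ⬝ᵥ v), c * (d 2 ⬝ᵥ v), c * (d 3 ⬝ᵥ v)], ?_⟩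
    funext ⟨i, j⟩
    rw [eval_scrollParam, ← hG, ← hvec]
    rfl

end Scroll

/-! ### The closure of the family of planes -/

section ScrollClosure

variable {K : Type*} [Field K] {e d : Fin 6 → Fin 6 → K}
  {T : (Fin 6 → K) →ₗ[K] (Fin 6 → K) →ₗ[K] (Fin 6 → K) →ₗ[K] K}
  {f : MvPolynomial (Fin 6) K} {L : Submodule K (Fin (5 + 1) → K)}

/-- On a plane of the family the coordinates of index at least 3 come only from the multiple of v,
so they are proportional; this vanishing of minors persists in the closure. -/
theorem coord_mul_comm_of_mem_grassClosure
    (h : IsNormalFrame T e d) (hL : L ∈ grassClosure 3 (scrollFamily f e d)) {m n : Fin 6}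
    (hm : 3 ≤ m) (hn : 3 ≤ n) {x y : Fin 6 → K} (hx : x ∈ L) (hy : y ∈ L) :
    (d m ⬝ᵥ x) * (d n ⬝ᵥ y) = (d n ⬝ᵥ x) * (d m ⬝ᵥ y) := by
  have hdot : ∀ (j : Fin 6) (k : Fin 2), IsPolyFun fun a : Fin 2 × Fin (5 + 1) → K =>
    d j ⬝ᵥ fun i => a (k, i) := fun j k => isPolyFun_dot (d j) fun i => isPolyFun_coord _
  refine sub_eq_zero.1 (eq_zero_of_mem_grassClosure hL (x := ![x, y])
    (((hdot m 0).mul (hdot n 1)).sub ((hdot n 0).mul (hdot m 1))) ?_ (Fin.forall_fin_two.2 ⟨hx, hy⟩))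
  rintro _ ⟨s, r, v, -, -, -, -, rfl⟩ x hx
  obtain ⟨a, b, c, h0⟩ := mem_scrollPlane_iff.1 (hx 0)
  obtain ⟨a', b', c', h1⟩ := mem_scrollPlane_iff.1 (hx 1)
  have hj : ∀ j : Fin 6, 3 ≤ j → d j ⬝ᵥ x 0 = c * (d j ⬝ᵥ v) ∧ d j ⬝ᵥ x 1 = c' * (d j ⬝ᵥ v) :=
    fun j hj => by
      rw [h0, h1, coord_scrollPlane h, coord_scrollPlane h]
      fin_cases j <;> simp at hj ⊢
  change (d m ⬝ᵥ x 0) * (d n ⬝ᵥ x 1) - (d n ⬝ᵥ x 0) * (d m ⬝ᵥ x 1) = 0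
  rw [(hj m hm).1, (hj m hm).2, (hj n hn).1, (hj n hn).2]
  ring

/-- The normal vector, in the first three coordinates, of two vectors. -/
def planeNormal (d : Fin 6 → Fin 6 → K) (x y : Fin 6 → K) : Fin 3 → K :=
  ![(d 1 ⬝ᵥ x) * (d 2 ⬝ᵥ y) - (d 2 ⬝ᵥ x) * (d 1 ⬝ᵥ y),
    (d 2 ⬝ᵥ x) * (d 0 ⬝ᵥ y) - (d 0 ⬝ᵥ x) * (d 2 ⬝ᵥ y),
    (d 0 ⬝ᵥ x) * (d 1 ⬝ᵥ y) - (d 1 ⬝ᵥ x) * (d 0 ⬝ᵥ y)]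

theorem planeNormal_smul (c : K) (x y : Fin 6 → K) :
    planeNormal d (c • x) (c • y) = (c * c) • planeNormal d x y := by
  funext i
  simp only [planeNormal, dotProduct_smul, smul_eq_mul, Pi.smul_apply]
  fin_cases i <;> simp <;> ring

/-- The corrections by w cancel the multiples of v and leave vectors of the tangent line. The cross
product of its two spanning vectors is −2(s², 2sr, r²). -/
theorem exists_planeNormal_eq
    (h : IsNormalFrame T e d) {s r : K} {v x y w : Fin 6 → K} {m : Fin 6} (hm : 3 ≤ m)
    (hx : x ∈ scrollPlane e s r v) (hy : y ∈ scrollPlane e s r v) (hw : w ∈ scrollPlane e s r v) :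
    ∃ k : K, planeNormal d ((d m ⬝ᵥ w) • x - (d m ⬝ᵥ x) • w) ((d m ⬝ᵥ w) • y - (d m ⬝ᵥ y) • w) =
      k • ![s * s, 2 * (s * r), r * r] := by
  have key : ∀ {x}, x ∈ scrollPlane e s r v → ∃ a b : K, ∀ j : Fin 6,
      d j ⬝ᵥ ((d m ⬝ᵥ w) • x - (d m ⬝ᵥ x) • w) =
      (![2 * r * a, -(s * a + r * b), 2 * s * b, 0, 0, 0] : Fin 6 → K) j := by
    intro x hx
    obtain ⟨a, b, c, rfl⟩ := mem_scrollPlane_iff.1 hx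
    obtain ⟨a', b', c', rfl⟩ := mem_scrollPlane_iff.1 hw
    have hdm : ∀ a b c : K, d m ⬝ᵥ (a • ((2 * r) • e 0 - s • e 1) + b • ((2 * s) • e 2 - r • e 1) +
        c • v) = c * (d m ⬝ᵥ v) := fun a b c => by
      rw [coord_scrollPlane h]
      fin_cases m <;> simp at hm ⊢
    refine ⟨(c' * a - c * a') * (d m ⬝ᵥ v), (c' * b - c * b') * (d m ⬝ᵥ v), fun j => ?_⟩
    rw [dotProduct_sub, dotProduct_smul, dotProduct_smul, hdm, hdm, coord_scrollPlane h,
      coord_scrollPlane h, smul_eq_mul, smul_eq_mul]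
    fin_cases j <;> simp <;> ring
  obtain ⟨a, b, h0⟩ := key hx
  obtain ⟨a', b', h1⟩ := key hy
  refine ⟨2 * (a' * b - a * b'), funext fun i => ?_⟩
  simp only [planeNormal, h0, h1, Pi.smul_apply, smul_eq_mul]
  fin_cases i <;> simp <;> ring

/-- On the original planes the normal is a multiple of (s², 2sr, r²) and (x₄ : x₅) = (s : r); these
relations pass to the closure once stated for arbitrary vectors of the plane. This is the role of w,
which corrects x and y to have coordinate m zero, at the cost of a factor cancelled at the end. -/
theorem planeNormal_relations [CharZero K]
    (h : IsNormalFrame T e d) (hL : L ∈ grassClosure 3 (scrollFamily f e d)) {m : Fin 6}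
    (hm : 3 ≤ m) {x y w v : Fin 6 → K} (hx : x ∈ L) (hy : y ∈ L) (hw : w ∈ L) (hv : v ∈ L)
    (hmw : d m ⬝ᵥ w ≠ 0) (hmx : d m ⬝ᵥ x = 0) (hmy : d m ⬝ᵥ y = 0) :
    planeNormal d x y 1 ^ 2 - 4 * (planeNormal d x y 2 * planeNormal d x y 0) = 0 ∧
    2 * planeNormal d x y 0 * (d 5 ⬝ᵥ v) - planeNormal d x y 1 * (d 4 ⬝ᵥ v) = 0 ∧
    planeNormal d x y 1 * (d 5 ⬝ᵥ v) - 2 * planeNormal d x y 2 * (d 4 ⬝ᵥ v) = 0 := by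
  have hmem : ∀ k, (![x, y, w, v] : Fin 4 → _) k ∈ L := by
    intro k
    fin_cases k
    exacts [hx, hy, hw, hv]
  let g : (Fin 4 → Fin 6 → K) → Fin 3 → K := fun z => planeNormal d
    ((d m ⬝ᵥ z 2) • z 0 - (d m ⬝ᵥ z 0) • z 2) ((d m ⬝ᵥ z 2) • z 1 - (d m ⬝ᵥ z 1) • z 2)
  have hdot : ∀ (j : Fin 6) (k : Fin 4), IsPolyFun fun a : Fin 4 × Fin (5 + 1) → K =>
    d j ⬝ᵥ fun i => a (k, i) := fun j k => isPolyFun_dot (d j) fun i => isPolyFun_coord _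
  have hg : ∀ i, IsPolyFun fun a : Fin 4 × Fin (5 + 1) → K => g (fun k i => a (k, i)) i := by
    have hd : ∀ (j : Fin 6) (k : Fin 4), IsPolyFun fun a : Fin 4 × Fin (5 + 1) → K =>
        d j ⬝ᵥ ((d m ⬝ᵥ fun i => a (2, i)) • (fun i => a (k, i)) -
          (d m ⬝ᵥ fun i => a (k, i)) • fun i => a (2, i)) := fun j k =>
      isPolyFun_dot _ fun i => ((hdot m 2).mul (isPolyFun_coord _)).sub
        ((hdot m k).mul (isPolyFun_coord _))
    intro i
    fin_cases i
    · exact ((hd 1 0).mul (hd 2 1)).sub ((hd 2 0).mul (hd 1 1))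
    · exact ((hd 2 0).mul (hd 0 1)).sub ((hd 0 0).mul (hd 2 1))
    · exact ((hd 0 0).mul (hd 1 1)).sub ((hd 1 0).mul (hd 0 1))
  have h0 : ∀ M ∈ scrollFamily f e d, ∀ z : Fin 4 → Fin 6 → K, (∀ i, z i ∈ M) →
      ∃ k s r c : K, g z = k • ![s * s, 2 * (s * r), r * r] ∧
        d 4 ⬝ᵥ z 3 = c * s ∧ d 5 ⬝ᵥ z 3 = c * r := by
    rintro _ ⟨s, r, v, hs, hv, hsv, -, rfl⟩ z hz
    obtain ⟨k, hk⟩ := exists_planeNormal_eq h hm (hz 0) (hz 1) (hz 2)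
    obtain ⟨a, b, c, hc⟩ := mem_scrollPlane_iff.1 (hz 3)
    refine ⟨k, s, r, c * (d 4 ⬝ᵥ v) / s, hk, ?_, ?_⟩
    · rw [hc, coord_scrollPlane h]
      field_simp
      simp
    · rw [hc, coord_scrollPlane h]
      field_simp
      simp only [Matrix.cons_val]
      linear_combination c * hsv
  have hgx : g ![x, y, w, v] = ((d m ⬝ᵥ w) * (d m ⬝ᵥ w)) • planeNormal d x y := by
    simp only [g, Matrix.cons_val, hmx, hmy, zero_smul, sub_zero, planeNormal_smul]
  have hne : (d m ⬝ᵥ w) * (d m ⬝ᵥ w) ≠ 0 := mul_ne_zero hmw hmw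
  have r1 := eq_zero_of_mem_grassClosure hL
    (((hg 1).pow 2).sub ((isPolyFun_const 4).mul ((hg 2).mul (hg 0)))) (fun M hM z hz => by
      obtain ⟨k, s, r, c, hk, -, -⟩ := h0 M hM z hz
      change g z 1 ^ 2 - 4 * (g z 2 * g z 0) = 0
      rw [hk]
      simp
      ring) hmem
  have r2 := eq_zero_of_mem_grassClosure hL
    ((((isPolyFun_const 2).mul (hg 0)).mul (hdot 5 3)).sub ((hg 1).mul (hdot 4 3)))
    (fun M hM z hz => by
      obtain ⟨k, s, r, c, hk, h4, h5⟩ := h0 M hM z hz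
      change 2 * g z 0 * (d 5 ⬝ᵥ z 3) - g z 1 * (d 4 ⬝ᵥ z 3) = 0
      rw [hk, h4, h5]
      simp
      ring) hmem
  have r3 := eq_zero_of_mem_grassClosure hL
    (((hg 1).mul (hdot 5 3)).sub (((isPolyFun_const 2).mul (hg 2)).mul (hdot 4 3)))
    (fun M hM z hz => by
      obtain ⟨k, s, r, c, hk, h4, h5⟩ := h0 M hM z hz
      change g z 1 * (d 5 ⬝ᵥ z 3) - 2 * g z 2 * (d 4 ⬝ᵥ z 3) = 0
      rw [hk, h4, h5]
      simp
      ring) hmem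
  change g ![x, y, w, v] 1 ^ 2 - 4 * (g ![x, y, w, v] 2 * g ![x, y, w, v] 0) = 0 at r1
  change 2 * g ![x, y, w, v] 0 * (d 5 ⬝ᵥ v) - g ![x, y, w, v] 1 * (d 4 ⬝ᵥ v) = 0 at r2
  change g ![x, y, w, v] 1 * (d 5 ⬝ᵥ v) - 2 * g ![x, y, w, v] 2 * (d 4 ⬝ᵥ v) = 0 at r3
  rw [hgx] at r1 r2 r3
  simp only [Pi.smul_apply, smul_eq_mul] at r1 r2 r3
  refine ⟨(mul_eq_zero.1 ?_).resolve_left (mul_ne_zero hne hne),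
    (mul_eq_zero.1 ?_).resolve_left hne, (mul_eq_zero.1 ?_).resolve_left hne⟩
  · linear_combination r1
  · linear_combination r2
  · linear_combination r3

/-- The vectors on the tangent line to the conic at the point with parameters `s` and `r`. -/
theorem mem_span_tangent [CharZero K]
    (h : IsNormalFrame T e d) {s r : K} (hsr : ¬ (s = 0 ∧ r = 0)) {z : Fin 6 → K}
    (h3 : d 3 ⬝ᵥ z = 0) (h4 : d 4 ⬝ᵥ z = 0) (h5 : d 5 ⬝ᵥ z = 0)
    (hz : s * s * (d 0 ⬝ᵥ z) + 2 * (s * r) * (d 1 ⬝ᵥ z) + r * r * (d 2 ⬝ᵥ z) = 0) :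
    ∃ a b : K, z = a • ((2 * r) • e 0 - s • e 1) + b • ((2 * s) • e 2 - r • e 1) := by
  have key : ∀ a b : K, 2 * r * a = d 0 ⬝ᵥ z → -(s * a + r * b) = d 1 ⬝ᵥ z →
      2 * s * b = d 2 ⬝ᵥ z →
      z = a • ((2 * r) • e 0 - s • e 1) + b • ((2 * s) • e 2 - r • e 1) := fun a b h0 h1 h2 => by
    refine h.ext_coord fun j => ?_
    have := coord_scrollPlane h s r a b 0 0 j
    rw [smul_zero, add_zero, zero_mul, add_zero] at this
    rw [this]
    fin_cases j
    exacts [h0.symm, h1.symm, h2.symm, h3, h4, h5]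
  by_cases hs : s = 0
  · have hr : r ≠ 0 := fun hr => hsr ⟨hs, hr⟩
    subst hs
    have h2 : d 2 ⬝ᵥ z = 0 := by simpa [hr] using hz
    refine ⟨(d 0 ⬝ᵥ z) / (2 * r), -(d 1 ⬝ᵥ z) / r, key _ _ (by field_simp) (by field_simp; ring)
      (by simp [h2])⟩
  · refine ⟨(-(d 1 ⬝ᵥ z) - r * ((d 2 ⬝ᵥ z) / (2 * s))) / s, (d 2 ⬝ᵥ z) / (2 * s),
      key _ _ ?_ (by field_simp; ring) (by field_simp)⟩
    field_simp
    linear_combination -hz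

/-- A plane of the closure that is not contained in the plane of the conic contains a tangent line
to the conic. -/
theorem exists_tangent_le [CharZero K] [IsAlgClosed K]
    (h : IsNormalFrame T e d) (hL : L ∈ grassClosure 3 (scrollFamily f e d)) {m : Fin 6}
    (hm : 3 ≤ m) {w : Fin 6 → K} (hw : w ∈ L) (hmw : d m ⬝ᵥ w ≠ 0) :
    ∃ s r : K, ¬ (s = 0 ∧ r = 0) ∧ (∀ v ∈ L, s * (d 5 ⬝ᵥ v) = r * (d 4 ⬝ᵥ v)) ∧
      ∀ z : Fin 6 → K, d 3 ⬝ᵥ z = 0 → d 4 ⬝ᵥ z = 0 → d 5 ⬝ᵥ z = 0 →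
        s * s * (d 0 ⬝ᵥ z) + 2 * (s * r) * (d 1 ⬝ᵥ z) + r * r * (d 2 ⬝ᵥ z) = 0 → z ∈ L := by
  -- The zero locus of coordinate m in L is two-dimensional; it will turn out to be the tangent
  -- line.
  have hL0 : Module.finrank K (L ⊓ dotKer (d m) : Submodule K (Fin (5 + 1) → K)) = 2 := by
    have hne : (dotProductBilin K K (d m)).comp L.subtype ≠ 0 := fun h0 =>
      hmw (LinearMap.congr_fun h0 ⟨w, hw⟩)
    have h1 := Module.Dual.finrank_ker_add_one_of_ne_zero hne
    rw [hL.1] at h1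
    have h2 : (LinearMap.ker ((dotProductBilin K K (d m)).comp L.subtype)).map L.subtype =
        L ⊓ dotKer (d m) := by
      rw [LinearMap.ker_comp, Submodule.map_comap_subtype]
      rfl
    rw [← h2, Submodule.finrank_map_subtype_eq]
    exact Nat.add_right_cancel h1
  obtain ⟨a, hli, ha⟩ := frames_nonempty hL0
  have hmem : ∀ i : Fin 2, (fun j => a (i, j)) ∈ L ⊓ dotKer (d m) := fun i => by
    rw [← show Submodule.span K _ = L ⊓ dotKer (d m) from ha]
    exact Submodule.subset_span ⟨i, rfl⟩
  obtain ⟨x, hxdef⟩ : ∃ x : Fin 2 → Fin (5 + 1) → K, x = fun i j => a (i, j) := ⟨_, rfl⟩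
  rw [← hxdef] at hli
  have hxL : ∀ i, x i ∈ L := fun i => hxdef ▸ (hmem i).1
  have hxm : ∀ i, d m ⬝ᵥ x i = 0 := fun i => hxdef ▸ (hmem i).2
  -- The coordinates of index at least 3 are proportional to those of w, so they vanish together
  -- with coordinate m.
  have hx : ∀ i, ∀ n : Fin 6, 3 ≤ n → d n ⬝ᵥ x i = 0 := fun i n hn => by
    have := coord_mul_comm_of_mem_grassClosure h hL hm hn (hxL i) hw
    rw [hxm, zero_mul] at this
    exact (mul_eq_zero.1 this.symm).resolve_right hmw
  have hN : planeNormal d (x 0) (x 1) ≠ 0 := fun hN => by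
    have h0 : (d 1 ⬝ᵥ x 0) * (d 2 ⬝ᵥ x 1) - (d 2 ⬝ᵥ x 0) * (d 1 ⬝ᵥ x 1) = 0 := congrFun hN 0
    have h1 : (d 2 ⬝ᵥ x 0) * (d 0 ⬝ᵥ x 1) - (d 0 ⬝ᵥ x 0) * (d 2 ⬝ᵥ x 1) = 0 := congrFun hN 1
    have h2 : (d 0 ⬝ᵥ x 0) * (d 1 ⬝ᵥ x 1) - (d 1 ⬝ᵥ x 0) * (d 0 ⬝ᵥ x 1) = 0 := congrFun hN 2
    have hz : ∀ i, d i ⬝ᵥ x 0 = 0 := fun i => by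
      have hcomb : (d i ⬝ᵥ x 1) • x 0 + (-(d i ⬝ᵥ x 0)) • x 1 = 0 := h.ext_coord fun j => by
        rw [dotProduct_add, dotProduct_smul, dotProduct_smul, dotProduct_zero, smul_eq_mul,
          smul_eq_mul]
        by_cases hi : 3 ≤ i
        · rw [hx 0 i hi, hx 1 i hi]
          ring
        by_cases hj : 3 ≤ j
        · rw [hx 0 j hj, hx 1 j hj]
          ring
        fin_cases i <;> fin_cases j <;> simp at hi hj ⊢ <;> first
          | linear_combination h0
          | linear_combination h1
          | linear_combination h2
          | linear_combination -h0
          | linear_combination -h1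
          | linear_combination -h2
          | ring
      have := Fintype.linearIndependent_iff.1 hli ![d i ⬝ᵥ x 1, -(d i ⬝ᵥ x 0)]
        (by rw [Fin.sum_univ_two]; exact hcomb) 1
      simpa using this
    exact hli.ne_zero 0 (h.ext_coord fun j => by rw [hz, dotProduct_zero])
  -- Here s² and r² are the last and first components of the normal, so the parameters of the
  -- tangent line are (r, s), in this order.
  obtain ⟨s, r, hr2, hr1, hr0⟩ := exists_conic_param
    (planeNormal_relations h hL hm (hxL 0) (hxL 1) hw hw hmw (hxm 0) (hxm 1)).1
  have hsr : ¬ (r = 0 ∧ s = 0) := by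
    rintro ⟨rfl, rfl⟩
    refine hN (funext fun i => ?_)
    fin_cases i
    · simpa using hr0
    · simpa using hr1
    · simpa using hr2
  refine ⟨r, s, hsr, fun v hv => ?_, fun z h3 h4 h5 hz => ?_⟩
  · obtain ⟨-, c1, c2⟩ := planeNormal_relations h hL hm (hxL 0) (hxL 1) hw hv hmw (hxm 0) (hxm 1)
    rw [hr0, hr1] at c1
    rw [hr1, hr2] at c2
    have e1 : r * (r * (d 5 ⬝ᵥ v) - s * (d 4 ⬝ᵥ v)) = 0 := by linear_combination 2⁻¹ * c1
    have e2 : s * (r * (d 5 ⬝ᵥ v) - s * (d 4 ⬝ᵥ v)) = 0 := by linear_combination 2⁻¹ * c2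
    by_contra hne
    rw [← sub_eq_zero] at hne
    exact hsr ⟨(mul_eq_zero.1 e1).resolve_right hne, (mul_eq_zero.1 e2).resolve_right hne⟩
  · have hle : L ⊓ dotKer (d m) ≤ Submodule.span K
        (Set.range ![(2 * s) • e 0 - r • e 1, (2 * r) • e 2 - s • e 1]) := by
      rw [← show Submodule.span K _ = L ⊓ dotKer (d m) from ha, ← hxdef, Submodule.span_le]
      rintro _ ⟨i, rfl⟩
      obtain ⟨α, β, hαβ⟩ := mem_span_tangent h hsr (hx i 3 (by decide)) (hx i 4 (by decide))
        (hx i 5 (by decide)) (by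
          rw [← hr0, ← hr2, show 2 * (r * s) = planeNormal d (x 0) (x 1) 1 by rw [hr1]; ring]
          simp only [planeNormal, Matrix.cons_val]
          fin_cases i <;> simp <;> ring)
      rw [SetLike.mem_coe, hαβ, Submodule.mem_span_range_iff_exists_fun]
      exact ⟨![α, β], by simp [Fin.sum_univ_two]⟩
    have heq := Submodule.eq_of_le_of_finrank_le hle (by
      rw [hL0]
      exact (finrank_range_le_card _).trans (by simp))
    obtain ⟨α, β, hαβ⟩ := mem_span_tangent h hsr h3 h4 h5 hz
    have : z ∈ L ⊓ dotKer (d m) := by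
      rw [heq, hαβ, Submodule.mem_span_range_iff_exists_fun]
      exact ⟨![α, β], by simp [Fin.sum_univ_two]⟩
    exact this.1

variable [CharZero K] [IsAlgClosed K] (hf : f.IsHomogeneous 3) (hT : IsNondegSymm (polarForm f))
  (h : IsNormalFrame (polarForm f) e d)
include hf hT h

/-- Uniqueness has to be checked among all limits of planes. By `exists_tangent_le` a member through
a point with x₄ ≠ 0 contains the tangent line with parameters (x₄ : x₅), hence is the plane joining
it to the point. -/
theorem isScrollStructure_scrollFamily :
    IsScrollStructure 3 (hypersurface (N := 5) f) (grassClosure 3 (scrollFamily f e d)) := by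
  have hrank := finrank_of_mem_scrollFamily h (f := f)
  refine ⟨⟨fun L hL => hL.1, ?_⟩, grassClosure_grassClosure hrank, fun L hL p hp => ?_,
    1, linPoly (d 4), isHomogeneous_linPoly _, ?_, fun p hpX hp => ?_⟩
  · rw [vanishingIdeal_frames_grassClosure hrank, vanishingIdeal_frames_scrollFamily hf hT h]
    exact isPrime_ker_aeval _
  · rw [mem_linearSpace] at hp
    refine eq_zero_of_mem_grassClosure hL (m := 1)
      ((isPolyFun_eval f).comp fun i => isPolyFun_coord (0, i)) ?_ (x := fun _ => p.rep) fun _ => hp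
    rintro _ ⟨s, r, v, -, -, hv, h0, rfl⟩ x hx
    exact eval_eq_zero_of_mem_scrollPlane hf hT h hv h0 (hx 0)
  · have hvec := coord_scrollVec h f ![1, 0, 0, 0, 0] 4
    have hne : scrollVec f e ![1, 0, 0, 0, 0] ≠ 0 := fun h0 => by
      rw [h0] at hvec
      simp at hvec
    obtain ⟨c, hc, hrep⟩ := exists_rep_mk (N := 5) _ hne
    refine ⟨Projectivization.mk K _ hne, ?_, ?_⟩
    · change eval _ f = 0
      rw [hrep, eval_smul_of_cubic hf, eval_scrollVec hf hT h, mul_zero]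
    · rw [eval_linPoly, hrep, dotProduct_smul, hvec]
      simpa using hc
  · rw [eval_linPoly] at hp
    have hpF : scrollPlane e (d 4 ⬝ᵥ p.rep) (d 5 ⬝ᵥ p.rep) p.rep ∈ scrollFamily f e d :=
      ⟨_, _, _, hp, hp, mul_comm _ _, hpX, rfl⟩
    refine ⟨_, ⟨subset_grassClosure hrank hpF, ?_⟩, ?_⟩
    · rw [mem_linearSpace]
      exact Submodule.subset_span ⟨2, rfl⟩
    · rintro L ⟨hL, hpL⟩
      rw [mem_linearSpace] at hpL
      obtain ⟨s, r, -, hv, hz⟩ := exists_tangent_le h hL (m := 4) (by decide) hpL hp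
      have hpv := hv _ hpL
      refine (Submodule.eq_of_le_of_finrank_le ?_ ?_).symm
      · intro x hx
        obtain ⟨a, b, c, rfl⟩ := mem_scrollPlane_iff.1 hx
        refine Submodule.add_mem _ (hz _ ?_ ?_ ?_ ?_) (Submodule.smul_mem _ _ hpL)
        all_goals
          simp only [dotProduct_add, dotProduct_sub, dotProduct_smul, h.dual, smul_eq_mul]
          simp
        linear_combination (2 * s * a - 2 * r * b) * hpv
      · rw [hL.1, finrank_scrollPlane h hp hp]

/-- Members not inside the plane of the conic are settled by `exists_tangent_le`; a member inside it
equals it, and so contains every tangent line. -/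
theorem isScrollInPlanesTangentTo_polarImageDual :
    IsScrollInPlanesTangentTo (hypersurface (N := 5) f) (polarImageDual f) := by
  refine ⟨_, isScrollStructure_scrollFamily hf hT h, fun L hL => ?_⟩
  have key : ∀ s r : K, ¬ (s = 0 ∧ r = 0) → (∀ z : Fin 6 → K, d 3 ⬝ᵥ z = 0 → d 4 ⬝ᵥ z = 0 →
      d 5 ⬝ᵥ z = 0 → s * s * (d 0 ⬝ᵥ z) + 2 * (s * r) * (d 1 ⬝ᵥ z) + r * r * (d 2 ⬝ᵥ z) = 0 →
      z ∈ L) → ∃ q ∈ polarImageDual (N := 5) f, tangentSpace (polarImageDual (N := 5) f) q ≤ L := by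
    intro s r hsr hz
    obtain ⟨c, hc, hrep⟩ := exists_rep_mk (N := 5) _ (h.conicVec_ne_zero hsr)
    obtain ⟨b, hb⟩ := IsAlgClosed.exists_pow_nat_eq c (n := 2) (by norm_num)
    refine ⟨_, (mem_polarImageDual hf hT h).2 ⟨b * s, b * r, by
      rw [hrep, conicVec_smul, ← hb, pow_two]⟩, fun y hy => ?_⟩
    obtain ⟨h3, h4, h5, h0⟩ := tangentSpace_polarImageDual hf hT h hc hrep hy
    exact hz y h3 h4 h5 h0
  by_cases hex : ∃ m : Fin 6, 3 ≤ m ∧ ∃ w ∈ L, d m ⬝ᵥ w ≠ 0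
  · obtain ⟨m, hm, w, hw, hmw⟩ := hex
    obtain ⟨s, r, hsr, -, hz⟩ := exists_tangent_le h hL hm hw hmw
    exact key s r hsr hz
  · push Not at hex
    refine key 1 0 (by simp) fun z h3 h4 h5 _ => ?_
    have hspan : ∀ x : Fin 6 → K, (∀ m : Fin 6, 3 ≤ m → d m ⬝ᵥ x = 0) →
        x ∈ Submodule.span K (Set.range ![e 0, e 1, e 2]) := fun x hx => by
      rw [Submodule.mem_span_range_iff_exists_fun]
      refine ⟨![d 0 ⬝ᵥ x, d 1 ⬝ᵥ x, d 2 ⬝ᵥ x], ?_⟩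
      conv_rhs => rw [← h.sum_smul x]
      rw [Fin.sum_univ_six, hx 3 (by decide), hx 4 (by decide), hx 5 (by decide)]
      simp [Fin.sum_univ_three]
    have heq : L = Submodule.span K (Set.range ![e 0, e 1, e 2]) :=
      Submodule.eq_of_le_of_finrank_le (fun x hx => hspan x fun m hm => hex m hm x hx) (by
        rw [hL.1]
        exact (finrank_range_le_card _).trans (by simp))
    rw [heq]
    refine hspan z fun m hm => ?_
    fin_cases m <;> simp at hm
    exacts [h3, h4, h5]

end ScrollClosure

end PerazzoCubic

/-! ### The main theorem -/

theorem mainTheorem2 {K : Type*} [Field K] [IsAlgClosed K] [CharZero K]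
    (f : MvPolynomial (Fin (5 + 1)) K) (hf : f.IsHomogeneous 3)
    (hhess : PerazzoCubic.hessian f = 0)
    (hcone : ¬ PerazzoCubic.IsCone (PerazzoCubic.hypersurface f)) :
    PerazzoCubic.IsSpecialPerazzoCubic f ∧
    PerazzoCubic.IsConic (PerazzoCubic.polarImageDual f) ∧
    PerazzoCubic.IsScrollInPlanesTangentTo (PerazzoCubic.hypersurface f)
      (PerazzoCubic.polarImageDual f) ∧
    ∃ D : MvPolynomial (Fin 3) K, D.IsHomogeneous 3 ∧
      PerazzoCubic.ProjectivelyEquivalent f (PerazzoCubic.canonicalForm D) := by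
  have hT := PerazzoCubic.isNondegSymm_polarForm hf hcone
  obtain ⟨e, d, h⟩ := PerazzoCubic.exists_normalFrame_polarForm hf hhess hcone
  exact ⟨PerazzoCubic.isSpecialPerazzoCubic_of_normalFrame hf hT h hhess hcone,
    PerazzoCubic.isConic_polarImageDual hf hT h,
    PerazzoCubic.isScrollInPlanesTangentTo_polarImageDual hf hT h,
    PerazzoCubic.exists_projectivelyEquivalent_canonicalForm hf hT h⟩
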